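/- **Setting.** Let $d\ge 1$, $[d]=\{1,\dots,d\}$, and for each $n$ let $q_1(n),\dots,q_d(n)$ be pairwise distinct positive integers with $q_k(n)\to\infty$ and $q_k(n)/N(n)\to\rho_k$ as $n\to\infty$ for all $k$, where $N(n)=q_1(n)+\cdots+q_d(n)$. Suppose that $\rho_1=0$ and $\rho_k>0$ for $k\neq 1$. Write $N(n)\times N(n)$ matrices as $d\times d$ block matrices whose $(k,l)$ block has size $q_k(n)\times q_l(n)$. For a $q_k(n)\times q_l(n)$ matrix $M$ let $\widetilde M$ be the $N(n)\times N(n)$ matrix with $(k,l)$ block $M$ and all other blocks $0$, and put $p_k(n)=\widetilde{I_{q_k(n)}}$. A *$(\rho_1,\dots,\rho_d)$-rectangular probability space* is a unital $*$-algebra $\mathcal A$ over $\mathbb C$ with non zero, pairwise orthogonal self-adjoint projectors $p_1,\dots,p_d$ of sum $1$ and tracial states $\varphi_k$ on $p_k\mathcal A p_k$ (linear, $\varphi_k(p_k)=1$, $\varphi_k(x^*x)\ge 0$, $\varphi_k(xy)=\varphi_k(yx)$) such that $\rho_k\varphi_k(xy)=\rho_l\varphi_l(yx)$ for all $k,l$,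 $x\in p_k\mathcal A p_l$, $y\in p_l\mathcal A p_k$. Put $\mathcal D=\mathrm{span}(p_1,\dots,p_d)\cong\mathbb C^d$ and $E(x)=\sum_k\varphi_k(p_kxp_k)\,p_k$. An element is *simple* if it belongs to some $p_k\mathcal A p_l$. The block matrices, with the $p_k(n)$ and the normalized traces of the diagonal blocks, form a $(q_1(n)/N(n),\dots,q_d(n)/N(n))$-rectangular probability space; let $E_n$ be its map $E$. A family $(a_j(n))_{j\in J}$ of random block matrices *converges in $\mathcal D$-distribution in probability* to a family $(a_j)_{j\in J}$ of simple elements of $\mathcal A$ if for every polynomial $P$ in the noncommuting variables $X_j,X_j^*$ ($j\in J$), with coefficients in $\mathcal D\cong\mathbb C^d$, the random vector $E_n(P(a_j(n),a_j(n)^*))\in\mathbb C^d$ converges in probability to $E(P(a_j,a_j^*))$. A family $(\mathcal B_\alpha)$ of $*$-subalgebras of $\mathcal A$ containing $\mathcal D$ is *free with amalgamation over $\mathcal D$* if $E(x_1\cdots x_m)=0$ whenever $m\ge 1$, $x_i\in\mathcal B_{\alpha_i}$, $\alpha_i\ne\alpha_{i+1}$ for $1\le i<m$, and $E(x_1)=\cdots=E(x_m)=0$.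 A family of subsets is free with amalgamation over $\mathcal D$ if the subsets are contained in $*$-subalgebras which are. **Hypotheses.** For $s\in\mathbb N$, $k,l\in[d]$ and all $n$, let $R(s,k,l,n)$ be a $q_k(n)\times q_l(n)$ complex random matrix, such that for every $n$ the family $(R(s,k,l,n))_{s,k,l}$ is independent and: * if $k\neq l$, the distribution of $R(s,k,l,n)$ is invariant under left and right multiplication by unitary matrices, its singular values are deterministic, and, as $n\to\infty$, its singular law (the uniform distribution on its $\min(q_k(n),q_l(n))$ singular values) converges weakly in probability to a deterministic probability measure; * if $s$ is odd, $R(s,k,k,n)$ is a uniform (Haar distributed) random unitary matrix; * if $s$ is even, $R(s,k,k,n)$ is hermitian, its distribution is invariant under conjugation by unitary matrices, its spectrum is deterministic, and, as $n\to\infty$, its spectral law (the uniform distribution on its spectrum, with multiplicities) converges weakly in probability to a deterministic probability measure. Let $(C(i,n))_{i\in I}$ be deterministic matrices, $C(i,n)$ being a (rectangular) diagonal $q_{k_i}(n)\times q_{l_i}(n)$ matrix. Suppose that the family is stable under products and adjoints and contains the identities of the blocks, with indices independent of $n$: for every $k$ there is $i$ with $\widetilde C(i,n)=p_k(n)$ for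 all $n$; for all $i,j$ with $l_i=k_j$ there is $m\in I$ with $\widetilde C(m,n)=\widetilde C(i,n)\widetilde C(j,n)$ for all $n$; for every $i$ there is $m\in I$ with $\widetilde C(m,n)=\widetilde C(i,n)^*$ for all $n$. Suppose that for every $i$ with $k_i=l_i$ the normalized trace of $C(i,n)$ has a finite limit as $n\to\infty$. Finally, suppose that the operator norms of all the matrices $R(s,k,l,n)$ and $C(i,n)$ are bounded by one constant, independent of $s,k,l,i,n$. **Conclusion.** There are a $(\rho_1,\dots,\rho_d)$-rectangular probability space $\mathcal A$ and simple elements $a(s,k,l)$ ($s\in\mathbb N$, $k,l\in[d]$), $c(i)$ ($i\in I$) of $\mathcal A$ such that the family $(\widetilde R(s,k,l,n))_{s,k,l}\cup(\widetilde C(i,n))_{i\in I}$ converges in $\mathcal D$-distribution in probability to $(a(s,k,l))_{s,k,l}\cup(c(i))_{i\in I}$, and the family of subsets consisting of the singletons $\{a(s,k,l)\}$ ($s\in\mathbb N$, $k,l\in[d]$) and the set $\{c(i):i\in I\}$ is free with amalgamation over $\mathcal D$. -/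

import Mathlib

open MeasureTheory Filter Topology
open scoped BigOperators ENNReal BoundedContinuousFunction

universe u v w

namespace RectFree

/-! ### Rectangular probability spaces -/

/-- A `(ρ₁, …, ρ_d)`-rectangular probability space: a `*`-algebra `A` with pairwise orthogonal
self-adjoint projectors `p k` of sum `1` (they are non zero, because `φ k (p k) = 1`), each corner
`p k A p k` carrying a tracial state `φ k`, with `ρ k φ k (x y) = ρ l φ l (y x)` for `x ∈ p k A p l`
and `y ∈ p l A p k`. The functional `φ k` of the corner `p k A p k` is encoded by its composition
with the compression `x ↦ p k x p k`, a linear functional on `A` (field `φ_corner`). -/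
structure RectSpace {d : ℕ} (ρ : Fin d → ℝ) (A : Type u) [Ring A] [StarRing A] [Algebra ℂ A]
    [StarModule ℂ A] where
  p : Fin d → A
  p_star : ∀ k, star (p k) = p k
  p_idem : ∀ k, p k * p k = p k
  p_orth : ∀ k l, k ≠ l → p k * p l = 0
  p_sum : ∑ k, p k = 1
  φ : Fin d → A →ₗ[ℂ] ℂ
  φ_corner : ∀ k x, φ k (p k * x * p k) = φ k x
  φ_one : ∀ k, φ k (p k) = 1
  φ_pos : ∀ k x, p k * x * p k = x → 0 ≤ (φ k (star x * x)).re ∧ (φ k (star x * x)).im = 0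
  φ_trace : ∀ k x y, p k * x * p k = x → p k * y * p k = y → φ k (x * y) = φ k (y * x)
  φ_rect : ∀ k l x y, p k * x * p l = x → p l * y * p k = y →
    (ρ k : ℂ) * φ k (x * y) = (ρ l : ℂ) * φ l (y * x)

/-- Symbols for non commutative polynomials with coefficients in `D`: the elements `p k` of the
canonical basis of `D`, and the variables `X j`, `X j ^*`. -/
inductive DVar (d : ℕ) (J : Type v) : Type v
  | proj : Fin d → DVar d J
  | var : J → DVar d J
  | adj : J → DVar d J

namespace RectSpace

variable {d : ℕ} {ρ : Fin d → ℝ} {A : Type u} [Ring A] [StarRing A] [Algebra ℂ A]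
  [StarModule ℂ A]

/-- The subalgebra `D`, the linear span of the projectors `p k`. -/
def diag (S : RectSpace ρ A) : StarSubalgebra ℂ A where
  carrier := {x | ∃ c : Fin d → ℂ, x = ∑ k, c k • S.p k}
  mul_mem' := by
    rintro _ _ ⟨a, rfl⟩ ⟨b, rfl⟩
    refine ⟨fun k => a k * b k, ?_⟩
    rw [Finset.sum_mul]
    refine Finset.sum_congr rfl fun k _ => ?_
    rw [Finset.mul_sum, Finset.sum_eq_single k]
    · rw [smul_mul_smul_comm, S.p_idem]
    · intro l _ hl
      rw [smul_mul_smul_comm, S.p_orth k l hl.symm, smul_zero]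
    · simp
  add_mem' := by
    rintro _ _ ⟨a, rfl⟩ ⟨b, rfl⟩
    exact ⟨fun k => a k + b k, by simp [add_smul, Finset.sum_add_distrib]⟩
  algebraMap_mem' := fun r => ⟨fun _ => r, by
    rw [← Finset.smul_sum, S.p_sum, Algebra.algebraMap_eq_smul_one]⟩
  star_mem' := by
    rintro _ ⟨a, rfl⟩
    exact ⟨fun k => star (a k), by simp [star_sum, star_smul, S.p_star]⟩

/-- The map `E : A → ℂ^d`, `E x = (φ k (x_kk))_k`, where `ℂ^d` is identified with `D`. -/
noncomputable def coordE (S : RectSpace ρ A) (x : A) : Fin d → ℂ :=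
  fun k => S.φ k (S.p k * x * S.p k)

/-- The conditional expectation `E x = ∑ k, φ k (x_kk) p k` of `A` onto `D`. -/
noncomputable def condExp (S : RectSpace ρ A) (x : A) : A :=
  ∑ k, S.coordE x k • S.p k

/-- Simple elements: the elements of the union of the `p k A p l`. -/
def IsSimple (S : RectSpace ρ A) (x : A) : Prop :=
  ∃ k l, S.p k * x * S.p l = x

/-- The value of a symbol at a family `a` of elements of `A`. -/
def symbolValue (S : RectSpace ρ A) {J : Type v} (a : J → A) : DVar d J → A
  | .proj k => S.p k
  | .var j => a j
  | .adj j => star (a j)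

/-- The `D`-distribution of a family `a`: it maps a non commutative polynomial `Q` in the
variables `X j`, `X j ^*` with coefficients in `D` to `E (Q (a j, a j ^*))`. -/
noncomputable def dDistribution (S : RectSpace ρ A) {J : Type v} (a : J → A) :
    FreeAlgebra ℂ (DVar d J) → Fin d → ℂ :=
  fun Q => S.coordE (FreeAlgebra.lift ℂ (S.symbolValue a) Q)

end RectSpace

/-! ### Freeness with amalgamation -/

section Freeness

variable {A : Type u} [Ring A] [StarRing A] [Algebra ℂ A] [StarModule ℂ A] {ι : Type v}

/-- Freeness with amalgamation over `C` (with respect to `E : A → C`) of a family of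
`*`-subalgebras containing `C`. A list `[(α₁, x₁), …, (α_m, x_m)]`, `m ≥ 1`, with consecutive
indices distinct, `x_i ∈ B α_i` and `E x_i = 0` has to satisfy `E (x₁ ⋯ x_m) = 0`. -/
def FreeSubalgebras (C : StarSubalgebra ℂ A) (E : A → A) (B : ι → StarSubalgebra ℂ A) : Prop :=
  (∀ α, C ≤ B α) ∧
  ∀ L : List (ι × A), L ≠ [] → L.IsChain (fun s t => s.1 ≠ t.1) →
    (∀ t ∈ L, t.2 ∈ B t.1 ∧ E t.2 = 0) → E (L.map Prod.snd).prod = 0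

/-- Freeness with amalgamation over `C` of a family of subsets. -/
def FreeSubsets (C : StarSubalgebra ℂ A) (E : A → A) (s : ι → Set A) : Prop :=
  ∃ B : ι → StarSubalgebra ℂ A, (∀ α, s α ⊆ B α) ∧ FreeSubalgebras C E B

end Freeness

/-! ### Block matrices -/

/-- Index set of the square matrices of size `q₁ + ⋯ + q_d`, cut into `d ^ 2` blocks. -/
abbrev BIdx {d : ℕ} (q : Fin d → ℕ) : Type := Σ k : Fin d, Fin (q k)

/-- The extension of a `q k × q l` matrix `M`: its `(k, l)` block is `M`, the others are `0`. -/
def embed {d : ℕ} {q : Fin d → ℕ} {k l : Fin d} (M : Matrix (Fin (q k)) (Fin (q l)) ℂ) :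
    Matrix (BIdx q) (BIdx q) ℂ :=
  Matrix.of fun x y =>
    if h : x.1 = k ∧ y.1 = l then
      M (Fin.cast (congrArg q h.1) x.2) (Fin.cast (congrArg q h.2) y.2)
    else 0

/-- The projector on the `k`-th block. -/
def blockProj {d : ℕ} (q : Fin d → ℕ) (k : Fin d) : Matrix (BIdx q) (BIdx q) ℂ :=
  embed (1 : Matrix (Fin (q k)) (Fin (q k)) ℂ)

lemma blockProj_eq {d : ℕ} (q : Fin d → ℕ) (k : Fin d) :
    blockProj q k = Matrix.diagonal fun x => if x.1 = k then 1 else 0 := by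
  ext ⟨a, i⟩ ⟨b, j⟩
  simp only [blockProj, embed, Matrix.of_apply, Matrix.diagonal_apply, Matrix.one_apply]
  by_cases ha : a = k
  · subst ha
    by_cases hb : b = a
    · subst hb; simp
    · have : ¬ a = b := fun h => hb h.symm
      simp [hb, this]
  · simp [ha]

lemma blockProj_mul_mul_apply {d : ℕ} (q : Fin d → ℕ) (k l : Fin d)
    (X : Matrix (BIdx q) (BIdx q) ℂ) (x y : BIdx q) :
    (blockProj q k * X * blockProj q l) x y = if x.1 = k ∧ y.1 = l then X x y else 0 := by
  rw [blockProj_eq, blockProj_eq, Matrix.mul_diagonal, Matrix.diagonal_mul]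
  by_cases h1 : x.1 = k <;> by_cases h2 : y.1 = l <;> simp [h1, h2]

/-- The normalized trace of the `k`-th diagonal block. -/
noncomputable def blockTr {d : ℕ} (q : Fin d → ℕ) (k : Fin d) :
    Matrix (BIdx q) (BIdx q) ℂ →ₗ[ℂ] ℂ where
  toFun X := (q k : ℂ)⁻¹ * ∑ i : Fin (q k), X ⟨k, i⟩ ⟨k, i⟩
  map_add' X Y := by simp [Finset.sum_add_distrib, mul_add]
  map_smul' c X := by simp [← Finset.mul_sum]; ring

/-- Block matrices form a rectangular probability space, with ratios `q k / (q₁ + ⋯ + q_d)`. -/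
noncomputable def matrixSpace {d : ℕ} (q : Fin d → ℕ) (hq : ∀ k, 0 < q k) :
    RectSpace (fun k => (q k : ℝ) / ((∑ l, q l : ℕ) : ℝ)) (Matrix (BIdx q) (BIdx q) ℂ) where
  p := blockProj q
  p_star k := by
    rw [blockProj_eq, Matrix.star_eq_conjTranspose, Matrix.diagonal_conjTranspose]
    congr 1; ext x; by_cases h : x.1 = k <;> simp [h]
  p_idem k := by
    simp [blockProj_eq]
  p_orth k l h := by
    rw [blockProj_eq, blockProj_eq, Matrix.diagonal_mul_diagonal, ← Matrix.diagonal_zero]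
    congr 1; ext x
    by_cases h1 : x.1 = k
    · simp [h1, h]
    · simp [h1]
  p_sum := by
    ext x y
    simp only [blockProj_eq, Matrix.sum_apply, Matrix.diagonal_apply, Matrix.one_apply]
    by_cases h : x = y <;> simp [h]
  φ := blockTr q
  φ_corner k x := by
    simp [blockTr, blockProj_mul_mul_apply]
  φ_one k := by
    have : (q k : ℂ) ≠ 0 := by exact_mod_cast (hq k).ne'
    simp [blockTr, blockProj_eq, this]
  φ_pos k x _ := by
    have h : blockTr q k (star x * x)
        = (((q k : ℝ)⁻¹ * ∑ i : Fin (q k), ∑ y, Complex.normSq (x y ⟨k, i⟩) : ℝ) : ℂ) := by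
      simp [blockTr, Matrix.star_eq_conjTranspose, Matrix.mul_apply, Complex.normSq_eq_conj_mul_self]
    rw [h]
    refine ⟨?_, Complex.ofReal_im _⟩
    rw [Complex.ofReal_re]
    exact mul_nonneg (by positivity)
      (Finset.sum_nonneg fun i _ => Finset.sum_nonneg fun y _ => Complex.normSq_nonneg _)
  φ_trace k x y hx hy := by
    have key : ∀ u v : Matrix (BIdx q) (BIdx q) ℂ, blockProj q k * v * blockProj q k = v →
        blockTr q k (u * v)
          = (q k : ℂ)⁻¹ * ∑ i : Fin (q k), ∑ j : Fin (q k), u ⟨k, i⟩ ⟨k, j⟩ * v ⟨k, j⟩ ⟨k, i⟩ := by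
      intro u v hv
      simp only [blockTr, LinearMap.coe_mk, AddHom.coe_mk, Matrix.mul_apply]
      congr 1
      refine Finset.sum_congr rfl fun i _ => ?_
      rw [Fintype.sum_sigma, Finset.sum_eq_single k]
      · intro b _ hb
        refine Finset.sum_eq_zero fun j _ => ?_
        rw [← hv, blockProj_mul_mul_apply]
        simp [hb]
      · simp
    rw [key x y hy, key y x hx, Finset.sum_comm]
    simp only [mul_comm]
  φ_rect k l x y hx hy := by
    have hk : (q k : ℂ) ≠ 0 := by exact_mod_cast (hq k).ne'
    have hl : (q l : ℂ) ≠ 0 := by exact_mod_cast (hq l).ne'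
    have key : ∀ (k l : Fin d) (u v : Matrix (BIdx q) (BIdx q) ℂ),
        blockProj q l * v * blockProj q k = v →
        blockTr q k (u * v)
          = (q k : ℂ)⁻¹ * ∑ i : Fin (q k), ∑ j : Fin (q l), u ⟨k, i⟩ ⟨l, j⟩ * v ⟨l, j⟩ ⟨k, i⟩ := by
      intro k l u v hv
      simp only [blockTr, LinearMap.coe_mk, AddHom.coe_mk, Matrix.mul_apply]
      congr 1
      refine Finset.sum_congr rfl fun i _ => ?_
      rw [Fintype.sum_sigma, Finset.sum_eq_single l]
      · intro b _ hb
        refine Finset.sum_eq_zero fun j _ => ?_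
        rw [← hv, blockProj_mul_mul_apply]
        simp [hb]
      · simp
    rw [key k l x y hy, key l k y x hx, Finset.sum_comm]
    push_cast
    simp only [mul_comm (x _ _)]
    field_simp

/-! ### Random matrices -/

noncomputable instance matrixMeasurableSpace {m n : Type*} : MeasurableSpace (Matrix m n ℂ) :=
  MeasurableSpace.pi

section Norm

open scoped Matrix.Norms.L2Operator

/-- The operator norm associated to the canonical hermitian norms. -/
noncomputable def opNorm {m n : ℕ} (M : Matrix (Fin m) (Fin n) ℂ) : ℝ := ‖M‖

end Norm

/-- The `i`-th (from `0`, in decreasing order) of the `min m n` singular values of an `m × n`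
matrix. -/
noncomputable def singVal {m n : ℕ} (M : Matrix (Fin m) (Fin n) ℂ) (i : Fin (min m n)) : ℝ :=
  (Matrix.toEuclideanLin M).singularValues i

/-- The singular law: the uniform distribution on the `min m n` singular values. -/
noncomputable def singularLaw {m n : ℕ} (M : Matrix (Fin m) (Fin n) ℂ) : Measure ℝ :=
  ((min m n : ℕ) : ℝ≥0∞)⁻¹ • ∑ i, Measure.dirac (singVal M i)

/-- The spectrum, with multiplicities. -/
noncomputable def spec {m : ℕ} (M : Matrix (Fin m) (Fin m) ℂ) : Multiset ℂ := M.charpoly.roots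

/-- The spectral law of a hermitian matrix: the uniform distribution on its spectrum. -/
noncomputable def spectralLaw {m : ℕ} (M : Matrix (Fin m) (Fin m) ℂ) : Measure ℝ :=
  (m : ℝ≥0∞)⁻¹ • ((spec M).map fun z => Measure.dirac z.re).sum

section Random

variable {Ω : Type v} [MeasurableSpace Ω]

/-- Convergence in probability (for the weak topology) of random measures on `ℝ` to a
deterministic one. -/
def WeakConvInProb (P : Measure Ω) (L : ℕ → Ω → Measure ℝ) (μ : Measure ℝ) : Prop :=
  ∀ f : ℝ →ᵇ ℝ, TendstoInMeasure P (fun n ω => ∫ t, f t ∂(L n ω)) atTop (fun _ => ∫ t, f t ∂μ)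

/-- The distribution is invariant under the left and right actions of the unitary groups. -/
def BiUnitarilyInvariant {m n : ℕ} (P : Measure Ω) (R : Ω → Matrix (Fin m) (Fin n) ℂ) : Prop :=
  ∀ (U : Matrix.unitaryGroup (Fin m) ℂ) (V : Matrix.unitaryGroup (Fin n) ℂ),
    P.map (fun ω => (U : Matrix (Fin m) (Fin m) ℂ) * R ω * (V : Matrix (Fin n) (Fin n) ℂ)) = P.map R

/-- The distribution is invariant under conjugation by unitary matrices. -/
def UnitarilyInvariant {m : ℕ} (P : Measure Ω) (R : Ω → Matrix (Fin m) (Fin m) ℂ) : Prop :=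
  ∀ U : Matrix.unitaryGroup (Fin m) ℂ,
    P.map (fun ω => (U : Matrix (Fin m) (Fin m) ℂ) * R ω * star (U : Matrix (Fin m) (Fin m) ℂ))
      = P.map R

/-- Uniform random unitary matrix: the distribution is the Haar probability measure. -/
def UniformUnitary {m : ℕ} (P : Measure Ω) (R : Ω → Matrix (Fin m) (Fin m) ℂ) : Prop :=
  ∃ μ : Measure (Matrix.unitaryGroup (Fin m) ℂ), μ.IsHaarMeasure ∧ IsProbabilityMeasure μ ∧
    P.map R = μ.map
      (fun U : Matrix.unitaryGroup (Fin m) ℂ => (U : Matrix (Fin m) (Fin m) ℂ))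

/-- Convergence in `D`-distribution in probability of families of random block matrices to a
family of simple elements of a rectangular probability space. -/
def DConvInProb {d : ℕ} (P : Measure Ω) (q : ℕ → Fin d → ℕ) (hq : ∀ n k, 0 < q n k)
    {J : Type w} (X : ∀ n, J → Ω → Matrix (BIdx (q n)) (BIdx (q n)) ℂ)
    {ρ : Fin d → ℝ} {A : Type u} [Ring A] [StarRing A] [Algebra ℂ A] [StarModule ℂ A]
    (S : RectSpace ρ A) (a : J → A) : Prop :=
  (∀ j, S.IsSimple (a j)) ∧
  ∀ Q : FreeAlgebra ℂ (DVar d J),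
    TendstoInMeasure P
      (fun n ω => (matrixSpace (q n) (hq n)).dDistribution (fun j => X n j ω) Q) atTop
      (fun _ => S.dDistribution a Q)

end Random

end RectFree

set_option linter.unusedSectionVars false

namespace RectFree

/-! ### Block matrices, their conditional expectation and contraction over matrix units -/

section BlockMatrices

open scoped Matrix.Norms.L2Operator

/-! The law of each random letter is invariant under conjugation by block diagonal unitary matrices,
and by independence one letter can be conjugated without moving the others. Let W and M be words.
Conjugate all the occurrences of one letter by $e^{i\theta H}$, with H block diagonal, and
differentiate the constant function $\theta \mapsto \mathbb E[tr_k(W)\, tr_k(M)]$ at 0. This gives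
an identity linear in H (`integral_bracket`).

Insert a matrix unit $e_{ba}$ of a diagonal block in W just before an occurrence x of that letter,
take $H = e_{ab}$, and sum over a, b and the blocks l with weight $1/q_l$. Since $\sum_l
q_l^{-1}\sum_{a,b} e_{ba} Z e_{ab} = E_n(Z)$, every commutator inside W contracts to the expectation
$E_n$ of a factor of W (`integral_contract`). The adjacent pair contracts to $E_n(1) = 1$ and
returns W itself. The terms where H meets M join two normalized traces into one and are $O(1/q_k)$.
With $M = W^*$, the second moment of $tr_k(W)$ is bounded by expectations of factors of W, up to
$O(1/q_k)$ (`integral_sq_blockTr_le`). If the letters of W are centered and neighbours have distinct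
indices, these factors are nonempty and, for a well chosen x, shorter than W. Induction on the
length shows that W is asymptotically centered (`isCentered_prod`): this is asymptotic freeness over
$\mathcal D$. Only $q_k \to \infty$ is used in this argument, never a ratio of block sizes, so a
vanishing $\rho_1$ does no harm there.

It remains to see that the algebra of each single letter, and that of the constants, has asymptotic
traces. For the constants this is a hypothesis, by stability under products. For hermitian letters
the traces of powers are moments of the spectral law. For a letter in an off-diagonal block they are
moments of the singular law times $\min(q_k,q_l)/q_k$, which converges because at most one ratio
vanishes. A Haar unitary a has the law of z a, where z is the diagonal matrix of roots of unity, of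
trace zero; asymptotic freeness of z and a then forces all positive powers of a to be centered
(`isCentered_letterSeq_pow`).

The limit space is not built abstractly. It is the algebra generated, inside the bounded sequences
of measurable functions of the matrices, by the projectors, the letters and the constants. Its
elements are combinations of projectors and alternating centered products, so their expected block
traces converge (`exists_hasCoord_of_mem_genAlg`), and the limits are the states $\varphi_k$. The
axioms on the states pass to the limit from block matrices, and freeness is `isCentered_prod` again.
-/

noncomputable instance matrixBorelSpace {m n : Type*} [Fintype m] [Fintype n] :
    BorelSpace (Matrix m n ℂ) :=
  inferInstanceAs (BorelSpace (m → n → ℂ))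

/-- The square matrices cut into blocks of sizes `q k`. -/
abbrev BMat {d : ℕ} (q : Fin d → ℕ) : Type := Matrix (BIdx q) (BIdx q) ℂ

variable {d : ℕ} {q : Fin d → ℕ}

/-- The conditional expectation of block matrices onto the span of the block projectors. -/
noncomputable def expD (q : Fin d → ℕ) : BMat q →ₗ[ℂ] BMat q :=
  ∑ k, (blockTr q k).smulRight (blockProj q k)

lemma expD_apply (X : BMat q) : expD q X = ∑ k, blockTr q k X • blockProj q k := by
  simp [expD]

lemma expD_eq_diagonal (X : BMat q) :
    expD q X = Matrix.diagonal fun x => blockTr q x.1 X := by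
  ext x y
  simp only [expD_apply, blockProj_eq, Matrix.sum_apply, Matrix.smul_apply,
    Matrix.diagonal_apply, smul_eq_mul]
  by_cases h : x = y <;> simp [h]

lemma norm_one_le : ‖(1 : BMat q)‖ ≤ 1 := by
  rw [← Matrix.diagonal_one, Matrix.l2_opNorm_diagonal]
  exact (pi_norm_le_iff_of_nonneg zero_le_one).2 fun _ => by simp

lemma norm_blockProj_le (k : Fin d) : ‖blockProj q k‖ ≤ 1 := by
  rw [blockProj_eq, Matrix.l2_opNorm_diagonal]
  refine (pi_norm_le_iff_of_nonneg zero_le_one).2 fun x => ?_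
  split_ifs <;> simp

lemma norm_entry_le (X : BMat q) (x y : BIdx q) : ‖X x y‖ ≤ ‖X‖ := by
  have h := Matrix.l2_opNorm_mulVec X (EuclideanSpace.single y 1)
  have h2 := PiLp.norm_apply_le (WithLp.toLp 2 (X.mulVec (EuclideanSpace.single y (1 : ℂ)))) x
  simp only [PiLp.norm_single, norm_one, mul_one] at h
  refine le_trans (le_of_eq ?_) (h2.trans h)
  simp [Matrix.mulVec, dotProduct]

lemma norm_blockTr_le (k : Fin d) (X : BMat q) : ‖blockTr q k X‖ ≤ ‖X‖ := by
  simp only [blockTr, LinearMap.coe_mk, AddHom.coe_mk, norm_mul, norm_inv, Complex.norm_natCast]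
  have h : ‖∑ i : Fin (q k), X ⟨k, i⟩ ⟨k, i⟩‖ ≤ q k * ‖X‖ := by
    refine (norm_sum_le _ _).trans ((Finset.sum_le_sum fun i _ => norm_entry_le X _ _).trans ?_)
    simp
  rcases Nat.eq_zero_or_pos (q k) with h0 | h0
  · simp [h0]
  · have : (0 : ℝ) < q k := by exact_mod_cast h0
    calc _ ≤ (q k : ℝ)⁻¹ * (q k * ‖X‖) := by gcongr
      _ = ‖X‖ := by field_simp

lemma blockTr_star (k : Fin d) (X : BMat q) :
    blockTr q k (star X) = star (blockTr q k X) := by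
  simp [blockTr, Matrix.star_apply]

lemma blockTr_diagonal (hq : ∀ k, 0 < q k) (c : Fin d → ℂ) (k : Fin d) :
    blockTr q k (Matrix.diagonal fun x => c x.1) = c k := by
  have : (q k : ℂ) ≠ 0 := by exact_mod_cast (hq k).ne'
  simp [blockTr, this]

lemma expD_one (hq : ∀ k, 0 < q k) : expD q 1 = 1 := by
  rw [expD_eq_diagonal, ← Matrix.diagonal_one]
  congr 1; ext x
  exact blockTr_diagonal hq (fun _ => 1) x.1

lemma norm_expD_le (X : BMat q) : ‖expD q X‖ ≤ ∑ k, ‖blockTr q k X‖ := by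
  rw [expD_eq_diagonal, Matrix.l2_opNorm_diagonal]
  refine (pi_norm_le_iff_of_nonneg (Finset.sum_nonneg fun _ _ => norm_nonneg _)).2 fun x => ?_
  exact Finset.single_le_sum (f := fun k => ‖blockTr q k X‖) (fun _ _ => norm_nonneg _)
    (Finset.mem_univ x.1)

lemma norm_expD_le_norm (X : BMat q) : ‖expD q X‖ ≤ ‖X‖ := by
  rw [expD_eq_diagonal, Matrix.l2_opNorm_diagonal]
  exact (pi_norm_le_iff_of_nonneg (norm_nonneg _)).2 fun x => norm_blockTr_le _ _

lemma blockTr_expD (hq : ∀ k, 0 < q k) (k : Fin d) (X : BMat q) :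
    blockTr q k (expD q X) = blockTr q k X := by
  rw [expD_eq_diagonal]
  exact blockTr_diagonal hq (fun l => blockTr q l X) k

/-- The matrix units of the `l`-th diagonal block. -/
def blockUnit (q : Fin d → ℕ) (l : Fin d) (a b : Fin (q l)) : BMat q :=
  Matrix.single ⟨l, a⟩ ⟨l, b⟩ 1

/-- The sum of `f e_{ba} e_{ab}` over the matrix units of the diagonal blocks, weighted by the
inverse sizes of the blocks. -/
noncomputable def swapSum {M : Type*} [AddCommGroup M] [Module ℂ M] (q : Fin d → ℕ)
    (f : BMat q → BMat q → M) : M :=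
  ∑ l, (q l : ℂ)⁻¹ • ∑ a, ∑ b, f (blockUnit q l b a) (blockUnit q l a b)

section swapSum

variable {M N : Type*} [AddCommGroup M] [Module ℂ M] [AddCommGroup N] [Module ℂ N]

lemma swapSum_add (f g : BMat q → BMat q → M) :
    swapSum q (fun X Y => f X Y + g X Y) = swapSum q f + swapSum q g := by
  simp [swapSum, Finset.sum_add_distrib]

lemma swapSum_sub (f g : BMat q → BMat q → M) :
    swapSum q (fun X Y => f X Y - g X Y) = swapSum q f - swapSum q g := by
  simp [swapSum, Finset.sum_sub_distrib, smul_sub]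

lemma swapSum_map (φ : M →ₗ[ℂ] N) (f : BMat q → BMat q → M) :
    swapSum q (fun X Y => φ (f X Y)) = φ (swapSum q f) := by
  simp [swapSum, map_sum]

lemma swapSum_mul_left (A : BMat q) (f : BMat q → BMat q → BMat q) :
    swapSum q (fun X Y => A * f X Y) = A * swapSum q f :=
  swapSum_map (LinearMap.mulLeft ℂ A) f

lemma swapSum_mul_right (A : BMat q) (f : BMat q → BMat q → BMat q) :
    swapSum q (fun X Y => f X Y * A) = swapSum q f * A :=
  swapSum_map (LinearMap.mulRight ℂ A) f

lemma swapSum_zero : swapSum q (fun _ _ => (0 : M)) = 0 := by simp [swapSum]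

end swapSum

lemma sum_blockUnit_self (l : Fin d) : ∑ a, blockUnit q l a a = blockProj q l := by
  ext ⟨i, x⟩ ⟨j, y⟩
  rw [Matrix.sum_apply, blockProj_eq, Matrix.diagonal_apply]
  by_cases hi : i = l
  · subst hi
    rw [Finset.sum_eq_single x]
    · simp only [blockUnit, Matrix.single_apply]
      by_cases h : (⟨i, x⟩ : BIdx q) = ⟨j, y⟩
      · rw [if_pos ⟨by simp, h⟩, if_pos h, if_pos trivial]
      · rw [if_neg fun h' => h h'.2, if_neg h]
    · intro b _ hb
      simp [blockUnit, hb]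
    · simp
  · have : ∀ a, blockUnit q l a a ⟨i, x⟩ ⟨j, y⟩ = 0 := fun a => by
      simp only [blockUnit, Matrix.single_apply]
      rw [if_neg]
      rintro ⟨h, -⟩
      exact hi (congrArg Sigma.fst h).symm
    simp [this, hi]

lemma blockUnit_mul_mul (l : Fin d) (a b : Fin (q l)) (Z : BMat q) :
    blockUnit q l b a * Z * blockUnit q l a b = Z ⟨l, a⟩ ⟨l, a⟩ • blockUnit q l b b := by
  ext x y
  simp [blockUnit, Matrix.single_mul_mul_single, Matrix.single_apply]

/-- Since $e_{ba} Z e_{ab} = Z_{aa} e_{bb}$, the sum over one block is its trace times its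
projector, and the weight `(q l)⁻¹` normalizes the trace. The weights of `swapSum` are chosen for
this: no ratio of block sizes is left. -/
lemma swapSum_mul_mul (Z : BMat q) : swapSum q (fun X Y => X * Z * Y) = expD q Z := by
  simp only [swapSum, blockUnit_mul_mul, expD_apply, blockTr, LinearMap.coe_mk, AddHom.coe_mk]
  refine Finset.sum_congr rfl fun l _ => ?_
  simp only [← Finset.smul_sum, sum_blockUnit_self, ← Finset.sum_smul, smul_smul]

lemma swapSum_comm {M : Type*} [AddCommGroup M] [Module ℂ M] (f : BMat q → BMat q → M) :
    swapSum q (fun X Y => f Y X) = swapSum q f := by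
  simp only [swapSum]
  refine Finset.sum_congr rfl fun l _ => ?_
  rw [Finset.sum_comm]

lemma swapSum_mul_mul' (Z : BMat q) : swapSum q (fun X Y => Y * Z * X) = expD q Z := by
  rw [swapSum_comm (fun X Y => X * Z * Y), swapSum_mul_mul]

lemma blockTr_eq_trace (k : Fin d) (X : BMat q) :
    blockTr q k X = (q k : ℂ)⁻¹ * (blockProj q k * X).trace := by
  simp only [blockTr, LinearMap.coe_mk, AddHom.coe_mk, Matrix.trace, Matrix.diag_apply,
    blockProj_eq, Matrix.diagonal_mul]
  congr 1
  rw [Fintype.sum_sigma, Finset.sum_eq_single k]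
  · simp
  · intro b _ hb; simp [hb]
  · simp

lemma trace_single_mul (x y : BIdx q) (Z : BMat q) :
    (Matrix.single x y (1 : ℂ) * Z).trace = Z y x := by
  rw [Matrix.trace_single_mul]; simp

lemma blockTr_mul_blockUnit_mul (k l : Fin d) (a b : Fin (q l)) (A B : BMat q) :
    blockTr q k (A * blockUnit q l b a * B)
      = (q k : ℂ)⁻¹ * (B * blockProj q k * A) ⟨l, a⟩ ⟨l, b⟩ := by
  rw [blockTr_eq_trace]
  congr 1
  rw [← mul_assoc, Matrix.trace_mul_comm, ← mul_assoc, ← mul_assoc,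
    Matrix.trace_mul_comm, blockUnit, trace_single_mul]

/-- Dual matrix units placed in two different traces join them into a single one. One of the two
normalizations remains as the factor `(q k)⁻¹`, which makes the covariance terms vanish
asymptotically. -/
lemma sum_blockTr_mul_blockTr (k l : Fin d) (A B A' B' : BMat q) :
    ∑ a, ∑ b, blockTr q k (A * blockUnit q l b a * B) * blockTr q k (A' * blockUnit q l a b * B')
      = (q k : ℂ)⁻¹ * blockTr q k
          (A * blockProj q l * B' * blockProj q k * A' * blockProj q l * B) := by
  simp only [blockTr_mul_blockUnit_mul]
  have h : ∀ Y Z : BMat q, (blockProj q l * Y * (blockProj q l * Z)).trace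
      = ∑ a, ∑ b, Y ⟨l, a⟩ ⟨l, b⟩ * Z ⟨l, b⟩ ⟨l, a⟩ := by
    intro Y Z
    simp only [Matrix.trace, Matrix.diag_apply, blockProj_eq, Matrix.mul_apply (M := _ * Y),
      Matrix.diagonal_mul]
    rw [Fintype.sum_sigma, Finset.sum_eq_single l]
    · refine Finset.sum_congr rfl fun a _ => ?_
      rw [Fintype.sum_sigma, Finset.sum_eq_single l]
      · simp
      · intro b _ hb; simp [hb]
      · simp
    · intro b _ hb; simp [hb]
    · simp
  have h2 := h (B * blockProj q k * A) (B' * blockProj q k * A')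
  rw [blockTr_eq_trace]
  have h3 : (blockProj q k * (A * blockProj q l * B' * blockProj q k * A' * blockProj q l * B)).trace
      = (blockProj q l * (B * blockProj q k * A) * (blockProj q l * (B' * blockProj q k * A'))).trace := by
    rw [show blockProj q k * (A * blockProj q l * B' * blockProj q k * A' * blockProj q l * B)
      = (blockProj q k * A * blockProj q l * B' * blockProj q k * A') * (blockProj q l * B) by
        noncomm_ring, Matrix.trace_mul_comm]
    congr 1; noncomm_ring
  rw [h3, h2, ← mul_assoc, Finset.mul_sum]
  refine Finset.sum_congr rfl fun a _ => ?_
  rw [Finset.mul_sum]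
  refine Finset.sum_congr rfl fun b _ => ?_
  ring

/-- The gain is `(q k)⁻¹`. The weight `(q l)⁻¹` is simply bounded by `1`, and `d` counts the blocks.
-/
lemma norm_swapSum_blockTr_le (hq : ∀ k, 0 < q k) (k : Fin d) (A B A' B' : BMat q) :
    ‖swapSum q (fun X Y => blockTr q k (A * X * B) * blockTr q k (A' * Y * B'))‖
      ≤ d * (q k : ℝ)⁻¹ * (‖A‖ * ‖B‖ * ‖A'‖ * ‖B'‖) := by
  simp only [swapSum, sum_blockTr_mul_blockTr]
  refine (norm_sum_le _ _).trans ?_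
  have : ∀ l ∈ Finset.univ, ‖(q l : ℂ)⁻¹ • ((q k : ℂ)⁻¹ * blockTr q k
      (A * blockProj q l * B' * blockProj q k * A' * blockProj q l * B))‖
      ≤ (q k : ℝ)⁻¹ * (‖A‖ * ‖B‖ * ‖A'‖ * ‖B'‖) := by
    intro l _
    rw [norm_smul, norm_mul, norm_inv, norm_inv, Complex.norm_natCast, Complex.norm_natCast]
    have h1 : (q l : ℝ)⁻¹ ≤ 1 := inv_le_one_of_one_le₀ (by exact_mod_cast hq l)
    have h2 : ‖blockTr q k (A * blockProj q l * B' * blockProj q k * A' * blockProj q l * B)‖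
        ≤ ‖A‖ * 1 * ‖B'‖ * 1 * ‖A'‖ * 1 * ‖B‖ := by
      refine (norm_blockTr_le _ _).trans ?_
      refine (norm_mul_le _ _).trans ?_
      gcongr
      refine (norm_mul_le _ _).trans ?_
      gcongr
      · refine (norm_mul_le _ _).trans ?_
        gcongr
        refine (norm_mul_le _ _).trans ?_
        gcongr
        · refine (norm_mul_le _ _).trans ?_
          gcongr
          refine (norm_mul_le _ _).trans ?_
          gcongr
          exact norm_blockProj_le _
        · exact norm_blockProj_le _
      · exact norm_blockProj_le _
    calc _ ≤ 1 * ((q k : ℝ)⁻¹ * (‖A‖ * 1 * ‖B'‖ * 1 * ‖A'‖ * 1 * ‖B‖)) := by gcongr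
      _ = _ := by ring
  refine (Finset.sum_le_sum this).trans ?_
  simp [mul_assoc]

end BlockMatrices

/-! ### Words with marked letters -/

section Words

variable {A : Type*} [Ring A]

/-- The product of the letters of a word. -/
def wordProd (L : List (Bool × A)) : A := (L.map Prod.snd).prod

@[simp] lemma wordProd_nil : wordProd ([] : List (Bool × A)) = 1 := rfl

@[simp] lemma wordProd_cons (f : Bool) (x : A) (L : List (Bool × A)) :
    wordProd ((f, x) :: L) = x * wordProd L := by simp [wordProd]

@[simp] lemma wordProd_append (L L' : List (Bool × A)) :
    wordProd (L ++ L') = wordProd L * wordProd L' := by simp [wordProd]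

/-- The derivative of the product of a word when the marked letters are moved by the inner
derivation of `H`. -/
def bracketWord (H : A) : List (Bool × A) → A
  | [] => 0
  | (f, x) :: L => (if f then H * x - x * H else 0) * wordProd L + x * bracketWord H L

lemma bracketWord_append (H : A) (L L' : List (Bool × A)) :
    bracketWord H (L ++ L') = bracketWord H L * wordProd L' + wordProd L * bracketWord H L' := by
  induction L with
  | nil => simp [bracketWord]
  | cons p L ih =>
    obtain ⟨f, x⟩ := p
    simp only [List.cons_append, bracketWord, ih, wordProd_append, wordProd_cons]
    noncomm_ring

lemma bracketWord_add (H H' : A) (L : List (Bool × A)) :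
    bracketWord (H + H') L = bracketWord H L + bracketWord H' L := by
  induction L with
  | nil => simp [bracketWord]
  | cons p L ih =>
    obtain ⟨f, x⟩ := p
    simp only [bracketWord, ih]
    cases f
    · simp; noncomm_ring
    · simp only [if_true]; noncomm_ring

lemma bracketWord_smul {𝕜 : Type*} [CommRing 𝕜] [Algebra 𝕜 A] (c : 𝕜) (H : A)
    (L : List (Bool × A)) : bracketWord (c • H) L = c • bracketWord H L := by
  induction L with
  | nil => simp [bracketWord]
  | cons p L ih =>
    obtain ⟨f, x⟩ := p
    simp only [bracketWord, ih]
    cases f <;> simp [smul_add, ← smul_sub]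

/-- The contraction of `X y (bracketWord Y L)` over dual bases, for a conditional expectation `E`. -/
def contractRight (E : A → A) : A → List (Bool × A) → A
  | _, [] => 0
  | y, (f, x) :: L => (if f then E y * x - E (y * x) else 0) * wordProd L
      + contractRight E (y * x) L

/-- The contraction of `(bracketWord Y L) X` over dual bases, for a conditional expectation `E`. -/
def contractLeft (E : A → A) : List (Bool × A) → A
  | [] => 0
  | (f, x) :: L => (if f then E (x * wordProd L) - x * E (wordProd L) else 0)
      + x * contractLeft E L

end Words

/-! ### Contraction of derivatives of words, and norm estimates -/

section Contraction

open scoped Matrix.Norms.L2Operator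

variable {d : ℕ} {q : Fin d → ℕ}

/-- By the Leibniz rule each marked letter `x` gives a term with `Y * x - x * Y`. In both halves the
letters enclosed between `X` and `Y` contract to their expectation. The argument `y` accumulates the
letters already passed, as the induction requires. -/
lemma swapSum_bracketWord_right (y : BMat q) (L : List (Bool × BMat q)) :
    swapSum q (fun X Y => X * y * bracketWord Y L) = contractRight (expD q) y L := by
  induction L generalizing y with
  | nil => simp [bracketWord, contractRight, swapSum_zero]
  | cons p L ih =>
    obtain ⟨f, x⟩ := p
    simp only [bracketWord, contractRight, mul_add, swapSum_add]
    rw [← ih (y * x)]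
    refine congrArg₂ (· + ·) ?_ ?_
    · cases f
      · simp [swapSum_zero]
      · simp only [if_true]
        rw [← swapSum_mul_mul y, ← swapSum_mul_mul (y * x), ← swapSum_mul_right, ← swapSum_sub,
          ← swapSum_mul_right]
        congr 1; ext1 X; ext1 Y; noncomm_ring
    · congr 1; ext1 X; ext1 Y; noncomm_ring

/-- The mirror image: here the enclosed letters are those that follow the marked one, with or
without it. -/
lemma swapSum_bracketWord_left (L : List (Bool × BMat q)) :
    swapSum q (fun X Y => bracketWord Y L * X) = contractLeft (expD q) L := by
  induction L with
  | nil => simp [bracketWord, contractLeft, swapSum_zero]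
  | cons p L ih =>
    obtain ⟨f, x⟩ := p
    simp only [bracketWord, contractLeft, add_mul, swapSum_add]
    rw [← ih]
    refine congrArg₂ (· + ·) ?_ ?_
    · cases f
      · simp [swapSum_zero]
      · simp only [if_true]
        rw [← swapSum_mul_mul' (x * wordProd L), ← swapSum_mul_mul' (wordProd L),
          ← swapSum_mul_left, ← swapSum_sub]
        congr 1; ext1 X; ext1 Y; noncomm_ring
    · rw [← swapSum_mul_left]
      congr 1; ext1 X; ext1 Y; noncomm_ring

lemma norm_wordProd_le {C : ℝ} (hC : 1 ≤ C) (L : List (Bool × BMat q))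
    (hL : ∀ p ∈ L, ‖p.2‖ ≤ C) : ‖wordProd L‖ ≤ C ^ L.length := by
  induction L with
  | nil => simpa using norm_one_le
  | cons p L ih =>
    obtain ⟨f, x⟩ := p
    simp only [List.mem_cons, forall_eq_or_imp] at hL
    rw [wordProd_cons, List.length_cons, pow_succ']
    exact (norm_mul_le _ _).trans (mul_le_mul hL.1 (ih hL.2) (norm_nonneg _) (by linarith))

lemma norm_bracketWord_le {C : ℝ} (hC : 1 ≤ C) (H : BMat q) (L : List (Bool × BMat q))
    (hL : ∀ p ∈ L, ‖p.2‖ ≤ C) : ‖bracketWord H L‖ ≤ 2 * L.length * ‖H‖ * C ^ L.length := by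
  induction L with
  | nil => simp [bracketWord]
  | cons p L ih =>
    obtain ⟨f, x⟩ := p
    simp only [List.mem_cons, forall_eq_or_imp] at hL
    have h0 : (0 : ℝ) ≤ C := by linarith
    have h1 : ‖(if f then H * x - x * H else 0)‖ ≤ 2 * ‖H‖ * C := by
      split_ifs
      · refine (norm_sub_le _ _).trans ?_
        have := norm_mul_le H x
        have := norm_mul_le x H
        have := mul_le_mul_of_nonneg_left hL.1 (norm_nonneg H)
        linarith
      · simpa using by positivity
    have h2 := norm_wordProd_le hC L hL.2
    have h3 := ih hL.2
    simp only [bracketWord, List.length_cons]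
    calc _ ≤ ‖(if f then H * x - x * H else 0)‖ * ‖wordProd L‖ + ‖x‖ * ‖bracketWord H L‖ :=
          (norm_add_le _ _).trans (add_le_add (norm_mul_le _ _) (norm_mul_le _ _))
      _ ≤ 2 * ‖H‖ * C * C ^ L.length + C * (2 * L.length * ‖H‖ * C ^ L.length) := by
          gcongr; exact hL.1
      _ = _ := by push_cast; ring

/-- Each marked letter contributes the two halves of a commutator, each bounded by
`norm_swapSum_blockTr_le`; hence the factor `2 * L.length`. -/
lemma norm_swapSum_blockTr_bracketWord_le (hq : ∀ k, 0 < q k) {C : ℝ} (hC : 1 ≤ C) (k : Fin d)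
    (A B A' : BMat q) (L : List (Bool × BMat q)) (hL : ∀ p ∈ L, ‖p.2‖ ≤ C) :
    ‖swapSum q (fun X Y => blockTr q k (A * X * B) * blockTr q k (A' * bracketWord Y L))‖
      ≤ d * (q k : ℝ)⁻¹ * (2 * L.length * (‖A‖ * ‖B‖ * ‖A'‖ * C ^ L.length)) := by
  have h0 : (0 : ℝ) ≤ C := by linarith
  induction L generalizing A' with
  | nil => simp [bracketWord, swapSum_zero]
  | cons p L ih =>
    obtain ⟨f, x⟩ := p
    simp only [List.mem_cons, forall_eq_or_imp] at hL
    have h3 := ih (A' * x) hL.2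
    have hx : ‖A' * x‖ ≤ ‖A'‖ * C := (norm_mul_le _ _).trans (by gcongr; exact hL.1)
    have hw := norm_wordProd_le hC L hL.2
    have h1 : ‖swapSum q (fun X Y => blockTr q k (A * X * B) *
        blockTr q k (A' * ((if f then Y * x - x * Y else 0) * wordProd L)))‖
        ≤ d * (q k : ℝ)⁻¹ * (2 * (‖A‖ * ‖B‖ * ‖A'‖ * C ^ (L.length + 1))) := by
      cases f
      · simp only [Bool.false_eq_true, if_false, zero_mul, mul_zero, map_zero, swapSum_zero,
          norm_zero]
        positivity
      · simp only [if_true]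
        have e : ∀ X Y : BMat q, blockTr q k (A * X * B) *
            blockTr q k (A' * ((Y * x - x * Y) * wordProd L))
            = blockTr q k (A * X * B) * blockTr q k (A' * Y * (x * wordProd L))
              - blockTr q k (A * X * B) * blockTr q k ((A' * x) * Y * wordProd L) := by
          intro X Y
          rw [← mul_sub, ← map_sub]
          congr 2; noncomm_ring
        simp only [e]
        rw [swapSum_sub]
        refine (norm_sub_le _ _).trans ((add_le_add (norm_swapSum_blockTr_le hq _ _ _ _ _)
          (norm_swapSum_blockTr_le hq _ _ _ _ _)).trans ?_)
        have h4 : ‖x * wordProd L‖ ≤ C * C ^ L.length :=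
          (norm_mul_le _ _).trans (mul_le_mul hL.1 hw (norm_nonneg _) h0)
        calc _ ≤ d * (q k : ℝ)⁻¹ * (‖A‖ * ‖B‖ * ‖A'‖ * (C * C ^ L.length))
              + d * (q k : ℝ)⁻¹ * (‖A‖ * ‖B‖ * (‖A'‖ * C) * C ^ L.length) := by gcongr
          _ = _ := by ring
    have e2 : ∀ X Y : BMat q, blockTr q k (A * X * B) * blockTr q k (A' * bracketWord Y ((f, x) :: L))
        = blockTr q k (A * X * B) *
        blockTr q k (A' * ((if f then Y * x - x * Y else 0) * wordProd L))
        + blockTr q k (A * X * B) * blockTr q k (A' * x * bracketWord Y L) := by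
      intro X Y
      rw [← mul_add, ← map_add]
      congr 2; simp only [bracketWord]; noncomm_ring
    simp only [e2]
    rw [swapSum_add]
    refine (norm_add_le _ _).trans ((add_le_add h1 h3).trans ?_)
    calc _ ≤ d * (q k : ℝ)⁻¹ * (2 * (‖A‖ * ‖B‖ * ‖A'‖ * C ^ (L.length + 1)))
          + d * (q k : ℝ)⁻¹ * (2 * L.length * (‖A‖ * ‖B‖ * (‖A'‖ * C) * C ^ L.length)) := by gcongr
      _ = _ := by simp only [List.length_cons]; push_cast; ring

end Contraction

/-! ### Schwinger–Dyson identities from unitary invariance -/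

section SchwingerDyson

open scoped Matrix.Norms.L2Operator

variable {d : ℕ} {q : Fin d → ℕ}

/-- The unitary block matrices that are block diagonal. -/
def IsBlockUnitary (U : BMat q) : Prop :=
  U ∈ unitary (BMat q) ∧ ∀ k, Commute (blockProj q k) U

/-- Evaluation at a point of a word of matrix valued functions. -/
def evalWord {X : Type*} (M : List (Bool × (X → BMat q))) (r : X) : List (Bool × BMat q) :=
  M.map fun p => (p.1, p.2 r)

/-- Conjugation of the marked letters of a word. -/
def conjWord (U : BMat q) (L : List (Bool × BMat q)) : List (Bool × BMat q) :=
  L.map fun p => (p.1, if p.1 then U * p.2 * star U else p.2)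

lemma norm_conj_unitary {U : BMat q} (hU : U ∈ unitary (BMat q)) (x : BMat q) :
    ‖U * x * star U‖ = ‖x‖ := by
  rw [CStarRing.norm_mul_mem_unitary _ (Unitary.star_mem hU), CStarRing.norm_mem_unitary_mul _ hU]

/-- The one parameter group generated by `i H`. -/
noncomputable def unitaryFlow (H : BMat q) (θ : ℝ) : BMat q :=
  NormedSpace.exp (θ • (Complex.I • H))

lemma unitaryFlow_mem {H : BMat q} (hH : IsSelfAdjoint H) (θ : ℝ) :
    unitaryFlow H θ ∈ unitary (BMat q) := by
  have h : IsSelfAdjoint (θ • H) := (IsSelfAdjoint.all θ).smul hH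
  have := (selfAdjoint.expUnitary ⟨θ • H, h⟩).2
  rw [selfAdjoint.expUnitary_coe] at this
  rwa [unitaryFlow, smul_comm]

lemma isBlockUnitary_unitaryFlow {H : BMat q} (hH : IsSelfAdjoint H)
    (hc : ∀ k, Commute (blockProj q k) H) (θ : ℝ) : IsBlockUnitary (unitaryFlow H θ) :=
  ⟨unitaryFlow_mem hH θ, fun k => (((hc k).smul_right Complex.I).smul_right θ).exp_right⟩

lemma hasDerivAt_unitaryFlow (H : BMat q) (θ : ℝ) :
    HasDerivAt (unitaryFlow H) ((Complex.I • H) * unitaryFlow H θ) θ := by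
  have h := hasDerivAt_exp_smul_const (𝕂 := ℝ) (Complex.I • H) θ
  have hc : Commute (NormedSpace.exp (θ • (Complex.I • H))) (Complex.I • H) :=
    (((Commute.refl (Complex.I • H)).smul_left θ)).exp_left
  rw [hc.eq] at h
  exact h

lemma star_unitaryFlow {H : BMat q} (hH : IsSelfAdjoint H) (θ : ℝ) :
    star (unitaryFlow H θ) = unitaryFlow (-H) θ := by
  rw [unitaryFlow, unitaryFlow, NormedSpace.star_exp]
  simp [star_smul, hH.star_eq]

lemma hasDerivAt_conj_unitaryFlow {H : BMat q} (hH : IsSelfAdjoint H) (x : BMat q) (θ : ℝ) :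
    HasDerivAt (fun θ => unitaryFlow H θ * x * star (unitaryFlow H θ))
      ((Complex.I • H) * (unitaryFlow H θ * x * star (unitaryFlow H θ))
        - (unitaryFlow H θ * x * star (unitaryFlow H θ)) * (Complex.I • H)) θ := by
  have h1 := hasDerivAt_unitaryFlow H θ
  have h2 := hasDerivAt_unitaryFlow (-H) θ
  have hc : Commute (unitaryFlow (-H) θ) (Complex.I • H) :=
    ((((Commute.refl H).smul_left Complex.I).neg_left.smul_left θ).smul_right Complex.I
      |> fun h => by simpa using h : Commute (θ • (Complex.I • (-H))) (Complex.I • H)).exp_left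
  simp only [star_unitaryFlow hH]
  refine ((h1.mul_const x).mul h2).congr_deriv ?_
  rw [smul_neg, neg_mul, mul_neg, ← hc.eq]
  noncomm_ring

lemma hasDerivAt_conjWord {H : BMat q} (hH : IsSelfAdjoint H) (L : List (Bool × BMat q)) (θ : ℝ) :
    HasDerivAt (fun θ => wordProd (conjWord (unitaryFlow H θ) L))
      (bracketWord (Complex.I • H) (conjWord (unitaryFlow H θ) L)) θ := by
  induction L with
  | nil => simpa [conjWord, bracketWord] using hasDerivAt_const θ (1 : BMat q)
  | cons p L ih =>
    obtain ⟨f, x⟩ := p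
    have e : ∀ θ, conjWord (unitaryFlow H θ) ((f, x) :: L)
      = (f, if f then unitaryFlow H θ * x * star (unitaryFlow H θ) else x)
        :: conjWord (unitaryFlow H θ) L := fun θ => rfl
    simp only [e, wordProd_cons, bracketWord]
    cases f
    · simpa using ih.const_mul x
    · simp only [if_true]
      exact (hasDerivAt_conj_unitaryFlow hH x θ).mul ih

lemma hasDerivAt_blockTr_conjWord {H : BMat q} (hH : IsSelfAdjoint H) (k : Fin d)
    (L : List (Bool × BMat q)) (θ : ℝ) :
    HasDerivAt (fun θ => blockTr q k (wordProd (conjWord (unitaryFlow H θ) L)))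
      (blockTr q k (bracketWord (Complex.I • H) (conjWord (unitaryFlow H θ) L))) θ :=
  (LinearMap.toContinuousLinearMap
    ((blockTr q k).restrictScalars ℝ)).hasFDerivAt.comp_hasDerivAt θ (hasDerivAt_conjWord hH L θ)

lemma evalWord_eq_conjWord {X : Type*} {M : List (Bool × (X → BMat q))} {U : BMat q} {τ : X → X}
    (h : ∀ p ∈ M, ∀ r, p.2 (τ r) = if p.1 then U * p.2 r * star U else p.2 r) (r : X) :
    evalWord M (τ r) = conjWord U (evalWord M r) := by
  simp only [evalWord, conjWord, List.map_map]
  refine List.map_congr_left fun p hp => ?_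
  simp [h p hp r]

/-- The adjoint of a word. -/
def starWord {X : Type*} (M : List (Bool × (X → BMat q))) : List (Bool × (X → BMat q)) :=
  (M.map fun p => (p.1, fun r => star (p.2 r))).reverse

lemma wordProd_starWord {X : Type*} (M : List (Bool × (X → BMat q))) (r : X) :
    wordProd (evalWord (starWord M) r) = star (wordProd (evalWord M r)) := by
  induction M with
  | nil => simp [starWord, evalWord]
  | cons p M ih =>
    simp only [starWord, evalWord, List.map_cons, List.reverse_cons, List.map_append,
      wordProd_append, wordProd_cons, star_mul, List.map_nil, wordProd_nil, mul_one] at ih ⊢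
    rw [ih]

variable {X : Type*} [MeasurableSpace X]

/-- The words whose letters are uniformly bounded measurable matrix valued functions. -/
def IsBddWord (C : ℝ) (M : List (Bool × (X → BMat q))) : Prop :=
  ∀ p ∈ M, Measurable p.2 ∧ ∀ r, ‖p.2 r‖ ≤ C

lemma IsBddWord.norm_le {C : ℝ} {M : List (Bool × (X → BMat q))} (hM : IsBddWord C M) (r : X) :
    ∀ p ∈ evalWord M r, ‖p.2‖ ≤ C := by
  intro p hp
  obtain ⟨p', hp', rfl⟩ := List.mem_map.1 hp
  exact (hM _ hp').2 r

lemma IsBddWord.measurable_wordProd {C : ℝ} {M : List (Bool × (X → BMat q))}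
    (hM : IsBddWord C M) : Measurable fun r => wordProd (evalWord M r) := by
  induction M with
  | nil => simp [evalWord]
  | cons p M ih =>
    simp only [evalWord, List.map_cons, wordProd_cons] at *
    exact (hM p (by simp)).1.mul (ih fun p hp => hM p (by simp [hp]))

lemma IsBddWord.measurable_bracketWord {C : ℝ} {M : List (Bool × (X → BMat q))}
    (hM : IsBddWord C M) (H : BMat q) : Measurable fun r => bracketWord H (evalWord M r) := by
  induction M with
  | nil => simp [evalWord, bracketWord]
  | cons p M ih =>
    obtain ⟨f, x⟩ := p
    have hM' : IsBddWord C M := fun p hp => hM p (by simp [hp])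
    have hx : Measurable x := (hM _ List.mem_cons_self).1
    have h1 := hM'.measurable_wordProd
    have h2 := ih hM'
    simp only [evalWord, List.map_cons, bracketWord] at *
    cases f
    · simp only [Bool.false_eq_true, if_false, zero_mul, zero_add]
      exact hx.mul h2
    · simp only [if_true]
      exact (((measurable_const.mul hx).sub (hx.mul measurable_const)).mul h1).add (hx.mul h2)

lemma measurable_blockTr (k : Fin d) : Measurable (blockTr q k) :=
  (LinearMap.continuous_of_finiteDimensional (blockTr q k)).measurable

/-- Invariance of a probability measure under the conjugation of the marked letters by block
diagonal unitary matrices. -/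
def ConjInvariant (μ : Measure X) (M : List (Bool × (X → BMat q))) : Prop :=
  ∀ U : BMat q, IsBlockUnitary U → ∃ τ : X → X, MeasurePreserving τ μ μ ∧
    ∀ p ∈ M, ∀ r, p.2 (τ r) = if p.1 then U * p.2 r * star U else p.2 r

lemma norm_wordTr_mul_bracket_le {C : ℝ} (hC : 1 ≤ C) (k : Fin d) (H : BMat q)
    {L L' : List (Bool × BMat q)} (hL : ∀ p ∈ L, ‖p.2‖ ≤ C) (hL' : ∀ p ∈ L', ‖p.2‖ ≤ C) :
    ‖blockTr q k (bracketWord H L) * blockTr q k (wordProd L')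
      + blockTr q k (wordProd L) * blockTr q k (bracketWord H L')‖
      ≤ (2 * L.length * ‖H‖ * C ^ L.length) * C ^ L'.length
        + C ^ L.length * (2 * L'.length * ‖H‖ * C ^ L'.length) := by
  have h0 : (0 : ℝ) ≤ C := by linarith
  refine (norm_add_le _ _).trans ?_
  rw [norm_mul, norm_mul]
  gcongr
  · exact (norm_blockTr_le _ _).trans (norm_bracketWord_le hC H L hL)
  · exact (norm_blockTr_le _ _).trans (norm_wordProd_le hC L' hL')
  · exact (norm_blockTr_le _ _).trans (norm_wordProd_le hC L hL)
  · exact (norm_blockTr_le _ _).trans (norm_bracketWord_le hC H L' hL')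

lemma integrable_wordTr_mul_bracket (μ : Measure X) [IsProbabilityMeasure μ] {C : ℝ} (hC : 1 ≤ C)
    (k : Fin d) (H : BMat q) {M M' : List (Bool × (X → BMat q))} (hM : IsBddWord C M)
    (hM' : IsBddWord C M') :
    Integrable (fun r => blockTr q k (bracketWord H (evalWord M r))
        * blockTr q k (wordProd (evalWord M' r))
      + blockTr q k (wordProd (evalWord M r)) * blockTr q k (bracketWord H (evalWord M' r))) μ := by
  refine Integrable.of_bound (C := (2 * M.length * ‖H‖ * C ^ M.length) * C ^ M'.length
        + C ^ M.length * (2 * M'.length * ‖H‖ * C ^ M'.length)) ?_ ?_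
  · refine (Measurable.add (Measurable.mul ?_ ?_) (Measurable.mul ?_ ?_)).aestronglyMeasurable
    · exact (measurable_blockTr k).comp (hM.measurable_bracketWord H)
    · exact (measurable_blockTr k).comp hM'.measurable_wordProd
    · exact (measurable_blockTr k).comp hM.measurable_wordProd
    · exact (measurable_blockTr k).comp (hM'.measurable_bracketWord H)
  · refine .of_forall fun r => ?_
    simpa [evalWord] using
      norm_wordTr_mul_bracket_le (q := q) hC k H (hM.norm_le r) (hM'.norm_le r)

/-- The integral of the product of the two traces does not change along the flow of `H`, so its
derivative is zero. Differentiation under the integral is allowed because bounded letters give a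
constant dominating function. -/
lemma integral_bracket_selfAdjoint (μ : Measure X) [IsProbabilityMeasure μ] {C : ℝ} (hC : 1 ≤ C)
    (k : Fin d) {M M' : List (Bool × (X → BMat q))} (hM : IsBddWord C M) (hM' : IsBddWord C M')
    (hinv : ConjInvariant μ (M ++ M')) {H : BMat q} (hH : IsSelfAdjoint H)
    (hHc : ∀ k, Commute (blockProj q k) H) :
    ∫ r, (blockTr q k (bracketWord (Complex.I • H) (evalWord M r))
        * blockTr q k (wordProd (evalWord M' r))
      + blockTr q k (wordProd (evalWord M r))
        * blockTr q k (bracketWord (Complex.I • H) (evalWord M' r))) ∂μ = 0 := by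
  set U := unitaryFlow H
  have hU : ∀ θ, IsBlockUnitary (U θ) := fun θ => isBlockUnitary_unitaryFlow hH hHc θ
  choose τ hτ hτM using fun θ => hinv (U θ) (hU θ)
  have eM : ∀ θ r, evalWord M (τ θ r) = conjWord (U θ) (evalWord M r) := fun θ r =>
    evalWord_eq_conjWord (fun p hp => hτM θ p (by simp [hp])) r
  have eM' : ∀ θ r, evalWord M' (τ θ r) = conjWord (U θ) (evalWord M' r) := fun θ r =>
    evalWord_eq_conjWord (fun p hp => hτM θ p (by simp [hp])) r
  set F : X → ℂ := fun r => blockTr q k (wordProd (evalWord M r))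
    * blockTr q k (wordProd (evalWord M' r)) with hF
  have hFm : Measurable F := ((measurable_blockTr k).comp hM.measurable_wordProd).mul
    ((measurable_blockTr k).comp hM'.measurable_wordProd)
  have hFb : ∀ r, ‖F r‖ ≤ C ^ M.length * C ^ M'.length := by
    intro r
    rw [hF, norm_mul]
    have h0 : (0 : ℝ) ≤ C := by linarith
    gcongr
    · simpa [evalWord] using
        (norm_blockTr_le _ _).trans (norm_wordProd_le (q := q) hC _ (hM.norm_le r))
    · simpa [evalWord] using
        (norm_blockTr_le _ _).trans (norm_wordProd_le (q := q) hC _ (hM'.norm_le r))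
  set G : X → ℂ := fun r => blockTr q k (bracketWord (Complex.I • H) (evalWord M r))
        * blockTr q k (wordProd (evalWord M' r))
      + blockTr q k (wordProd (evalWord M r))
        * blockTr q k (bracketWord (Complex.I • H) (evalWord M' r)) with hG
  have hGi : Integrable G μ := integrable_wordTr_mul_bracket μ hC k _ hM hM'
  have hFint : ∀ θ, ∫ r, F (τ θ r) ∂μ = ∫ r, F r ∂μ := by
    intro θ
    conv_rhs => rw [← (hτ θ).map_eq]
    rw [integral_map (hτ θ).measurable.aemeasurable hFm.aestronglyMeasurable]
  have key := hasDerivAt_integral_of_dominated_loc_of_deriv_le (𝕜 := ℝ) (μ := μ) (x₀ := (0 : ℝ))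
    (s := Set.univ) (F := fun θ r => F (τ θ r)) (F' := fun θ r => G (τ θ r))
    (bound := fun _ => (2 * M.length * ‖Complex.I • H‖ * C ^ M.length) * C ^ M'.length
        + C ^ M.length * (2 * M'.length * ‖Complex.I • H‖ * C ^ M'.length))
    Filter.univ_mem (.of_forall fun θ => (hFm.comp (hτ θ).measurable).aestronglyMeasurable)
    (Integrable.of_bound (hFm.comp (hτ 0).measurable).aestronglyMeasurable
      _ (.of_forall fun r => hFb _))
    ((hτ 0).integrable_comp hGi.aestronglyMeasurable |>.2 hGi).aestronglyMeasurable
    (.of_forall fun r θ _ => by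
      simpa [hG, evalWord] using
        norm_wordTr_mul_bracket_le (q := q) hC k _ (hM.norm_le (τ θ r)) (hM'.norm_le (τ θ r)))
    (integrable_const _)
    (.of_forall fun r θ _ => by
      simp only [hF, hG, eM, eM']
      exact (hasDerivAt_blockTr_conjWord hH k _ θ).mul (hasDerivAt_blockTr_conjWord hH k _ θ))
  have h0 := key.2
  simp only [hFint] at h0
  have h1 := h0.unique (hasDerivAt_const _ _)
  have hGm := hGi.aestronglyMeasurable
  -- The derivative at `0` is the integral of `G ∘ τ 0`. The map `τ 0` need not be the identity, but
  -- it preserves `μ`.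
  rw [← (hτ 0).map_eq, integral_map (hτ 0).measurable.aemeasurable
    (by rw [(hτ 0).map_eq]; exact hGm)]
  exact h1

/-- The derivative at the identity of the invariance under conjugation. -/
lemma integral_bracket (μ : Measure X) [IsProbabilityMeasure μ] {C : ℝ} (hC : 1 ≤ C)
    (k : Fin d) {M M' : List (Bool × (X → BMat q))} (hM : IsBddWord C M) (hM' : IsBddWord C M')
    (hinv : ConjInvariant μ (M ++ M')) {H : BMat q} (hHc : ∀ k, Commute (blockProj q k) H) :
    ∫ r, (blockTr q k (bracketWord H (evalWord M r)) * blockTr q k (wordProd (evalWord M' r))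
      + blockTr q k (wordProd (evalWord M r))
        * blockTr q k (bracketWord H (evalWord M' r))) ∂μ = 0 := by
  have hHs : ∀ k, Commute (blockProj q k) (star H) := by
    intro k
    have := (hHc k).star_star
    rwa [show star (blockProj q k) = blockProj q k by
      rw [blockProj_eq, Matrix.star_eq_conjTranspose, Matrix.diagonal_conjTranspose]
      congr 1; ext x; by_cases h : x.1 = k <;> simp [h]] at this
  have h1 := integral_bracket_selfAdjoint μ hC k hM hM' hinv (H := H + star H)
    (IsSelfAdjoint.add_star_self H) (fun k => (hHc k).add_right (hHs k))
  have h2 := integral_bracket_selfAdjoint μ hC k hM hM' hinv (H := Complex.I • (H - star H))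
    (by
      rw [IsSelfAdjoint, star_smul, star_sub, star_star, Complex.star_def, Complex.conj_I, neg_smul,
        ← smul_neg, neg_sub])
    (fun k => ((hHc k).sub_right (hHs k)).smul_right _)
  have hi1 := integrable_wordTr_mul_bracket μ hC k (Complex.I • (H + star H)) hM hM'
  have hi2 := integrable_wordTr_mul_bracket μ hC k (Complex.I • Complex.I • (H - star H)) hM hM'
  -- The identity is complex linear in `H`, and the self-adjoint directions `H + star H` and `I • (H
  -- - star H)` span `H`. The scalars also absorb the factor `I` of the flow.
  have e : H = (-(Complex.I / 2)) • (Complex.I • (H + star H))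
      + (-(1 / 2 : ℂ)) • (Complex.I • Complex.I • (H - star H)) := by
    simp only [smul_smul, smul_add, smul_sub]
    rw [show -(Complex.I / 2) * Complex.I = 1 / 2 by linear_combination (-1 / 2) * Complex.I_mul_I,
      show -(1 / 2 : ℂ) * (Complex.I * Complex.I) = 1 / 2 by
        linear_combination (-1 / 2) * Complex.I_mul_I]
    rw [add_add_sub_cancel, ← add_smul]
    norm_num
  have e2 : ∀ r, blockTr q k (bracketWord H (evalWord M r))
        * blockTr q k (wordProd (evalWord M' r))
      + blockTr q k (wordProd (evalWord M r)) * blockTr q k (bracketWord H (evalWord M' r))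
      = (-(Complex.I / 2)) * (blockTr q k (bracketWord (Complex.I • (H + star H)) (evalWord M r))
        * blockTr q k (wordProd (evalWord M' r))
      + blockTr q k (wordProd (evalWord M r))
        * blockTr q k (bracketWord (Complex.I • (H + star H)) (evalWord M' r)))
      + (-(1 / 2 : ℂ)) * (blockTr q k (bracketWord (Complex.I • Complex.I • (H - star H))
          (evalWord M r)) * blockTr q k (wordProd (evalWord M' r))
      + blockTr q k (wordProd (evalWord M r))
        * blockTr q k (bracketWord (Complex.I • Complex.I • (H - star H)) (evalWord M' r))) := by
    intro r
    have hb : ∀ L : List (Bool × BMat q), bracketWord H L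
        = (-(Complex.I / 2)) • bracketWord (Complex.I • (H + star H)) L
          + (-(1 / 2 : ℂ)) • bracketWord (Complex.I • Complex.I • (H - star H)) L := by
      intro L
      rw [← bracketWord_smul, ← bracketWord_smul, ← bracketWord_add, ← e]
    rw [hb, hb (evalWord M' r)]
    simp only [map_add, map_smul, smul_eq_mul]
    ring
  simp only [e2]
  rw [integral_add (hi1.const_mul _) (hi2.const_mul _), integral_const_mul, integral_const_mul,
    h1, h2]
  simp

lemma commute_blockUnit (l : Fin d) (a b : Fin (q l)) (k : Fin d) :
    Commute (blockProj q k) (blockUnit q l a b) := by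
  rw [Commute, SemiconjBy, blockProj_eq]
  ext x y
  rw [Matrix.diagonal_mul, Matrix.mul_diagonal]
  simp only [blockUnit, Matrix.single_apply]
  by_cases h : (⟨l, a⟩ : BIdx q) = x ∧ (⟨l, b⟩ : BIdx q) = y
  · obtain ⟨rfl, rfl⟩ := h
    simp
  · simp [h]

lemma integral_swapSum (μ : Measure X) {f : BMat q → BMat q → X → ℂ}
    (hf : ∀ l a b, Integrable (f (blockUnit q l b a) (blockUnit q l a b)) μ)
    (h0 : ∀ l a b, ∫ r, f (blockUnit q l b a) (blockUnit q l a b) r ∂μ = 0) :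
    ∫ r, swapSum q (fun Y Z => f Y Z r) ∂μ = 0 := by
  have h1 : ∀ l a, Integrable (fun r => ∑ b, f (blockUnit q l b a) (blockUnit q l a b) r) μ :=
    fun l a => integrable_finsetSum _ fun b _ => hf l a b
  have h2 : ∀ l, Integrable (fun r => ∑ a, ∑ b, f (blockUnit q l b a) (blockUnit q l a b) r) μ :=
    fun l => integrable_finsetSum _ fun a _ => h1 l a
  simp only [swapSum, smul_eq_mul]
  rw [integral_finsetSum _ fun l _ => (h2 l).const_mul _]
  refine Finset.sum_eq_zero fun l _ => ?_
  rw [integral_const_mul, integral_finsetSum _ fun a _ => h1 l a, Finset.sum_eq_zero, mul_zero]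
  intro a _
  rw [integral_finsetSum _ fun b _ => hf l a b]
  exact Finset.sum_eq_zero fun b _ => h0 l a b

lemma norm_blockUnit_le (l : Fin d) (a b : Fin (q l)) : ‖blockUnit q l a b‖ ≤ 1 := by
  have h : ‖blockUnit q l a b‖ * ‖blockUnit q l a b‖ ≤ 1 := by
    rw [← CStarRing.norm_star_mul_self, Matrix.star_eq_conjTranspose, blockUnit,
      Matrix.conjTranspose_single, Matrix.single_mul_single_same, star_one, one_mul,
      ← Matrix.diagonal_single, Matrix.l2_opNorm_diagonal]
    refine (pi_norm_le_iff_of_nonneg zero_le_one).2 fun x => ?_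
    rw [Pi.single_apply]
    split_ifs <;> simp
  nlinarith [norm_nonneg (blockUnit q l a b)]

lemma IsBddWord.append {C : ℝ} {M M' : List (Bool × (X → BMat q))} (hM : IsBddWord C M)
    (hM' : IsBddWord C M') : IsBddWord C (M ++ M') := fun p hp =>
  (List.mem_append.1 hp).elim (hM p) (hM' p)

lemma IsBddWord.cons {C : ℝ} {f : Bool} {x : X → BMat q} {M : List (Bool × (X → BMat q))}
    (hx : Measurable x) (hxC : ∀ r, ‖x r‖ ≤ C) (hM : IsBddWord C M) : IsBddWord C ((f, x) :: M) := by
  intro p hp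
  rcases List.mem_cons.1 hp with rfl | hp
  · exact ⟨hx, hxC⟩
  · exact hM p hp

/-- The sum over the matrix units of the identities `integral_bracket`. -/
lemma integral_contract (hq : ∀ k, 0 < q k) (μ : Measure X) [IsProbabilityMeasure μ] {C : ℝ}
    (hC : 1 ≤ C) (k : Fin d) {L₁ L₂ M : List (Bool × (X → BMat q))} {x : X → BMat q}
    (h₁ : IsBddWord C L₁) (hx : IsBddWord C ((true, x) :: L₂)) (hM : IsBddWord C M)
    (hinv : ConjInvariant μ ((L₁ ++ (true, x) :: L₂) ++ M)) :
    ∫ r, (blockTr q k (contractLeft (expD q) (evalWord L₁ r) * (x r * wordProd (evalWord L₂ r))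
        + wordProd (evalWord L₁ r) * ((x r - expD q (x r)) * wordProd (evalWord L₂ r)
          + contractRight (expD q) (x r) (evalWord L₂ r)))
        * blockTr q k (wordProd (evalWord M r))
      + swapSum q (fun Y Z => blockTr q k (wordProd (evalWord L₁ r) * Y
          * (x r * wordProd (evalWord L₂ r)))
          * blockTr q k (1 * bracketWord Z (evalWord M r)))) ∂μ = 0 := by
  -- The matrix unit enters the word as an unmarked letter, so the same transformations `τ` witness
  -- the invariance of the enlarged word.
  have hw : ∀ Y : BMat q, ‖Y‖ ≤ 1 → IsBddWord C (L₁ ++ (false, fun _ : X => Y) :: (true, x) :: L₂) :=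
    fun Y hY => h₁.append (IsBddWord.cons measurable_const (fun _ => hY.trans hC) hx)
  have hinv' : ∀ Y : BMat q,
      ConjInvariant μ ((L₁ ++ (false, fun _ : X => Y) :: (true, x) :: L₂) ++ M) := by
    intro Y U hU
    obtain ⟨τ, hτ, h⟩ := hinv U hU
    refine ⟨τ, hτ, fun p hp r => ?_⟩
    by_cases hp' : p = (false, fun _ : X => Y)
    · subst hp'; simp
    · refine h p ?_ r
      simp only [List.mem_append, List.mem_cons] at hp ⊢
      tauto
  have key := integral_swapSum (q := q) μ (f := fun Y Z r =>
      blockTr q k (bracketWord Z (evalWord (L₁ ++ (false, fun _ : X => Y) :: (true, x) :: L₂) r))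
        * blockTr q k (wordProd (evalWord M r))
      + blockTr q k (wordProd (evalWord (L₁ ++ (false, fun _ : X => Y) :: (true, x) :: L₂) r))
        * blockTr q k (bracketWord Z (evalWord M r)))
    (fun l a b => integrable_wordTr_mul_bracket μ hC k _ (hw _ (norm_blockUnit_le _ _ _)) hM)
    (fun l a b => integral_bracket μ hC k (hw _ (norm_blockUnit_le _ _ _)) hM (hinv' _)
      (commute_blockUnit l a b))
  rw [← key]
  congr 1; ext1 r
  rw [swapSum_add]
  refine congrArg₂ (· + ·) ?_ ?_
  -- On the right of `Y` the word starts with the marked letter `x`, and the accumulated factor is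
  -- `1`. Contraction of the adjacent pair gives `expD q 1 = 1`, so `x` itself reappears, and with
  -- it the original word.
  · have e : ∀ Y Z : BMat q,
        blockTr q k (bracketWord Z (evalWord (L₁ ++ (false, fun _ : X => Y) :: (true, x) :: L₂) r))
        * blockTr q k (wordProd (evalWord M r))
        = (LinearMap.mulRight ℂ (blockTr q k (wordProd (evalWord M r))) ∘ₗ blockTr q k)
          (bracketWord Z (evalWord L₁ r) * Y * (x r * wordProd (evalWord L₂ r))
            + wordProd (evalWord L₁ r) * (Y * 1 * bracketWord Z ((true, x r) :: evalWord L₂ r))) := by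
      intro Y Z
      simp only [LinearMap.comp_apply, LinearMap.mulRight_apply]
      congr 2
      simp only [evalWord, List.map_append, List.map_cons, bracketWord_append, wordProd_cons]
      conv_lhs => rw [bracketWord]
      simp only [Bool.false_eq_true, if_false, zero_mul, zero_add, mul_one]
      noncomm_ring
    simp only [e]
    rw [swapSum_map, swapSum_add, swapSum_mul_right, swapSum_mul_left, swapSum_bracketWord_left,
      swapSum_bracketWord_right]
    simp only [LinearMap.comp_apply, LinearMap.mulRight_apply, contractRight, if_true, expD_one hq,
      one_mul]
  · congr 1; ext1 Y; ext1 Z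
    simp only [evalWord, List.map_append, List.map_cons, wordProd_append, wordProd_cons, one_mul,
      mul_assoc]

lemma measurable_star_bmat : Measurable fun X : BMat q => star X :=
  continuous_star.measurable

lemma IsBddWord.starWord {C : ℝ} {M : List (Bool × (X → BMat q))} (hM : IsBddWord C M) :
    IsBddWord C (starWord M) := by
  intro p hp
  simp only [RectFree.starWord, List.mem_reverse, List.mem_map] at hp
  obtain ⟨p', hp', rfl⟩ := hp
  exact ⟨measurable_star_bmat.comp (hM p' hp').1, fun r => by
    simpa only [norm_star] using (hM p' hp').2 r⟩

/-- Conjugation commutes with the adjoint, so the same `τ` works. This lets the second word be the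
adjoint of the first and turns the identity into one for a second moment. -/
lemma ConjInvariant.append_starWord {μ : Measure X} {M : List (Bool × (X → BMat q))}
    (h : ConjInvariant μ M) : ConjInvariant μ (M ++ starWord M) := by
  intro U hU
  obtain ⟨τ, hτ, hM⟩ := h U hU
  refine ⟨τ, hτ, fun p hp r => ?_⟩
  rcases List.mem_append.1 hp with hp | hp
  · exact hM p hp r
  · simp only [starWord, List.mem_reverse, List.mem_map] at hp
    obtain ⟨p', hp', rfl⟩ := hp
    simp only [hM p' hp' r]
    split_ifs
    · simp only [star_mul, star_star, mul_assoc]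
    · rfl

/-- The error term in the expansion of the second moment of the trace of a word. -/
noncomputable def contractError (L₁ L₂ : List (Bool × BMat q)) (x : BMat q) : BMat q :=
  wordProd L₁ * (expD q x * wordProd L₂)
    - contractLeft (expD q) L₁ * (x * wordProd L₂) - wordProd L₁ * contractRight (expD q) x L₂

/-- Estimate of the second moment of the trace of a word around a marked letter. -/
lemma integral_sq_blockTr_le (hq : ∀ k, 0 < q k) (μ : Measure X) [IsProbabilityMeasure μ] {C : ℝ}
    (hC : 1 ≤ C) (k : Fin d) {L₁ L₂ : List (Bool × (X → BMat q))} {x : X → BMat q}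
    (h₁ : IsBddWord C L₁) (hx : IsBddWord C ((true, x) :: L₂))
    (hinv : ConjInvariant μ (L₁ ++ (true, x) :: L₂))
    (hEm : Measurable fun r => contractError (evalWord L₁ r) (evalWord L₂ r) (x r))
    (hE : Integrable (fun r => ‖contractError (evalWord L₁ r) (evalWord L₂ r) (x r)‖) μ) :
    ∫ r, ‖blockTr q k (wordProd (evalWord (L₁ ++ (true, x) :: L₂) r))‖ ^ 2 ∂μ
      ≤ C ^ (L₁.length + (L₂.length + 1))
          * ∫ r, ‖contractError (evalWord L₁ r) (evalWord L₂ r) (x r)‖ ∂μ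
        + d * (q k : ℝ)⁻¹ * (2 * (L₁.length + (L₂.length + 1) : ℕ) *
          (C ^ (L₁.length + (L₂.length + 1)) * C ^ (L₁.length + (L₂.length + 1)))) := by
  set m := L₁.length + (L₂.length + 1) with hm
  set W := L₁ ++ (true, x) :: L₂ with hW
  have hWb : IsBddWord C W := h₁.append hx
  have hWl : W.length = m := by simp [hW, hm]
  have h0 : (0 : ℝ) ≤ C := by linarith
  have key := integral_contract hq μ hC k h₁ hx hWb.starWord hinv.append_starWord
  set g : X → ℂ := fun r => blockTr q k (wordProd (evalWord W r)) with hg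
  have hgm : Measurable g := (measurable_blockTr k).comp hWb.measurable_wordProd
  have hgb : ∀ r, ‖g r‖ ≤ C ^ m := fun r => by
    have := norm_wordProd_le (q := q) hC _ (hWb.norm_le r)
    rw [evalWord, List.length_map, hWl] at this
    exact (norm_blockTr_le _ _).trans this
  set S : X → BMat q := fun r => contractError (evalWord L₁ r) (evalWord L₂ r) (x r) with hS
  set R : X → ℂ := fun r => swapSum q (fun Y Z => blockTr q k (wordProd (evalWord L₁ r) * Y
          * (x r * wordProd (evalWord L₂ r)))
          * blockTr q k (1 * bracketWord Z (evalWord (starWord W) r))) with hR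
  have hgs : ∀ r, blockTr q k (wordProd (evalWord (starWord W) r)) = star (g r) := fun r => by
    rw [wordProd_starWord, blockTr_star]
  have hRb : ∀ r, ‖R r‖ ≤ d * (q k : ℝ)⁻¹ * (2 * m * (C ^ m * C ^ m)) := by
    intro r
    have h := norm_swapSum_blockTr_bracketWord_le hq hC k (wordProd (evalWord L₁ r))
      (x r * wordProd (evalWord L₂ r)) 1 (evalWord (starWord W) r) (hWb.starWord.norm_le r)
    have hl : (evalWord (starWord W) r).length = m := by simp [evalWord, starWord, hWl]
    rw [hl] at h
    refine h.trans ?_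
    have e1 := norm_wordProd_le (q := q) hC _ (h₁.norm_le r)
    have e2 := norm_wordProd_le (q := q) hC _ (hx.norm_le r)
    simp only [evalWord, List.map_cons, wordProd_cons, List.length_map, List.length_cons] at e1 e2
    have e3 : ‖wordProd (evalWord L₁ r)‖ * ‖x r * wordProd (evalWord L₂ r)‖ * ‖(1 : BMat q)‖
        ≤ C ^ L₁.length * C ^ (L₂.length + 1) * 1 := by
      gcongr
      · exact e1
      · exact e2
      · exact norm_one_le
    rw [mul_one, ← pow_add, ← hm] at e3
    gcongr
  -- The contracted terms are the word minus `contractError`. Against the conjugate trace, the word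
  -- itself gives `‖g r‖ ^ 2`.
  have hpt : ∀ r, blockTr q k (contractLeft (expD q) (evalWord L₁ r)
        * (x r * wordProd (evalWord L₂ r))
        + wordProd (evalWord L₁ r) * ((x r - expD q (x r)) * wordProd (evalWord L₂ r)
          + contractRight (expD q) (x r) (evalWord L₂ r)))
        * blockTr q k (wordProd (evalWord (starWord W) r)) + R r
      = ((‖g r‖ ^ 2 : ℝ) : ℂ) - (blockTr q k (S r) * star (g r) - R r) := by
    intro r
    have e : contractLeft (expD q) (evalWord L₁ r) * (x r * wordProd (evalWord L₂ r))
        + wordProd (evalWord L₁ r) * ((x r - expD q (x r)) * wordProd (evalWord L₂ r)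
          + contractRight (expD q) (x r) (evalWord L₂ r)) = wordProd (evalWord W r) - S r := by
      simp only [hS, hW, contractError, evalWord, List.map_append, List.map_cons, wordProd_append,
        wordProd_cons]
      noncomm_ring
    rw [e, hgs, map_sub, sub_mul]
    have : blockTr q k (wordProd (evalWord W r)) * star (g r) = ((‖g r‖ ^ 2 : ℝ) : ℂ) := by
      rw [Complex.star_def, Complex.mul_conj, Complex.normSq_eq_norm_sq]
    rw [this]; ring
  have key2 : ∫ r, (((‖g r‖ ^ 2 : ℝ) : ℂ) - (blockTr q k (S r) * star (g r) - R r)) ∂μ = 0 := by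
    rw [← key]
    congr 1; ext1 r
    rw [← hpt]
  have hi1 : Integrable (fun r => ((‖g r‖ ^ 2 : ℝ) : ℂ)) μ := by
    refine Integrable.of_bound (C := (C ^ m) ^ 2) ?_ (.of_forall fun r => ?_)
    · exact (Complex.measurable_ofReal.comp (hgm.norm.pow_const 2)).aestronglyMeasurable
    · rw [Complex.norm_real, Real.norm_of_nonneg (by positivity)]
      have := hgb r
      gcongr
  have hRm : Measurable R := by
    have hP₁ := h₁.measurable_wordProd
    have hP₂ := hx.measurable_wordProd
    simp only [evalWord, List.map_cons, wordProd_cons] at hP₁ hP₂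
    simp only [hR, swapSum, one_mul, smul_eq_mul]
    refine Finset.measurable_sum _ fun l _ => ?_
    apply Measurable.const_mul
    refine Finset.measurable_sum _ fun a _ => ?_
    refine Finset.measurable_sum _ fun b _ => ?_
    refine Measurable.mul ?_ ?_
    · exact (measurable_blockTr (q := q) k).comp
        ((hP₁.mul_const (blockUnit q l b a)).mul hP₂)
    · exact (measurable_blockTr k).comp (hWb.starWord.measurable_bracketWord _)
  have hb : ∀ r, ‖blockTr q k (S r) * star (g r) - R r‖
      ≤ C ^ m * ‖S r‖ + d * (q k : ℝ)⁻¹ * (2 * m * (C ^ m * C ^ m)) := by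
    intro r
    refine (norm_sub_le _ _).trans (add_le_add ?_ (hRb r))
    rw [norm_mul, norm_star, mul_comm]
    exact mul_le_mul (hgb r) (norm_blockTr_le _ _) (norm_nonneg _) (by positivity)
  have hi3 : Integrable (fun r => C ^ m * ‖S r‖
      + d * (q k : ℝ)⁻¹ * (2 * m * (C ^ m * C ^ m))) μ :=
    (hE.const_mul _).add (integrable_const _)
  have hi2 : Integrable (fun r => blockTr q k (S r) * star (g r) - R r) μ := by
    refine hi3.mono' (Measurable.aestronglyMeasurable ?_) (.of_forall hb)
    exact (((measurable_blockTr k).comp hEm).mul (continuous_star.measurable.comp hgm)).sub hRm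
  rw [integral_sub hi1 hi2, sub_eq_zero] at key2
  have e : ∫ r, ‖g r‖ ^ 2 ∂μ = ‖∫ r, (blockTr q k (S r) * star (g r) - R r) ∂μ‖ := by
    have h : ∫ r, ((‖g r‖ ^ 2 : ℝ) : ℂ) ∂μ = ((∫ r, ‖g r‖ ^ 2 ∂μ : ℝ) : ℂ) := integral_ofReal
    rw [← key2, h, Complex.norm_real, Real.norm_of_nonneg
      (integral_nonneg fun r => by positivity)]
  rw [e]
  refine (norm_integral_le_integral_norm _).trans ((integral_mono hi2.norm hi3 hb).trans ?_)
  rw [integral_add (hE.const_mul _) (integrable_const _), integral_const_mul]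
  simp

end SchwingerDyson

/-! ### Bounded sequences of random matrices and asymptotic freeness -/

section Sequences

open scoped Matrix.Norms.L2Operator

/-- Sequences of matrix valued functions of a family of matrices indexed by `T`. -/
abbrev SeqAlg {d : ℕ} (q : ℕ → Fin d → ℕ) (T : Type) : Type u :=
  ∀ n : ULift.{u} ℕ, (T → BMat (q n.down)) → BMat (q n.down)

variable {d : ℕ} {q : ℕ → Fin d → ℕ} {T : Type}

/-- Conjugation of the coordinate `t`. -/
def conjCoord [DecidableEq T] {q : Fin d → ℕ} (t : T) (U : BMat q) (r : T → BMat q) : T → BMat q :=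
  Function.update r t (U * r t * star U)

lemma norm_algebraMap_le {q : Fin d → ℕ} (c : ℂ) : ‖algebraMap ℂ (BMat q) c‖ ≤ ‖c‖ := by
  rw [Algebra.algebraMap_eq_smul_one, norm_smul]
  exact mul_le_of_le_one_right (norm_nonneg _) norm_one_le

/-- The uniformly bounded sequences of measurable functions. -/
def bddAlg (q : ℕ → Fin d → ℕ) (T : Type) : StarSubalgebra ℂ (SeqAlg.{u} q T) where
  carrier := {x | (∀ n, Measurable (x n)) ∧ ∃ C, ∀ n r, ‖x n r‖ ≤ C}
  mul_mem' := by
    rintro x y ⟨hx, C, hC⟩ ⟨hy, D, hD⟩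
    refine ⟨fun n => (hx n).mul (hy n), C * D, fun n r => (norm_mul_le _ _).trans ?_⟩
    exact mul_le_mul (hC n r) (hD n r) (norm_nonneg _) ((norm_nonneg _).trans (hC n r))
  add_mem' := by
    rintro x y ⟨hx, C, hC⟩ ⟨hy, D, hD⟩
    exact ⟨fun n => (hx n).add (hy n), C + D, fun n r =>
      (norm_add_le _ _).trans (add_le_add (hC n r) (hD n r))⟩
  algebraMap_mem' c := ⟨fun n => measurable_const, ‖c‖, fun n r => norm_algebraMap_le c⟩
  star_mem' := by
    rintro x ⟨hx, C, hC⟩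
    exact ⟨fun n => measurable_star_bmat.comp (hx n), C, fun n r =>
      (norm_star (x n r)).trans_le (hC n r)⟩

/-- The sequences of functions that depend equivariantly on the coordinate `α`, and not on the
other coordinates, with respect to block diagonal conjugations. -/
def equivAlg [DecidableEq T] (q : ℕ → Fin d → ℕ) (α : Option T) :
    StarSubalgebra ℂ (SeqAlg.{u} q T) where
  carrier := {x | ∀ n t U, IsBlockUnitary U → ∀ r, x n (conjCoord t U r)
    = if α = some t then U * x n r * star U else x n r}
  mul_mem' := by
    intro x y hx hy n t U hU r
    have h : star U * U = 1 := Unitary.star_mul_self_of_mem hU.1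
    simp only [Pi.mul_apply, hx n t U hU r, hy n t U hU r]
    split_ifs
    · calc U * x n r * star U * (U * y n r * star U)
          = U * x n r * (star U * U) * y n r * star U := by noncomm_ring
        _ = U * (x n r * y n r) * star U := by rw [h]; noncomm_ring
    · rfl
  add_mem' := by
    intro x y hx hy n t U hU r
    simp only [Pi.add_apply, hx n t U hU r, hy n t U hU r]
    split_ifs
    · noncomm_ring
    · rfl
  algebraMap_mem' c := by
    intro n t U hU r
    have h : U * star U = 1 := Unitary.mul_star_self_of_mem hU.1
    simp only [Pi.algebraMap_apply, Algebra.algebraMap_eq_smul_one]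
    simp [h]
  star_mem' := by
    intro x hx n t U hU r
    simp only [Pi.star_apply, hx n t U hU r]
    split_ifs
    · simp only [star_mul, star_star, mul_assoc]
    · rfl

/-- The conditional expectation onto the span of the projectors, matrixwise. -/
noncomputable def seqExp : SeqAlg.{u} q T →ₗ[ℂ] SeqAlg.{u} q T where
  toFun x n r := expD (q n.down) (x n r)
  map_add' x y := by ext1 n; ext1 r; simp
  map_smul' c x := by ext1 n; ext1 r; simp

lemma measurable_expD {q : Fin d → ℕ} : Measurable (expD q) :=
  (LinearMap.continuous_of_finiteDimensional (expD q)).measurable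

lemma seqExp_mem_bddAlg {x : SeqAlg.{u} q T} (hx : x ∈ bddAlg q T) : seqExp x ∈ bddAlg q T :=
  ⟨fun n => measurable_expD.comp (hx.1 n), hx.2.imp fun _ hC n r =>
    (norm_expD_le_norm _).trans (hC n r)⟩

/-- The bounded sequences whose norm tends to `0` in mean. -/
def IsSmall (μ : ∀ n, Measure (T → BMat (q n))) (x : SeqAlg.{u} q T) : Prop :=
  x ∈ bddAlg q T ∧ Tendsto (fun n => ∫ r, ‖x ⟨n⟩ r‖ ∂μ n) atTop (𝓝 0)

variable {μ : ∀ n, Measure (T → BMat (q n))}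

lemma isSmall_of_le {x : SeqAlg.{u} q T} (hx : x ∈ bddAlg q T) {b : ℕ → ℝ}
    (hb : Tendsto b atTop (𝓝 0)) (h : ∀ n, ∫ r, ‖x ⟨n⟩ r‖ ∂μ n ≤ b n) : IsSmall μ x :=
  ⟨hx, squeeze_zero (fun _ => integral_nonneg fun _ => norm_nonneg _) h hb⟩

lemma isSmall_zero : IsSmall μ (0 : SeqAlg.{u} q T) :=
  ⟨zero_mem _, by simp⟩

variable [∀ n, IsProbabilityMeasure (μ n)]

lemma integrable_of_mem_bddAlg {x : SeqAlg.{u} q T} (hx : x ∈ bddAlg q T) (n : ℕ) :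
    Integrable (x ⟨n⟩) (μ n) := by
  obtain ⟨C, hC⟩ := hx.2
  exact Integrable.of_bound (hx.1 ⟨n⟩).aestronglyMeasurable C (.of_forall fun r => hC _ r)

lemma IsSmall.add {x y : SeqAlg.{u} q T} (hx : IsSmall μ x) (hy : IsSmall μ y) :
    IsSmall μ (x + y) := by
  refine isSmall_of_le (add_mem hx.1 hy.1) (by simpa using hx.2.add hy.2) fun n => ?_
  have hi := (integrable_of_mem_bddAlg (μ := μ) hx.1 n).norm
  have hi' := (integrable_of_mem_bddAlg (μ := μ) hy.1 n).norm
  rw [← integral_add hi hi']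
  exact integral_mono (integrable_of_mem_bddAlg (add_mem hx.1 hy.1) n).norm (hi.add hi')
    fun r => norm_add_le _ _

lemma IsSmall.mul_left {x y : SeqAlg.{u} q T} (hx : IsSmall μ x) (hy : y ∈ bddAlg q T) :
    IsSmall μ (y * x) := by
  obtain ⟨C, hC⟩ := hy.2
  refine isSmall_of_le (mul_mem hy hx.1) (b := fun n => C * ∫ r, ‖x ⟨n⟩ r‖ ∂μ n)
    (by simpa using hx.2.const_mul C) fun n => ?_
  rw [← integral_const_mul]
  refine integral_mono (integrable_of_mem_bddAlg (mul_mem hy hx.1) n).norm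
    ((integrable_of_mem_bddAlg hx.1 n).norm.const_mul C) fun r => (norm_mul_le _ _).trans ?_
  exact mul_le_mul_of_nonneg_right (hC _ r) (norm_nonneg _)

lemma IsSmall.mul_right {x y : SeqAlg.{u} q T} (hx : IsSmall μ x) (hy : y ∈ bddAlg q T) :
    IsSmall μ (x * y) := by
  obtain ⟨C, hC⟩ := hy.2
  refine isSmall_of_le (mul_mem hx.1 hy) (b := fun n => (∫ r, ‖x ⟨n⟩ r‖ ∂μ n) * C)
    (by simpa using hx.2.mul_const C) fun n => ?_
  rw [← integral_mul_const]
  refine integral_mono (integrable_of_mem_bddAlg (mul_mem hx.1 hy) n).norm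
    ((integrable_of_mem_bddAlg hx.1 n).norm.mul_const C) fun r => (norm_mul_le _ _).trans ?_
  exact mul_le_mul_of_nonneg_left (hC _ r) (norm_nonneg _)

lemma IsSmall.smul {x : SeqAlg.{u} q T} (hx : IsSmall μ x) (c : ℂ) : IsSmall μ (c • x) := by
  rw [← one_mul x, ← smul_mul_assoc]
  exact hx.mul_left (Subalgebra.smul_mem (bddAlg q T).toSubalgebra (one_mem _) c)

lemma IsSmall.sub {x y : SeqAlg.{u} q T} (hx : IsSmall μ x) (hy : IsSmall μ y) :
    IsSmall μ (x - y) := by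
  simpa [sub_eq_add_neg] using hx.add (hy.smul (-1))

/-- A bounded sequence is centered when the normalized traces of its diagonal blocks tend to `0`
in mean. -/
def IsCentered (μ : ∀ n, Measure (T → BMat (q n))) (x : SeqAlg.{u} q T) : Prop :=
  x ∈ bddAlg q T ∧ ∀ k, Tendsto (fun n => ∫ r, ‖blockTr (q n) k (x ⟨n⟩ r)‖ ∂μ n) atTop (𝓝 0)

lemma integrable_blockTr {x : SeqAlg.{u} q T} (hx : x ∈ bddAlg q T) (n : ℕ) (k : Fin d) :
    Integrable (fun r => blockTr (q n) k (x ⟨n⟩ r)) (μ n) := by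
  obtain ⟨C, hC⟩ := hx.2
  exact Integrable.of_bound ((measurable_blockTr k).comp (hx.1 ⟨n⟩)).aestronglyMeasurable C
    (.of_forall fun r => (norm_blockTr_le _ _).trans (hC _ r))

/-- The expectation is a scalar on each block, so its operator norm is at most the sum of the `d`
normalized traces. -/
lemma IsCentered.isSmall {x : SeqAlg.{u} q T} (hx : IsCentered μ x) : IsSmall μ (seqExp x) := by
  refine isSmall_of_le (seqExp_mem_bddAlg hx.1)
    (b := fun n => ∑ k, ∫ r, ‖blockTr (q n) k (x ⟨n⟩ r)‖ ∂μ n)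
    (by simpa using tendsto_finsetSum Finset.univ fun k _ => hx.2 k) fun n => ?_
  rw [← integral_finsetSum _ fun k _ => (integrable_blockTr hx.1 n k).norm]
  exact integral_mono (integrable_of_mem_bddAlg (seqExp_mem_bddAlg hx.1) n).norm
    (integrable_finsetSum _ fun k _ => (integrable_blockTr hx.1 n k).norm) fun r => norm_expD_le _

/-- The words at the level `n` of a word with letters in the algebra of sequences. -/
def levelWord (n : ℕ) (L : List (Bool × SeqAlg.{u} q T)) :
    List (Bool × ((T → BMat (q n)) → BMat (q n))) :=
  L.map fun p => (p.1, p.2 ⟨n⟩)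

lemma wordProd_apply (L : List (Bool × SeqAlg.{u} q T)) (n : ℕ) (r : T → BMat (q n)) :
    wordProd L ⟨n⟩ r = wordProd (evalWord (levelWord n L) r) := by
  induction L with
  | nil => rfl
  | cons p L ih =>
    simp only [levelWord, evalWord, List.map_cons, wordProd_cons] at ih ⊢
    rw [← ih, ← Pi.mul_apply, ← Pi.mul_apply, ← wordProd_cons p.1]

lemma contractRight_apply (y : SeqAlg.{u} q T) (L : List (Bool × SeqAlg.{u} q T)) (n : ℕ)
    (r : T → BMat (q n)) : contractRight seqExp y L ⟨n⟩ r
      = contractRight (expD (q n)) (y ⟨n⟩ r) (evalWord (levelWord n L) r) := by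
  induction L generalizing y with
  | nil => rfl
  | cons p L ih =>
    obtain ⟨f, x⟩ := p
    have h := ih (y * x)
    have hw := wordProd_apply L n r
    simp only [levelWord, evalWord, List.map_cons, contractRight] at h hw ⊢
    rw [Pi.add_apply, Pi.add_apply, h, Pi.mul_apply, Pi.mul_apply, hw]
    cases f <;> rfl

lemma contractLeft_apply (L : List (Bool × SeqAlg.{u} q T)) (n : ℕ)
    (r : T → BMat (q n)) : contractLeft seqExp L ⟨n⟩ r
      = contractLeft (expD (q n)) (evalWord (levelWord n L) r) := by
  induction L with
  | nil => rfl
  | cons p L ih =>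
    obtain ⟨f, x⟩ := p
    have hw := wordProd_apply L n r
    simp only [levelWord, evalWord, List.map_cons, contractLeft] at ih hw ⊢
    rw [Pi.add_apply, Pi.add_apply, Pi.mul_apply, Pi.mul_apply, ih]
    cases f
    · rfl
    · simp only [if_true]
      rw [← hw]; rfl

lemma wordProd_mem {S : StarSubalgebra ℂ (SeqAlg.{u} q T)} {L : List (Bool × SeqAlg.{u} q T)}
    (hL : ∀ p ∈ L, p.2 ∈ S) : wordProd L ∈ S := by
  refine Submonoid.list_prod_mem S.toSubalgebra.toSubmonoid fun x hx => ?_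
  obtain ⟨p, hp, rfl⟩ := List.mem_map.1 hx
  exact hL p hp

/-- Each marked letter contributes only the expectations of the factor ending just before it and of
the factor ending at it. Small sequences absorb bounded factors on both sides. -/
lemma isSmall_contractRight {y : SeqAlg.{u} q T} (hy : y ∈ bddAlg q T)
    {L : List (Bool × SeqAlg.{u} q T)} (hL : ∀ p ∈ L, p.2 ∈ bddAlg q T)
    (h : ∀ L₁ x L₂, L = L₁ ++ (true, x) :: L₂ → IsSmall μ (seqExp (y * wordProd L₁))
      ∧ IsSmall μ (seqExp (y * wordProd L₁ * x))) :
    IsSmall μ (contractRight seqExp y L) := by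
  induction L generalizing y with
  | nil => exact isSmall_zero
  | cons p L ih =>
    obtain ⟨f, x⟩ := p
    simp only [List.mem_cons, forall_eq_or_imp] at hL
    simp only [contractRight]
    refine IsSmall.add ?_ (ih (mul_mem hy hL.1) hL.2 fun L₁ z L₂ e => ?_)
    · refine IsSmall.mul_right ?_ (wordProd_mem hL.2)
      cases f
      · exact isSmall_zero
      · have := h [] x L rfl
        simp only [wordProd_nil, mul_one] at this
        exact (this.1.mul_right hL.1).sub this.2
    · have := h ((f, x) :: L₁) z L₂ (by simp [e])
      simpa only [wordProd_cons, ← mul_assoc] using this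

lemma isSmall_contractLeft
    {L : List (Bool × SeqAlg.{u} q T)} (hL : ∀ p ∈ L, p.2 ∈ bddAlg q T)
    (h : ∀ L₁ x L₂, L = L₁ ++ (true, x) :: L₂ → IsSmall μ (seqExp (x * wordProd L₂))
      ∧ IsSmall μ (seqExp (wordProd L₂))) :
    IsSmall μ (contractLeft seqExp L) := by
  induction L with
  | nil => exact isSmall_zero
  | cons p L ih =>
    obtain ⟨f, x⟩ := p
    simp only [List.mem_cons, forall_eq_or_imp] at hL
    simp only [contractLeft]
    refine IsSmall.add ?_ ((ih hL.2 fun L₁ z L₂ e => h ((f, x) :: L₁) z L₂ (by simp [e])).mul_left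
      hL.1)
    cases f
    · exact isSmall_zero
    · have := h [] x L rfl
      exact this.1.sub (this.2.mul_left hL.1)

/-- Expand the nonnegative integral of `(‖g r‖ - c) ^ 2`, where `c` is the mean of `‖g r‖`. -/
lemma sq_integral_norm_le {X : Type*} [MeasurableSpace X] (ν : Measure X) [IsProbabilityMeasure ν]
    {g : X → ℂ} (hg : Integrable g ν) (hg2 : Integrable (fun r => ‖g r‖ ^ 2) ν) :
    (∫ r, ‖g r‖ ∂ν) ^ 2 ≤ ∫ r, ‖g r‖ ^ 2 ∂ν := by
  set c := ∫ r, ‖g r‖ ∂ν with hc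
  have h : 0 ≤ ∫ r, (‖g r‖ ^ 2 - (2 * c) * ‖g r‖ + c ^ 2) ∂ν :=
    integral_nonneg fun r => by
      change 0 ≤ ‖g r‖ ^ 2 - (2 * c) * ‖g r‖ + c ^ 2
      nlinarith [sq_nonneg (‖g r‖ - c)]
  have h1 : Integrable (fun r => ‖g r‖ ^ 2 - (2 * c) * ‖g r‖) ν :=
    hg2.sub (hg.norm.const_mul _)
  rw [integral_add h1 (integrable_const _),
    integral_sub hg2 (hg.norm.const_mul _), integral_const_mul, ← hc] at h
  simp only [integral_const, probReal_univ, one_smul] at h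
  nlinarith

lemma exists_isBddWord {L : List (Bool × SeqAlg.{u} q T)} (hL : ∀ p ∈ L, p.2 ∈ bddAlg q T) :
    ∃ C, 1 ≤ C ∧ ∀ n, IsBddWord C (levelWord n L) := by
  induction L with
  | nil => exact ⟨1, le_rfl, fun n p hp => by simp [levelWord] at hp⟩
  | cons p L ih =>
    simp only [List.mem_cons, forall_eq_or_imp] at hL
    obtain ⟨C, hC, h⟩ := ih hL.2
    obtain ⟨hm, D, hD⟩ := hL.1
    refine ⟨max C D, hC.trans (le_max_left _ _), fun n => ?_⟩
    refine IsBddWord.cons (hm ⟨n⟩) (fun r => (hD _ r).trans (le_max_right _ _)) fun p' hp' => ?_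
    exact ⟨(h n p' hp').1, fun r => ((h n p' hp').2 r).trans (le_max_left _ _)⟩

variable [DecidableEq T]

/-- The marking of the letters of index `t`. -/
def markWord (t : T) (L : List (Option T × SeqAlg.{u} q T)) : List (Bool × SeqAlg.{u} q T) :=
  L.map fun p => (decide (p.1 = some t), p.2)

lemma wordProd_markWord (t : T) (L : List (Option T × SeqAlg.{u} q T)) :
    wordProd (markWord t L) = (L.map Prod.snd).prod := by
  simp [wordProd, markWord, Function.comp_def]

lemma markWord_eq_append_cons {t : T} {L : List (Option T × SeqAlg.{u} q T)}
    {L₁ L₂ : List (Bool × SeqAlg.{u} q T)} {x : SeqAlg.{u} q T}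
    (h : markWord t L = L₁ ++ (true, x) :: L₂) : ∃ L₁' L₂', L = L₁' ++ (some t, x) :: L₂'
      ∧ markWord t L₁' = L₁ ∧ markWord t L₂' = L₂ := by
  obtain ⟨L₁', L', rfl, h1, h2⟩ := List.map_eq_append_iff.1 h
  obtain ⟨⟨o, y⟩, L₂', rfl, h3, h4⟩ := List.map_eq_cons_iff.1 h2
  simp only [Prod.mk.injEq, decide_eq_true_eq] at h3
  obtain ⟨rfl, rfl⟩ := h3
  exact ⟨L₁', L₂', rfl, h1, h4⟩

/-- By equivariance, conjugating the coordinate `t` conjugates the letters of index `t` and fixes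
all the others. These are exactly the letters that `markWord` marks. -/
lemma conjInvariant_levelWord {ν : ∀ n, Measure (T → BMat (q n))}
    (hν : ∀ n t (U : BMat (q n)), IsBlockUnitary U →
      MeasurePreserving (conjCoord t U) (ν n) (ν n))
    (t : T) {L : List (Option T × SeqAlg.{u} q T)} (hL : ∀ p ∈ L, p.2 ∈ equivAlg q p.1) (n : ℕ) :
    ConjInvariant (ν n) (levelWord n (markWord t L)) := by
  intro U hU
  refine ⟨conjCoord t U, hν n t U hU, fun p hp r => ?_⟩
  simp only [levelWord, markWord, List.map_map, List.mem_map, Function.comp_apply] at hp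
  obtain ⟨p', hp', rfl⟩ := hp
  refine (hL p' hp' ⟨n⟩ t U hU r).trans ?_
  simp

/-- One step of the asymptotic freeness: a product of centered letters is centered if all the
shorter factors of the product are. -/
lemma isCentered_prod_step (hq : ∀ n k, 0 < q n k)
    (hq_top : ∀ k, Tendsto (fun n => q n k) atTop atTop)
    (hμ : ∀ n t (U : BMat (q n)), IsBlockUnitary U →
      MeasurePreserving (conjCoord t U) (μ n) (μ n))
    {t : T} {x : SeqAlg.{u} q T} {L₁ L₂ : List (Option T × SeqAlg.{u} q T)}
    (hL : ∀ p ∈ L₁ ++ (some t, x) :: L₂, p.2 ∈ equivAlg q p.1 ∧ IsCentered μ p.2)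
    (hc : (L₁ ++ (some t, x) :: L₂).IsChain fun s t => s.1 ≠ t.1)
    (ih : ∀ L', L' ≠ [] → L' <:+: L₁ ++ (some t, x) :: L₂ →
      L'.length < (L₁ ++ (some t, x) :: L₂).length → IsCentered μ (L'.map Prod.snd).prod)
    (hend : L₁ ≠ [] ∨ ∀ p ∈ L₂, p.1 ≠ some t) :
    IsCentered μ ((L₁ ++ (some t, x) :: L₂).map Prod.snd).prod := by
  have hb : ∀ p ∈ L₁ ++ (some t, x) :: L₂, p.2 ∈ bddAlg q T := fun p hp => (hL p hp).2.1
  have hbm : ∀ L' : List (Option T × SeqAlg.{u} q T), L' ⊆ L₁ ++ (some t, x) :: L₂ →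
      ∀ p ∈ markWord t L', p.2 ∈ bddAlg q T := by
    intro L' hL' p hp
    obtain ⟨p', hp', rfl⟩ := List.mem_map.1 hp
    exact hb _ (hL' hp')
  have hx : x ∈ bddAlg q T := hb (some t, x) (by simp)
  have hxs : IsSmall μ (seqExp x) := (hL (some t, x) (by simp)).2.isSmall
  have hb₁ := hbm L₁ (by simp)
  have hb₂ := hbm L₂ (fun p hp => by simp [hp])
  have hP₁ := wordProd_mem hb₁
  have hP₂ := wordProd_mem hb₂
  -- The factors that occur start at `x` and stop just before, or at, a later letter `y` of index
  -- `t`. The hypothesis `hend` prevents the factor from `x` to `y` from being the whole word, so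
  -- that the induction hypothesis applies.
  have hR : IsSmall μ (contractRight seqExp x (markWord t L₂)) := by
    refine isSmall_contractRight hx hb₂ fun M₁ y M₂ e => ?_
    obtain ⟨M₁', M₂', rfl, rfl, rfl⟩ := markWord_eq_append_cons e
    rw [wordProd_markWord]
    constructor
    · have := (ih ((some t, x) :: M₁') (by simp) ⟨L₁, (some t, y) :: M₂', by simp⟩
        (by simp; omega)).isSmall
      simpa using this
    · have := (ih ((some t, x) :: M₁' ++ [(some t, y)]) (by simp) ⟨L₁, M₂', by simp⟩ (by
        rcases hend with h | h
        · have := List.length_pos_iff.2 h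
          simp; omega
        · exact absurd rfl (h (some t, y) (by simp)))).isSmall
      simpa [mul_assoc] using this
  have hl : IsSmall μ (contractLeft seqExp (markWord t L₁)) := by
    refine isSmall_contractLeft hb₁ fun M₁ y M₂ e => ?_
    obtain ⟨M₁', M₂', rfl, rfl, rfl⟩ := markWord_eq_append_cons e
    rw [wordProd_markWord]
    constructor
    · have := (ih ((some t, y) :: M₂') (by simp) ⟨M₁', (some t, x) :: L₂, by simp⟩
        (by simp; omega)).isSmall
      simpa using this
    -- An empty factor would have expectation `1`, which is not small. The chain condition excludes
    -- it: two letters of index `t` are never adjacent.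
    · have hne : M₂' ≠ [] := by
        rintro rfl
        have h2 : ((some t, y) :: (some t, x) :: L₂).IsChain
            fun s t : Option T × SeqAlg.{u} q T => s.1 ≠ t.1 := by
          refine hc.infix ⟨M₁', [], by simp⟩
        simp at h2
      exact (ih M₂' hne ⟨M₁' ++ [(some t, y)], (some t, x) :: L₂, by simp⟩
        (by simp; omega)).isSmall
  set S : SeqAlg.{u} q T := wordProd (markWord t L₁) * (seqExp x * wordProd (markWord t L₂))
    - contractLeft seqExp (markWord t L₁) * (x * wordProd (markWord t L₂))
    - wordProd (markWord t L₁) * contractRight seqExp x (markWord t L₂) with hSdef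
  have hS : IsSmall μ S :=
    (((hxs.mul_right hP₂).mul_left hP₁).sub (hl.mul_right (mul_mem hx hP₂))).sub (hR.mul_left hP₁)
  have eS : ∀ n r, contractError (evalWord (levelWord n (markWord t L₁)) r)
      (evalWord (levelWord n (markWord t L₂)) r) (x ⟨n⟩ r) = S ⟨n⟩ r := by
    intro n r
    simp only [hSdef, contractError, Pi.sub_apply, Pi.mul_apply, wordProd_apply,
      contractLeft_apply, contractRight_apply]
    rfl
  obtain ⟨C, hC, hCb⟩ := exists_isBddWord (hbm _ (List.Subset.refl _))
  have eW : markWord t (L₁ ++ (some t, x) :: L₂)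
      = markWord t L₁ ++ (true, x) :: markWord t L₂ := by simp [markWord]
  have hW : ((L₁ ++ (some t, x) :: L₂).map Prod.snd).prod ∈ bddAlg q T := by
    rw [← wordProd_markWord t]
    exact wordProd_mem (hbm _ (List.Subset.refl _))
  refine ⟨hW, fun k => ?_⟩
  set m := L₁.length + (L₂.length + 1) with hmdef
  have hbound : ∀ n, ∫ r, ‖blockTr (q n) k (((L₁ ++ (some t, x) :: L₂).map Prod.snd).prod ⟨n⟩ r)‖ ^ 2
      ∂μ n ≤ C ^ m * ∫ r, ‖S ⟨n⟩ r‖ ∂μ n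
        + d * (q n k : ℝ)⁻¹ * (2 * (m : ℕ) * (C ^ m * C ^ m)) := by
    intro n
    have hCn := hCb n
    have hinv := conjInvariant_levelWord hμ t (fun p hp => (hL p hp).1) n
    rw [eW] at hCn hinv
    simp only [levelWord, List.map_append, List.map_cons] at hCn hinv
    have h := integral_sq_blockTr_le (hq n) (μ n) hC k
      (L₁ := levelWord n (markWord t L₁)) (L₂ := levelWord n (markWord t L₂)) (x := x ⟨n⟩)
      (fun p hp => hCn p (List.mem_append_left _ hp))
      (fun p hp => hCn p (List.mem_append_right _ hp)) hinv
      (by simpa only [eS] using hS.1.1 ⟨n⟩)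
      (by simpa only [eS] using (integrable_of_mem_bddAlg hS.1 n).norm)
    simp only [eS] at h
    rw [← wordProd_markWord t, eW]
    simp only [wordProd_apply]
    simpa [levelWord, markWord, hmdef] using h
  have hlim : Tendsto (fun n => C ^ m * ∫ r, ‖S ⟨n⟩ r‖ ∂μ n
      + d * (q n k : ℝ)⁻¹ * (2 * (m : ℕ) * (C ^ m * C ^ m))) atTop (𝓝 0) := by
    have h1 : Tendsto (fun n => (q n k : ℝ)⁻¹) atTop (𝓝 0) :=
      tendsto_inv_atTop_zero.comp (tendsto_natCast_atTop_atTop.comp (hq_top k))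
    simpa using (hS.2.const_mul (C ^ m)).add ((h1.const_mul (d : ℝ)).mul_const _)
  have hsq := squeeze_zero (fun n => integral_nonneg fun _ => by positivity) hbound hlim
  have hroot := (Real.continuous_sqrt.tendsto 0).comp hsq
  rw [Real.sqrt_zero] at hroot
  refine squeeze_zero (fun _ => integral_nonneg fun _ => norm_nonneg _) (fun n => ?_) hroot
  refine Real.le_sqrt_of_sq_le (sq_integral_norm_le (μ n) (integrable_blockTr hW n k) ?_)
  obtain ⟨D, hD⟩ := hW.2
  refine Integrable.of_bound (C := D ^ 2)
    (((measurable_blockTr k).comp (hW.1 ⟨n⟩)).norm.pow_const 2).aestronglyMeasurable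
    (.of_forall fun r => ?_)
  rw [Real.norm_of_nonneg (by positivity)]
  have := (norm_blockTr_le k _).trans (hD ⟨n⟩ r)
  gcongr

/-- Asymptotic freeness: a product of centered letters, with distinct consecutive indices, is
centered. -/
theorem isCentered_prod (hq : ∀ n k, 0 < q n k)
    (hq_top : ∀ k, Tendsto (fun n => q n k) atTop atTop)
    (hμ : ∀ n t (U : BMat (q n)), IsBlockUnitary U →
      MeasurePreserving (conjCoord t U) (μ n) (μ n))
    (L : List (Option T × SeqAlg.{u} q T)) (hne : L ≠ [])
    (hc : L.IsChain fun s t => s.1 ≠ t.1)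
    (hL : ∀ p ∈ L, p.2 ∈ equivAlg q p.1 ∧ IsCentered μ p.2) :
    IsCentered μ (L.map Prod.snd).prod := by
  induction hm : L.length using Nat.strong_induction_on generalizing L with
  | _ m ih =>
    have ih' : ∀ L', L' ≠ [] → L' <:+: L → L'.length < L.length →
        IsCentered μ (L'.map Prod.snd).prod := fun L' h1 h2 h3 =>
      ih _ (hm ▸ h3) L' h1 (hc.infix h2) (fun p hp => hL p (h2.subset hp)) rfl
    have step := fun (t : T) (x : SeqAlg.{u} q T) (L₁ L₂ : List (Option T × SeqAlg.{u} q T))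
      (e : L = L₁ ++ (some t, x) :: L₂) (h : L₁ ≠ [] ∨ ∀ p ∈ L₂, p.1 ≠ some t) =>
      show IsCentered μ (L.map Prod.snd).prod by
        subst e
        exact isCentered_prod_step hq hq_top hμ hL hc ih' h
    -- A letter of index `some t` in second or third position has a nonempty prefix, as the step
    -- requires. As no two adjacent indices are `none`, the words of length at least two without
    -- such a letter have the form `[some t, none]`; there no later letter has index `t`.
    match L, hne, hc, hL, step with
    | [(o, x)], _, _, hL, _ => simpa using (hL (o, x) (by simp)).2
    | [(o, x), (some t, y)], _, _, _, step =>
      exact step t y [(o, x)] [] rfl (Or.inl (by simp))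
    | [(none, x), (none, y)], _, hc, _, _ => simp at hc
    | [(some t, x), (none, y)], _, _, _, step =>
      exact step t x [] [(none, y)] rfl (Or.inr (by simp))
    | p₁ :: (some t, y) :: p₃ :: L, _, _, _, step =>
      exact step t y [p₁] (p₃ :: L) rfl (Or.inl (by simp))
    | p₁ :: (none, y) :: (some t, z) :: L, _, _, _, step =>
      exact step t z [p₁, (none, y)] L rfl (Or.inl (by simp))
    | p₁ :: (none, y) :: (none, z) :: L, _, hc, _, _ => simp at hc

end Sequences

/-! ### Asymptotic conditional expectations and spans of alternating products -/

section Limit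

open scoped Matrix.Norms.L2Operator

variable {d : ℕ} {q : ℕ → Fin d → ℕ} {T : Type}

/-- The sequence of the projectors on the `k`-th block. -/
def seqProj (q : ℕ → Fin d → ℕ) (T : Type) (k : Fin d) : SeqAlg.{u} q T :=
  fun n _ => blockProj (q n.down) k

/-- The elements of the span of the projectors. -/
def seqDiag (q : ℕ → Fin d → ℕ) (T : Type) (c : Fin d → ℂ) : SeqAlg.{u} q T :=
  ∑ k, c k • seqProj q T k

lemma seqDiag_apply (c : Fin d → ℂ) (n : ULift.{u} ℕ) (r : T → BMat (q n.down)) :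
    seqDiag q T c n r = ∑ k, c k • blockProj (q n.down) k := by
  simp [seqDiag, Finset.sum_apply, seqProj]

lemma seqDiag_single (k : Fin d) (z : ℂ) :
    seqDiag.{u} q T (Pi.single k z) = z • seqProj q T k := by
  rw [seqDiag, Finset.sum_eq_single k] <;> simp +contextual

lemma seqDiag_add (c c' : Fin d → ℂ) :
    seqDiag.{u} q T (c + c') = seqDiag q T c + seqDiag q T c' := by
  simp [seqDiag, add_smul, Finset.sum_add_distrib]

lemma seqDiag_smul (z : ℂ) (c : Fin d → ℂ) :
    seqDiag.{u} q T (z • c) = z • seqDiag q T c := by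
  simp [seqDiag, Finset.smul_sum, smul_smul]

lemma seqDiag_mem {S : StarSubalgebra ℂ (SeqAlg.{u} q T)} (hS : ∀ k, seqProj q T k ∈ S)
    (c : Fin d → ℂ) : seqDiag q T c ∈ S :=
  sum_mem fun k _ => S.toSubalgebra.smul_mem (hS k) _

lemma seqProj_mem_bddAlg (k : Fin d) : seqProj.{u} q T k ∈ bddAlg q T :=
  ⟨fun _ => measurable_const, 1, fun _ _ => norm_blockProj_le k⟩

variable (hq : ∀ n k, 0 < q n k)

section

variable {q : Fin d → ℕ}

lemma blockTr_blockProj (hq : ∀ k, 0 < q k) (k l : Fin d) :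
    blockTr q k (blockProj q l) = if l = k then 1 else 0 := by
  rw [blockProj_eq, blockTr_diagonal hq (fun x => if x = l then 1 else 0)]
  simp [eq_comm]

lemma blockTr_sum_blockProj (hq : ∀ k, 0 < q k) (c : Fin d → ℂ) (k : Fin d) :
    blockTr q k (∑ l, c l • blockProj q l) = c k := by
  simp [map_sum, blockTr_blockProj hq]

lemma blockTr_blockProj_mul (k l : Fin d) (X : BMat q) :
    blockTr q k (blockProj q l * X) = if l = k then blockTr q k X else 0 := by
  rw [blockProj_eq]
  simp only [blockTr, LinearMap.coe_mk, AddHom.coe_mk, Matrix.diagonal_mul]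
  by_cases h : l = k
  · simp [h]
  · have h' : ¬k = l := fun h' => h h'.symm
    simp [h, h']

lemma blockTr_mul_blockProj (k l : Fin d) (X : BMat q) :
    blockTr q k (X * blockProj q l) = if l = k then blockTr q k X else 0 := by
  rw [blockProj_eq]
  simp only [blockTr, LinearMap.coe_mk, AddHom.coe_mk, Matrix.mul_diagonal]
  by_cases h : l = k
  · simp [h]
  · have h' : ¬k = l := fun h' => h h'.symm
    simp [h, h']

end

variable {μ : ∀ n, Measure (T → BMat (q n))} [∀ n, IsProbabilityMeasure (μ n)]

lemma isCentered_zero : IsCentered μ (0 : SeqAlg.{u} q T) := ⟨zero_mem _, by simp⟩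

lemma IsCentered.add {x y : SeqAlg.{u} q T} (hx : IsCentered μ x) (hy : IsCentered μ y) :
    IsCentered μ (x + y) := by
  refine ⟨add_mem hx.1 hy.1, fun k => squeeze_zero (fun _ => integral_nonneg fun _ => norm_nonneg _)
    (fun n => ?_) (by simpa using (hx.2 k).add (hy.2 k))⟩
  have h1 := (integrable_blockTr (μ := μ) hx.1 n k).norm
  have h2 := (integrable_blockTr (μ := μ) hy.1 n k).norm
  rw [← integral_add h1 h2]
  refine integral_mono (integrable_blockTr (add_mem hx.1 hy.1) n k).norm (h1.add h2) fun r => ?_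
  simp only [Pi.add_apply, map_add]
  exact norm_add_le _ _

lemma IsCentered.smul {x : SeqAlg.{u} q T} (hx : IsCentered μ x) (c : ℂ) :
    IsCentered μ (c • x) := by
  refine ⟨(bddAlg q T).toSubalgebra.smul_mem hx.1 c, fun k => ?_⟩
  simpa [integral_const_mul] using (hx.2 k).const_mul ‖c‖

lemma isCentered_of_blockTr_le {x y : SeqAlg.{u} q T} (hx : IsCentered μ x) (hy : y ∈ bddAlg q T)
    (h : ∀ n k r, ‖blockTr (q n) k (y ⟨n⟩ r)‖ ≤ ‖blockTr (q n) k (x ⟨n⟩ r)‖) : IsCentered μ y :=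
  ⟨hy, fun k => squeeze_zero (fun _ => integral_nonneg fun _ => norm_nonneg _)
    (fun n => integral_mono (integrable_blockTr hy n k).norm (integrable_blockTr hx.1 n k).norm
      fun r => h n k r) (hx.2 k)⟩

lemma IsCentered.proj_mul {x : SeqAlg.{u} q T} (hx : IsCentered μ x) (k : Fin d) :
    IsCentered μ (seqProj q T k * x) := by
  refine isCentered_of_blockTr_le hx (mul_mem (seqProj_mem_bddAlg k) hx.1) fun n l r => ?_
  change ‖blockTr (q n) l (blockProj (q n) k * x ⟨n⟩ r)‖ ≤ _
  rw [blockTr_blockProj_mul]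
  split_ifs <;> simp

/-- The sequence `x` has the asymptotic conditional expectation `∑ k, c k p k`. -/
def HasCoord (μ : ∀ n, Measure (T → BMat (q n))) (x : SeqAlg.{u} q T) (c : Fin d → ℂ) : Prop :=
  IsCentered μ (x - seqDiag q T c)

lemma HasCoord.add {x y : SeqAlg.{u} q T} {c c' : Fin d → ℂ} (hx : HasCoord μ x c)
    (hy : HasCoord μ y c') : HasCoord μ (x + y) (c + c') := by
  rw [HasCoord, seqDiag_add, add_sub_add_comm]
  exact IsCentered.add hx hy

lemma HasCoord.smul {x : SeqAlg.{u} q T} {c : Fin d → ℂ} (hx : HasCoord μ x c) (z : ℂ) :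
    HasCoord μ (z • x) (z • c) := by
  rw [HasCoord, seqDiag_smul, ← smul_sub]
  exact IsCentered.smul hx z

lemma hasCoord_seqDiag (c : Fin d → ℂ) : HasCoord μ (seqDiag.{u} q T c) c := by
  rw [HasCoord, sub_self]
  exact isCentered_zero

lemma HasCoord.mem_bddAlg {x : SeqAlg.{u} q T} {c : Fin d → ℂ} (hx : HasCoord μ x c) :
    x ∈ bddAlg q T := by
  have := add_mem hx.1 (seqDiag_mem seqProj_mem_bddAlg c)
  rwa [sub_add_cancel] at this

lemma IsCentered.hasCoord {x : SeqAlg.{u} q T} (hx : IsCentered μ x) : HasCoord μ x 0 := by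
  simpa [HasCoord, seqDiag] using hx

lemma HasCoord.isCentered {x : SeqAlg.{u} q T} (hx : HasCoord μ x 0) : IsCentered μ x := by
  simpa [HasCoord, seqDiag] using hx

include hq

/-- The difference from the diagonal element tends to zero in mean, so the coordinates are limits of
expected traces. This determines them uniquely. -/
lemma HasCoord.tendsto {x : SeqAlg.{u} q T} {c : Fin d → ℂ} (hx : HasCoord μ x c) (k : Fin d) :
    Tendsto (fun n => ∫ r, blockTr (q n) k (x ⟨n⟩ r) ∂μ n) atTop (𝓝 (c k)) := by
  rw [tendsto_iff_norm_sub_tendsto_zero]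
  refine squeeze_zero (fun _ => norm_nonneg _) (fun n => ?_) (hx.2 k)
  have hi := integrable_blockTr (μ := μ) hx.mem_bddAlg n k
  have : (∫ r, blockTr (q n) k (x ⟨n⟩ r) ∂μ n) - c k
      = ∫ r, blockTr (q n) k ((x - seqDiag q T c) ⟨n⟩ r) ∂μ n := by
    simp only [Pi.sub_apply, seqDiag_apply, map_sub, blockTr_sum_blockProj (hq n)]
    rw [integral_sub hi (integrable_const _)]
    simp
  rw [this]
  exact norm_integral_le_integral_norm _

lemma HasCoord.unique {x : SeqAlg.{u} q T} {c c' : Fin d → ℂ} (hx : HasCoord μ x c)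
    (hx' : HasCoord μ x c') : c = c' := by
  ext k
  exact tendsto_nhds_unique (hx.tendsto hq k) (hx'.tendsto hq k)

omit hq

variable [DecidableEq T] (B : Option T → StarSubalgebra ℂ (SeqAlg.{u} q T))

/-- The algebra generated by a family of algebras. -/
noncomputable def genAlg : StarSubalgebra ℂ (SeqAlg.{u} q T) := StarAlgebra.adjoin ℂ (⋃ α, (B α : Set _))

lemma le_genAlg (α : Option T) : B α ≤ genAlg B := fun _ hx =>
  StarAlgebra.subset_adjoin ℂ _ (Set.mem_iUnion.2 ⟨α, hx⟩)

/-- The products of centered elements with distinct consecutive indices. -/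
def alternatingProducts (μ : ∀ n, Measure (T → BMat (q n))) : Set (SeqAlg.{u} q T) :=
  {x | ∃ L : List (Option T × SeqAlg.{u} q T), L ≠ [] ∧ L.IsChain (fun s t => s.1 ≠ t.1) ∧
    (∀ p ∈ L, p.2 ∈ B p.1 ∧ IsCentered μ p.2) ∧ (L.map Prod.snd).prod = x}

/-- The span of the projectors and of the alternating products. -/
def alternatingSpan (μ : ∀ n, Measure (T → BMat (q n))) : Submodule ℂ (SeqAlg.{u} q T) :=
  Submodule.span ℂ (Set.range (seqProj q T) ∪ alternatingProducts B μ)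

variable {B} (hBproj : ∀ α k, seqProj q T k ∈ B α)
  (hBcoord : ∀ α, ∀ x ∈ B α, ∃ c, HasCoord μ x c)

lemma seqDiag_mem_alternatingSpan (c : Fin d → ℂ) : seqDiag q T c ∈ alternatingSpan B μ :=
  Submodule.sum_mem _ fun k _ => Submodule.smul_mem _ _ (Submodule.subset_span (Or.inl ⟨k, rfl⟩))

-- The projectors are absorbed by the first letter, which stays in its algebra and stays centered:
-- multiplication by `p k` keeps one block trace and kills the others.
include hBproj in
lemma seqDiag_mul_mem {x : SeqAlg.{u} q T} (hx : x ∈ alternatingProducts B μ) (c : Fin d → ℂ) :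
    seqDiag q T c * x ∈ alternatingSpan B μ := by
  rw [seqDiag, Finset.sum_mul]
  refine Submodule.sum_mem _ fun k _ => ?_
  rw [smul_mul_assoc]
  refine Submodule.smul_mem _ _ (Submodule.subset_span (Or.inr ?_))
  obtain ⟨L, hne, hc, hL, rfl⟩ := hx
  match L, hne, hc, hL with
  | (α, y) :: L, _, hc, hL =>
    refine ⟨(α, seqProj q T k * y) :: L, by simp, ?_, ?_, by simp [mul_assoc]⟩
    · exact List.isChain_cons.2 (List.isChain_cons.1 hc)
    · intro p hp
      rcases List.mem_cons.1 hp with rfl | hp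
      · have := hL (α, y) (by simp)
        exact ⟨mul_mem (hBproj α k) this.1, this.2.proj_mul k⟩
      · exact hL p (by simp [hp])

include hBproj hBcoord

/-- Every element of `B α` is a centered element of `B α` plus an element of the diagonal. If the
product begins with a letter of the same algebra, the two are merged before this splitting;
otherwise the new centered factor lengthens the alternating product. -/
lemma mul_mem_alternatingSpan {α : Option T} {x : SeqAlg.{u} q T} (hx : x ∈ B α)
    {y : SeqAlg.{u} q T} (hy : y ∈ alternatingSpan B μ) : x * y ∈ alternatingSpan B μ := by
  have hsplit : ∀ z ∈ B α, ∃ c, ∃ z' ∈ B α, IsCentered μ z' ∧ z = z' + seqDiag q T c := by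
    intro z hz
    obtain ⟨c, hc⟩ := hBcoord α z hz
    exact ⟨c, _, sub_mem hz (seqDiag_mem (hBproj α) c), hc, by simp⟩
  refine Submodule.span_induction (p := fun y _ => x * y ∈ alternatingSpan B μ) ?_ ?_ ?_ ?_ hy
  · rintro y (⟨k, rfl⟩ | hy)
    · obtain ⟨c, z, hz, hz', e⟩ := hsplit _ (mul_mem hx (hBproj α k))
      rw [e]
      refine add_mem (Submodule.subset_span (Or.inr ?_)) (seqDiag_mem_alternatingSpan c)
      exact ⟨[(α, z)], by simp, by simp, by simp [hz, hz'], by simp⟩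
    · have hy' := hy
      obtain ⟨L, hne, hc, hL, rfl⟩ := hy
      match L, hne, hc, hL with
      | (β, y) :: L, _, hc, hL =>
        by_cases h : α = β
        · subst h
          have hyB := (hL (α, y) (by simp)).1
          obtain ⟨c, z, hz, hz', e⟩ := hsplit _ (mul_mem hx hyB)
          simp only [List.map_cons, List.prod_cons]
          rw [← mul_assoc, e, add_mul]
          refine add_mem (Submodule.subset_span (Or.inr ⟨(α, z) :: L, by simp, ?_, ?_, by simp⟩)) ?_
          · exact List.isChain_cons.2 (List.isChain_cons.1 hc)
          · intro p hp
            rcases List.mem_cons.1 hp with rfl | hp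
            · exact ⟨hz, hz'⟩
            · exact hL p (by simp [hp])
          -- The diagonal part of the merged letter is left in front of the tail. An empty tail is
          -- not an alternating product and is treated apart.
          · by_cases hn : L = []
            · subst hn
              simpa using seqDiag_mem_alternatingSpan c
            · exact seqDiag_mul_mem hBproj
                ⟨L, hn, hc.tail, fun p hp => hL p (by simp [hp]), rfl⟩ c
        · obtain ⟨c, z, hz, hz', e⟩ := hsplit _ hx
          rw [e, add_mul]
          refine add_mem (Submodule.subset_span (Or.inr
            ⟨(α, z) :: (β, y) :: L, by simp, ?_, ?_, by simp⟩)) (seqDiag_mul_mem hBproj hy' c)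
          · exact List.isChain_cons_cons.2 ⟨h, hc⟩
          · intro p hp
            rcases List.mem_cons.1 hp with rfl | hp
            · exact ⟨hz, hz'⟩
            · exact hL p hp
  · simp
  · intro y z _ _ h1 h2
    rw [mul_add]; exact add_mem h1 h2
  · intro c y _ h
    rw [mul_smul_comm]; exact Submodule.smul_mem _ _ h

/-- The span contains `1` and is stable under left multiplication by each `B α`, hence by the whole
generated algebra. -/
lemma genAlg_le_alternatingSpan {x : SeqAlg.{u} q T} (hx : x ∈ genAlg B) :
    x ∈ alternatingSpan B μ := by
  -- Each `B α` is closed under `star`, so adjoining the adjoints of the generators adds nothing.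
  have hs : (genAlg B).toSubalgebra = Algebra.adjoin ℂ (⋃ α, (B α : Set _)) := by
    rw [genAlg, StarAlgebra.adjoin_toSubalgebra]
    congr 1
    refine Set.union_eq_self_of_subset_right ?_
    intro x hx
    rw [Set.mem_star, Set.mem_iUnion] at hx
    obtain ⟨α, hα⟩ := hx
    refine Set.mem_iUnion.2 ⟨α, ?_⟩
    have := star_mem hα
    rwa [star_star] at this
  have hx' : x ∈ Algebra.adjoin ℂ (⋃ α, (B α : Set (SeqAlg.{u} q T))) := by
    rw [← hs]; exact hx
  have key : ∀ y ∈ alternatingSpan B μ, x * y ∈ alternatingSpan B μ := by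
    refine Algebra.adjoin_induction (p := fun x _ => ∀ y ∈ alternatingSpan B μ,
      x * y ∈ alternatingSpan B μ) ?_ ?_ ?_ ?_ hx'
    · intro x hx y hy
      obtain ⟨α, hα⟩ := Set.mem_iUnion.1 hx
      exact mul_mem_alternatingSpan hBproj hBcoord hα hy
    · intro c y hy
      rw [← Algebra.smul_def]
      exact Submodule.smul_mem _ _ hy
    · intro x z _ _ h1 h2 y hy
      rw [add_mul]; exact add_mem (h1 y hy) (h2 y hy)
    · intro x z _ _ h1 h2 y hy
      rw [mul_assoc]; exact h1 _ (h2 y hy)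
  have h1 : (1 : SeqAlg.{u} q T) = seqDiag q T 1 := by
    ext1 n; ext1 r
    rw [seqDiag_apply]
    simp only [Pi.one_apply, one_smul]
    ext i j
    simp only [blockProj_eq, Matrix.sum_apply, Matrix.diagonal_apply, Matrix.one_apply]
    by_cases h : i = j <;> simp [h]
  have := key _ (seqDiag_mem_alternatingSpan (B := B) (μ := μ) 1)
  rwa [← h1, mul_one] at this

include hq in
/-- Every element of the algebra generated by asymptotically free algebras has an asymptotic
conditional expectation. -/
theorem exists_hasCoord_of_mem_genAlg
    (hq_top : ∀ k, Tendsto (fun n => q n k) atTop atTop)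
    (hμ : ∀ n t (U : BMat (q n)), IsBlockUnitary U →
      MeasurePreserving (conjCoord t U) (μ n) (μ n))
    (hBeq : ∀ α, B α ≤ equivAlg q α)
    {x : SeqAlg.{u} q T} (hx : x ∈ genAlg B) : ∃ c, HasCoord μ x c := by
  have := genAlg_le_alternatingSpan hBproj hBcoord hx
  refine Submodule.span_induction (p := fun y _ => ∃ c, HasCoord μ y c) ?_ ?_ ?_ ?_ this
  · rintro y (⟨k, rfl⟩ | ⟨L, hne, hc, hL, rfl⟩)
    · refine ⟨Pi.single k 1, ?_⟩
      rw [← one_smul ℂ (seqProj q T k), ← seqDiag_single]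
      exact hasCoord_seqDiag _
    · exact ⟨0, (isCentered_prod hq hq_top hμ L hne hc fun p hp =>
        ⟨hBeq _ (hL p hp).1, (hL p hp).2⟩).hasCoord⟩
  · exact ⟨0, isCentered_zero.hasCoord⟩
  · rintro y z _ _ ⟨c, h⟩ ⟨c', h'⟩
    exact ⟨_, h.add h'⟩
  · rintro z y _ ⟨c, h⟩
    exact ⟨_, h.smul z⟩

end Limit

/-! ### The limit rectangular probability space and freeness in it -/

section LimitSpace

open scoped Matrix.Norms.L2Operator

variable {d : ℕ} {q : ℕ → Fin d → ℕ} {T : Type} [DecidableEq T]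

lemma blockTr_corner {q : Fin d → ℕ} (k : Fin d) (X : BMat q) :
    blockTr q k (blockProj q k * X * blockProj q k) = blockTr q k X := by
  rw [blockTr_mul_blockProj, if_pos rfl, blockTr_blockProj_mul, if_pos rfl]

/-- Algebras of equivariant sequences with asymptotic conditional expectations, for probability
measures that are invariant under block diagonal conjugations of each coordinate. -/
structure AsympFree (q : ℕ → Fin d → ℕ) (ρ : Fin d → ℝ) (μ : ∀ n, Measure (T → BMat (q n)))
    (B : Option T → StarSubalgebra ℂ (SeqAlg.{u} q T)) : Prop where
  prob : ∀ n, IsProbabilityMeasure (μ n)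
  pos : ∀ n k, 0 < q n k
  top : ∀ k, Tendsto (fun n => q n k) atTop atTop
  ratio : ∀ k, Tendsto (fun n => (q n k : ℝ) / ((∑ l, q n l : ℕ) : ℝ)) atTop (𝓝 (ρ k))
  inv : ∀ n t (U : BMat (q n)), IsBlockUnitary U → MeasurePreserving (conjCoord t U) (μ n) (μ n)
  proj : ∀ α k, seqProj q T k ∈ B α
  coord : ∀ α, ∀ x ∈ B α, ∃ c, HasCoord μ x c
  equiv : ∀ α, B α ≤ equivAlg q α

namespace AsympFree

variable {ρ : Fin d → ℝ} {μ : ∀ n, Measure (T → BMat (q n))}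
  {B : Option T → StarSubalgebra ℂ (SeqAlg.{u} q T)} (h : AsympFree q ρ μ B)

include h

lemma exists_hasCoord (x : genAlg B) : ∃ c, HasCoord μ (x : SeqAlg.{u} q T) c :=
  have := h.prob
  exists_hasCoord_of_mem_genAlg h.pos h.proj h.coord h.top h.inv h.equiv x.2

/-- The coordinates of the asymptotic conditional expectation. -/
noncomputable def limCoord (x : genAlg B) : Fin d → ℂ := (h.exists_hasCoord x).choose

lemma hasCoord (x : genAlg B) : HasCoord μ (x : SeqAlg.{u} q T) (h.limCoord x) :=
  (h.exists_hasCoord x).choose_spec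

lemma limCoord_eq {x : genAlg B} {c : Fin d → ℂ} (hc : HasCoord μ (x : SeqAlg.{u} q T) c) :
    h.limCoord x = c :=
  have := h.prob
  (h.hasCoord x).unique h.pos hc

lemma tendsto (x : genAlg B) (k : Fin d) :
    Tendsto (fun n => ∫ r, blockTr (q n) k ((x : SeqAlg.{u} q T) ⟨n⟩ r) ∂μ n) atTop
      (𝓝 (h.limCoord x k)) :=
  have := h.prob
  (h.hasCoord x).tendsto h.pos k

/-- The projectors of the limit space. -/
def limProj (k : Fin d) : genAlg B := ⟨seqProj q T k, le_genAlg B none (h.proj none k)⟩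

lemma limCoord_limProj (k : Fin d) : h.limCoord (h.limProj k) = Pi.single k 1 := by
  have := h.prob
  refine h.limCoord_eq ?_
  change HasCoord μ (seqProj q T k) _
  rw [← one_smul ℂ (seqProj q T k), ← seqDiag_single]
  exact hasCoord_seqDiag _

lemma limProj_apply (k : Fin d) (n : ULift.{u} ℕ) (r : T → BMat (q n.down)) :
    (h.limProj k : SeqAlg.{u} q T) n r = blockProj (q n.down) k := rfl

lemma coe_apply_injective {x y : genAlg B}
    (hxy : ∀ n r, (x : SeqAlg.{u} q T) n r = (y : SeqAlg.{u} q T) n r) : x = y :=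
  Subtype.ext (funext fun n => funext fun r => hxy n r)

/-- The limit rectangular probability space. -/
noncomputable def limitSpace : RectSpace ρ (genAlg B) where
  p := h.limProj
  p_star k := h.coe_apply_injective fun n _ => (matrixSpace (q n.down) (h.pos n.down)).p_star k
  p_idem k := h.coe_apply_injective fun n _ => (matrixSpace (q n.down) (h.pos n.down)).p_idem k
  p_orth k l hkl := h.coe_apply_injective fun n _ =>
    (matrixSpace (q n.down) (h.pos n.down)).p_orth k l hkl
  p_sum := h.coe_apply_injective fun n r => by
    have := (matrixSpace (q n.down) (h.pos n.down)).p_sum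
    simp only [AddSubmonoidClass.coe_finsetSum, Finset.sum_apply, limProj_apply]
    exact this
  φ k :=
    { toFun := fun x => h.limCoord x k
      map_add' := fun x y => by
        have := h.prob
        rw [h.limCoord_eq ((h.hasCoord x).add (h.hasCoord y))]; rfl
      map_smul' := fun c x => by
        have := h.prob
        rw [h.limCoord_eq ((h.hasCoord x).smul c)]; rfl }
  -- Apart from the normalization, the axioms on `φ` hold for block matrices at every `n` and every
  -- point, hence after integration, hence in the limit.
  φ_corner k x := by
    refine tendsto_nhds_unique (h.tendsto (h.limProj k * x * h.limProj k) k) ?_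
    refine (h.tendsto x k).congr fun n => ?_
    congr 1; ext1 r
    exact (blockTr_corner k _).symm
  φ_one k := by
    change h.limCoord (h.limProj k) k = 1
    rw [h.limCoord_limProj, Pi.single_eq_same]
  φ_pos k x hx := by
    have hpt : ∀ n r, blockTr (q n) k (((star x * x : genAlg B) : SeqAlg.{u} q T) ⟨n⟩ r)
        = ((blockTr (q n) k (((star x * x : genAlg B) : SeqAlg.{u} q T) ⟨n⟩ r)).re : ℂ) ∧
        0 ≤ (blockTr (q n) k (((star x * x : genAlg B) : SeqAlg.{u} q T) ⟨n⟩ r)).re := by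
      intro n r
      have e : blockProj (q n) k * (x : SeqAlg.{u} q T) ⟨n⟩ r * blockProj (q n) k
          = (x : SeqAlg.{u} q T) ⟨n⟩ r :=
        congrFun (congrFun (congrArg Subtype.val hx) ⟨n⟩) r
      have := (matrixSpace (q n) (h.pos n)).φ_pos k _ e
      exact ⟨Complex.ext rfl this.2, this.1⟩
    have ht := h.tendsto (star x * x) k
    have e : ∀ n, ∫ r, blockTr (q n) k (((star x * x : genAlg B) : SeqAlg.{u} q T) ⟨n⟩ r) ∂μ n
        = ((∫ r, (blockTr (q n) k (((star x * x : genAlg B) : SeqAlg.{u} q T) ⟨n⟩ r)).re ∂μ n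
          : ℝ) : ℂ) := by
      intro n
      rw [← integral_complex_ofReal]
      congr 1; ext1 r
      exact (hpt n r).1
    simp only [e] at ht
    have hre := (Complex.continuous_re.tendsto _).comp ht
    have him := (Complex.continuous_im.tendsto _).comp ht
    refine ⟨ge_of_tendsto' hre fun n => ?_, tendsto_nhds_unique him ?_⟩
    · exact integral_nonneg fun r => (hpt n r).2
    · simp only [Function.comp_def, Complex.ofReal_im]
      exact tendsto_const_nhds
  φ_trace k x y hx hy := by
    refine tendsto_nhds_unique (h.tendsto (x * y) k) ((h.tendsto (y * x) k).congr fun n => ?_)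
    congr 1; ext1 r
    exact ((matrixSpace (q n) (h.pos n)).φ_trace k _ _
      (congrFun (congrFun (congrArg Subtype.val hx) ⟨n⟩) r)
      (congrFun (congrFun (congrArg Subtype.val hy) ⟨n⟩) r)).symm
  φ_rect k l x y hx hy := by
    -- The ratios of the matrix spaces converge to `ρ`. No division by `ρ k` occurs, so the limit is
    -- legitimate even where it vanishes.
    have hk := ((Complex.continuous_ofReal.tendsto _).comp (h.ratio k)).mul (h.tendsto (x * y) k)
    have hl := ((Complex.continuous_ofReal.tendsto _).comp (h.ratio l)).mul (h.tendsto (y * x) l)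
    refine tendsto_nhds_unique hk (hl.congr fun n => ?_)
    simp only [Function.comp_apply]
    rw [← integral_const_mul, ← integral_const_mul]
    congr 1; ext1 r
    exact ((matrixSpace (q n) (h.pos n)).φ_rect k l _ _
      (congrFun (congrFun (congrArg Subtype.val hx) ⟨n⟩) r)
      (congrFun (congrFun (congrArg Subtype.val hy) ⟨n⟩) r)).symm

lemma coordE_limitSpace (x : genAlg B) : h.limitSpace.coordE x = h.limCoord x := by
  ext k
  exact h.limitSpace.φ_corner k x

/-- Coordinates are unique, so a diagonal element that vanishes in the algebra has zero
coefficients. This translates the centering of freeness, an equality in the algebra, into the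
asymptotic centering of `isCentered_prod`. -/
lemma condExp_limitSpace_eq_zero {x : genAlg B} :
    h.limitSpace.condExp x = 0 ↔ h.limCoord x = 0 := by
  have := h.prob
  rw [RectSpace.condExp, coordE_limitSpace]
  constructor
  · intro e
    have h1 : HasCoord μ ((∑ k, h.limCoord x k • h.limitSpace.p k : genAlg B) : SeqAlg.{u} q T)
        (h.limCoord x) := by
      have : ((∑ k, h.limCoord x k • h.limitSpace.p k : genAlg B) : SeqAlg.{u} q T)
          = seqDiag q T (h.limCoord x) := by
        simp only [AddSubmonoidClass.coe_finsetSum, seqDiag]; rfl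
      rw [this]
      exact hasCoord_seqDiag _
    rw [e] at h1
    exact h1.unique h.pos isCentered_zero.hasCoord
  · intro e
    simp [e]

/-- The generating algebras are free with amalgamation in the limit space. -/
theorem freeSubalgebras : FreeSubalgebras h.limitSpace.diag h.limitSpace.condExp
    (fun α => (B α).comap (genAlg B).subtype) := by
  have := h.prob
  constructor
  · rintro α _ ⟨c, rfl⟩
    rw [StarSubalgebra.mem_comap, map_sum]
    refine sum_mem fun k _ => ?_
    rw [map_smul]
    exact (B α).toSubalgebra.smul_mem (h.proj α k) _
  · intro L hne hc hL
    rw [h.condExp_limitSpace_eq_zero]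
    refine h.limCoord_eq ?_
    have e : ((L.map Prod.snd).prod : genAlg B)
        = ((L.map fun p => (p.1, (p.2 : SeqAlg.{u} q T))).map Prod.snd).prod := by
      rw [← StarSubalgebra.coe_subtype, map_list_prod, List.map_map, List.map_map]
      rfl
    rw [e]
    refine (isCentered_prod h.pos h.top h.inv _ (by simpa using hne) ?_ ?_).hasCoord
    · rw [List.isChain_map]
      exact hc
    · intro p hp
      obtain ⟨p', hp', rfl⟩ := List.mem_map.1 hp
      obtain ⟨h1, h2⟩ := hL p' hp'
      refine ⟨h.equiv _ h1, ?_⟩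
      rw [h.condExp_limitSpace_eq_zero] at h2
      have := h.hasCoord p'.2
      rw [h2] at this
      exact this.isCentered

/-- Convergence in `D`-distribution of random matrices that have the distributions `μ n`. -/
theorem dConvInProb {Ω : Type v} [MeasurableSpace Ω] (P : Measure Ω)
    {R : ∀ n, Ω → T → BMat (q n)} (hR : ∀ n, Measurable (R n)) (hRμ : ∀ n, P.map (R n) = μ n)
    {J : Type w} (a : J → genAlg B) (ha : ∀ j, h.limitSpace.IsSimple (a j))
    (X : ∀ n, J → Ω → BMat (q n))
    (hX : ∀ n, ∀ᵐ ω ∂P, ∀ j, X n j ω = (a j : SeqAlg.{u} q T) ⟨n⟩ (R n ω)) :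
    DConvInProb P q h.pos X h.limitSpace a := by
  have := h.prob
  refine ⟨ha, fun Q => ?_⟩
  set x : genAlg B := FreeAlgebra.lift ℂ (h.limitSpace.symbolValue a) Q with hx
  -- Evaluation at `n` and `r` is an algebra homomorphism that sends the limit variables to the
  -- matrices and the limit projectors to the block projectors. It therefore commutes with the
  -- evaluation of polynomials.
  have hev : ∀ n (r : T → BMat (q n)), (x : SeqAlg.{u} q T) ⟨n⟩ r = FreeAlgebra.lift ℂ
      ((matrixSpace (q n) (h.pos n)).symbolValue fun j => (a j : SeqAlg.{u} q T) ⟨n⟩ r) Q := by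
    intro n r
    let ev : genAlg B →ₐ[ℂ] BMat (q n) :=
      ((Pi.evalAlgHom ℂ _ r).comp (Pi.evalAlgHom ℂ _ (⟨n⟩ : ULift.{u} ℕ))).comp
        (genAlg B).toSubalgebra.val
    have : ev.comp (FreeAlgebra.lift ℂ (h.limitSpace.symbolValue a)) = FreeAlgebra.lift ℂ
      ((matrixSpace (q n) (h.pos n)).symbolValue fun j => (a j : SeqAlg.{u} q T) ⟨n⟩ r) := by
      ext j
      rcases j with k | j | j <;> simp <;> rfl
    exact congrArg (fun f => f Q) this
  have hc := h.hasCoord x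
  set c := h.limCoord x with hcdef
  have hlim : h.limitSpace.dDistribution a Q = c := h.coordE_limitSpace x
  have hval : ∀ n, ∀ᵐ ω ∂P, (matrixSpace (q n) (h.pos n)).dDistribution (fun j => X n j ω) Q
      = fun k => blockTr (q n) k ((x : SeqAlg.{u} q T) ⟨n⟩ (R n ω)) := by
    intro n
    filter_upwards [hX n] with ω hω
    simp only [hω]
    ext k
    rw [hev]
    exact (matrixSpace (q n) (h.pos n)).φ_corner k _
  rw [hlim]
  refine TendstoInMeasure.congr_left
    (f := fun n ω k => blockTr (q n) k ((x : SeqAlg.{u} q T) ⟨n⟩ (R n ω)))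
    (fun n => (hval n).mono fun ω hω => hω.symm) ?_
  have hmeas : ∀ n, Measurable fun r : T → BMat (q n) =>
      (fun k => blockTr (q n) k ((x : SeqAlg.{u} q T) ⟨n⟩ r) : Fin d → ℂ) := fun n =>
    measurable_pi_lambda _ fun k => (measurable_blockTr k).comp (hc.mem_bddAlg.1 ⟨n⟩)
  have hcent : ∀ n r k, blockTr (q n) k ((x : SeqAlg.{u} q T) ⟨n⟩ r) - c k
      = blockTr (q n) k (((x : SeqAlg.{u} q T) - seqDiag q T c) ⟨n⟩ r) := by
    intro n r k
    rw [Pi.sub_apply, Pi.sub_apply, map_sub, seqDiag_apply, blockTr_sum_blockProj (h.pos n)]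
  have hi : ∀ n, Integrable (fun r => ∑ k, ‖blockTr (q n) k
      (((x : SeqAlg.{u} q T) - seqDiag q T c) ⟨n⟩ r)‖) (μ n) := fun n =>
    integrable_finsetSum _ fun k _ => (integrable_blockTr hc.1 n k).norm
  have hle : ∀ n r, ‖(fun k => blockTr (q n) k ((x : SeqAlg.{u} q T) ⟨n⟩ r)) - c‖
      ≤ ∑ k, ‖blockTr (q n) k (((x : SeqAlg.{u} q T) - seqDiag q T c) ⟨n⟩ r)‖ := by
    intro n r
    refine (pi_norm_le_iff_of_nonneg (Finset.sum_nonneg fun _ _ => norm_nonneg _)).2 fun k => ?_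
    rw [Pi.sub_apply, hcent]
    exact Finset.single_le_sum (f := fun k => ‖blockTr (q n) k
      (((x : SeqAlg.{u} q T) - seqDiag q T c) ⟨n⟩ r)‖) (fun _ _ => norm_nonneg _)
      (Finset.mem_univ k)
  -- `HasCoord` is a convergence in mean, which implies convergence in probability.
  refine tendstoInMeasure_of_tendsto_eLpNorm one_ne_zero
    (fun n => ((hmeas n).comp (hR n)).aestronglyMeasurable) aestronglyMeasurable_const ?_
  have hsum : Tendsto (fun n => ENNReal.ofReal (∫ r, ∑ k, ‖blockTr (q n) k
      (((x : SeqAlg.{u} q T) - seqDiag q T c) ⟨n⟩ r)‖ ∂μ n)) atTop (𝓝 0) := by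
    rw [← ENNReal.ofReal_zero]
    refine (ENNReal.continuous_ofReal.tendsto 0).comp ?_
    have := tendsto_finsetSum Finset.univ fun k _ => hc.2 k
    simp only [Finset.sum_const_zero] at this
    refine this.congr fun n => ?_
    rw [integral_finsetSum _ fun k _ => (integrable_blockTr hc.1 n k).norm]
  refine tendsto_of_tendsto_of_tendsto_of_le_of_le tendsto_const_nhds hsum
    (fun _ => bot_le) fun n => ?_
  rw [eLpNorm_one_eq_lintegral_enorm]
  have e := lintegral_map (μ := P) (f := fun r : T → BMat (q n) =>
    ‖(fun k => blockTr (q n) k ((x : SeqAlg.{u} q T) ⟨n⟩ r) : Fin d → ℂ) - c‖ₑ)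
    (((hmeas n).sub_const c).enorm) (hR n)
  refine le_trans (le_of_eq e.symm) ?_
  rw [hRμ n, ofReal_integral_eq_lintegral_ofReal (hi n)
    (.of_forall fun r => Finset.sum_nonneg fun _ _ => norm_nonneg _)]
  refine lintegral_mono fun r => ?_
  rw [← ofReal_norm]
  exact ENNReal.ofReal_le_ofReal (hle n r)

end AsympFree

end LimitSpace

/-! ### Rectangular blocks inside block matrices -/

section Embedding

open scoped Matrix.Norms.L2Operator Matrix

variable {d : ℕ} {q : Fin d → ℕ}

/-- The inclusion of the `k`-th block, as an isometry. -/
def blockIncl (q : Fin d → ℕ) (k : Fin d) : Matrix (BIdx q) (Fin (q k)) ℂ :=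
  Matrix.of fun x i => if x = ⟨k, i⟩ then 1 else 0

lemma blockIncl_apply (k : Fin d) (x : BIdx q) (i : Fin (q k)) :
    blockIncl q k x i = if x = ⟨k, i⟩ then 1 else 0 := rfl

lemma blockIncl_mul_apply {k : Fin d} {n : Type*} (M : Matrix (Fin (q k)) n ℂ) (i : Fin (q k))
    (j : n) : (blockIncl q k * M) ⟨k, i⟩ j = M i j := by
  rw [Matrix.mul_apply, Finset.sum_eq_single i]
  · simp [blockIncl_apply]
  · intro b _ hb
    rw [blockIncl_apply, if_neg, zero_mul]
    simpa using hb.symm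
  · simp

lemma blockIncl_mul_apply_of_ne {k l : Fin d} (h : l ≠ k) {n : Type*}
    (M : Matrix (Fin (q k)) n ℂ) (i : Fin (q l)) (j : n) : (blockIncl q k * M) ⟨l, i⟩ j = 0 := by
  rw [Matrix.mul_apply]
  refine Finset.sum_eq_zero fun b _ => ?_
  rw [blockIncl_apply, if_neg, zero_mul]
  intro e
  exact h (congrArg Sigma.fst e)

lemma mul_blockIncl_conjTranspose_apply {k : Fin d} {m : Type*} (M : Matrix m (Fin (q k)) ℂ)
    (i : m) (j : Fin (q k)) : (M * (blockIncl q k)ᴴ) i ⟨k, j⟩ = M i j := by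
  have h := blockIncl_mul_apply Mᴴ j i
  rw [← Matrix.conjTranspose_conjTranspose (M * (blockIncl q k)ᴴ), Matrix.conjTranspose_apply,
    Matrix.conjTranspose_mul, Matrix.conjTranspose_conjTranspose, h, Matrix.conjTranspose_apply,
    star_star]

lemma mul_blockIncl_conjTranspose_apply_of_ne {k l : Fin d} (h : l ≠ k) {m : Type*}
    (M : Matrix m (Fin (q k)) ℂ) (i : m) (j : Fin (q l)) :
    (M * (blockIncl q k)ᴴ) i ⟨l, j⟩ = 0 := by
  have h := blockIncl_mul_apply_of_ne h Mᴴ j i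
  rw [← Matrix.conjTranspose_conjTranspose (M * (blockIncl q k)ᴴ), Matrix.conjTranspose_apply,
    Matrix.conjTranspose_mul, Matrix.conjTranspose_conjTranspose, h, star_zero]

/-- With the isometries `blockIncl`, statements on products, adjoints, norms and conjugations of
extended blocks become matrix algebra. -/
lemma embed_eq {k l : Fin d} (M : Matrix (Fin (q k)) (Fin (q l)) ℂ) :
    embed M = blockIncl q k * M * (blockIncl q l)ᴴ := by
  ext ⟨a, i⟩ ⟨b, j⟩
  simp only [embed, Matrix.of_apply]
  by_cases hb : b = l
  · subst hb
    rw [mul_blockIncl_conjTranspose_apply]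
    by_cases ha : a = k
    · subst ha
      rw [blockIncl_mul_apply]
      simp
    · rw [blockIncl_mul_apply_of_ne ha, dif_neg]
      exact fun h => ha h.1
  · rw [mul_blockIncl_conjTranspose_apply_of_ne hb, dif_neg]
    exact fun h => hb h.2

lemma conjTranspose_blockIncl_mul_self (k : Fin d) : (blockIncl q k)ᴴ * blockIncl q k = 1 := by
  ext i j
  rw [Matrix.mul_apply, Finset.sum_eq_single ⟨k, i⟩]
  · simp [blockIncl_apply, Matrix.one_apply]
  · intro b _ hb
    simp [blockIncl_apply, hb]
  · simp

lemma blockProj_eq_blockIncl (k : Fin d) :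
    blockProj q k = blockIncl q k * (blockIncl q k)ᴴ := by
  rw [blockProj, embed_eq, Matrix.mul_one]

lemma blockProj_mul_blockIncl (k : Fin d) : blockProj q k * blockIncl q k = blockIncl q k := by
  rw [blockProj_eq_blockIncl, Matrix.mul_assoc, conjTranspose_blockIncl_mul_self, Matrix.mul_one]

lemma conjTranspose_blockIncl_mul_blockProj (k : Fin d) :
    (blockIncl q k)ᴴ * blockProj q k = (blockIncl q k)ᴴ := by
  rw [blockProj_eq_blockIncl, ← Matrix.mul_assoc, conjTranspose_blockIncl_mul_self, Matrix.one_mul]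

lemma blockProj_mul_embed_mul {k l : Fin d} (M : Matrix (Fin (q k)) (Fin (q l)) ℂ) :
    blockProj q k * embed M * blockProj q l = embed M := by
  rw [embed_eq, Matrix.mul_assoc, Matrix.mul_assoc _ _ (blockProj q l),
    conjTranspose_blockIncl_mul_blockProj, ← Matrix.mul_assoc, ← Matrix.mul_assoc,
    blockProj_mul_blockIncl]

lemma embed_mul_embed {k l j : Fin d} (M : Matrix (Fin (q k)) (Fin (q l)) ℂ)
    (N : Matrix (Fin (q l)) (Fin (q j)) ℂ) : embed M * embed N = embed (M * N) := by
  rw [embed_eq, embed_eq, embed_eq]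
  calc blockIncl q k * M * (blockIncl q l)ᴴ * (blockIncl q l * N * (blockIncl q j)ᴴ)
      = blockIncl q k * M * ((blockIncl q l)ᴴ * blockIncl q l) * N * (blockIncl q j)ᴴ := by
        simp only [Matrix.mul_assoc]
    _ = _ := by
        rw [conjTranspose_blockIncl_mul_self, Matrix.mul_one, Matrix.mul_assoc (blockIncl q k)]

lemma star_embed {k l : Fin d} (M : Matrix (Fin (q k)) (Fin (q l)) ℂ) :
    star (embed M) = embed Mᴴ := by
  rw [embed_eq, embed_eq, Matrix.star_eq_conjTranspose, Matrix.conjTranspose_mul,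
    Matrix.conjTranspose_mul, Matrix.conjTranspose_conjTranspose, Matrix.mul_assoc]

lemma embed_pow_succ {k : Fin d} (M : Matrix (Fin (q k)) (Fin (q k)) ℂ) (m : ℕ) :
    embed M ^ (m + 1) = embed (M ^ (m + 1)) := by
  induction m with
  | zero => simp
  | succ m ih => rw [pow_succ, ih, embed_mul_embed, ← pow_succ]

lemma blockTr_embed {k : Fin d} (M : Matrix (Fin (q k)) (Fin (q k)) ℂ) :
    blockTr q k (embed M) = (q k : ℂ)⁻¹ * M.trace := by
  simp [blockTr, embed, Matrix.trace]

lemma norm_blockIncl_le (k : Fin d) : ‖blockIncl q k‖ ≤ 1 := by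
  have h := Matrix.l2_opNorm_conjTranspose_mul_self (blockIncl q k)
  rw [conjTranspose_blockIncl_mul_self, ← Matrix.diagonal_one, Matrix.l2_opNorm_diagonal] at h
  have h1 : ‖(1 : Fin (q k) → ℂ)‖ ≤ 1 :=
    (pi_norm_le_iff_of_nonneg zero_le_one).2 fun _ => by simp
  have h2 : ‖(fun _ => 1 : Fin (q k) → ℂ)‖ ≤ 1 := h1
  nlinarith [norm_nonneg (blockIncl q k)]

lemma norm_embed_le {k l : Fin d} (M : Matrix (Fin (q k)) (Fin (q l)) ℂ) :
    ‖embed M‖ ≤ opNorm M := by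
  rw [embed_eq, opNorm]
  calc _ ≤ ‖blockIncl q k‖ * ‖M‖ * ‖(blockIncl q l)ᴴ‖ :=
        (Matrix.l2_opNorm_mul _ _).trans (mul_le_mul_of_nonneg_right (Matrix.l2_opNorm_mul _ _)
          (norm_nonneg _))
    _ ≤ 1 * ‖M‖ * 1 := by
        rw [Matrix.l2_opNorm_conjTranspose]
        gcongr <;> exact norm_blockIncl_le _
    _ = _ := by ring

/-- The diagonal block of a block matrix. -/
def diagBlock (U : BMat q) (k : Fin d) : Matrix (Fin (q k)) (Fin (q k)) ℂ :=
  (blockIncl q k)ᴴ * U * blockIncl q k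

lemma IsBlockUnitary.mul_blockIncl {U : BMat q} (hU : IsBlockUnitary U) (k : Fin d) :
    U * blockIncl q k = blockIncl q k * diagBlock U k := by
  rw [diagBlock, ← Matrix.mul_assoc, ← Matrix.mul_assoc, ← blockProj_eq_blockIncl, (hU.2 k).eq,
    Matrix.mul_assoc, blockProj_mul_blockIncl]

lemma IsBlockUnitary.diagBlock_mem {U : BMat q} (hU : IsBlockUnitary U) (k : Fin d) :
    diagBlock U k ∈ Matrix.unitaryGroup (Fin (q k)) ℂ := by
  rw [Matrix.mem_unitaryGroup_iff', Matrix.star_eq_conjTranspose]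
  have h1 : (U * blockIncl q k)ᴴ * (U * blockIncl q k) = 1 := by
    rw [Matrix.conjTranspose_mul, Matrix.mul_assoc, ← Matrix.mul_assoc _ U,
      ← Matrix.star_eq_conjTranspose U, Unitary.star_mul_self_of_mem hU.1, Matrix.one_mul,
      conjTranspose_blockIncl_mul_self]
  rwa [hU.mul_blockIncl, Matrix.conjTranspose_mul, Matrix.mul_assoc, ← Matrix.mul_assoc _ _ (diagBlock U k),
    conjTranspose_blockIncl_mul_self, Matrix.one_mul] at h1

/-- The two diagonal blocks of `U` act on the two sides. For `k ≠ l` this is covered by bi-unitary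
invariance of the letter; for `k = l` it is a conjugation. -/
lemma IsBlockUnitary.conj_embed {U : BMat q} (hU : IsBlockUnitary U) {k l : Fin d}
    (M : Matrix (Fin (q k)) (Fin (q l)) ℂ) :
    U * embed M * star U = embed (diagBlock U k * M * (diagBlock U l)ᴴ) := by
  have h : (blockIncl q l)ᴴ * star U = (diagBlock U l)ᴴ * (blockIncl q l)ᴴ := by
    rw [Matrix.star_eq_conjTranspose, ← Matrix.conjTranspose_mul, hU.mul_blockIncl,
      Matrix.conjTranspose_mul]
  rw [embed_eq, embed_eq, Matrix.mul_assoc U, Matrix.mul_assoc _ _ (star U), h,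
    Matrix.mul_assoc (blockIncl q k), ← Matrix.mul_assoc U, hU.mul_blockIncl]
  simp only [Matrix.mul_assoc]

lemma IsBlockUnitary.mul_embed {U : BMat q} (hU : IsBlockUnitary U) {k l : Fin d}
    (M : Matrix (Fin (q k)) (Fin (q l)) ℂ) : U * embed M = embed (diagBlock U k * M) := by
  rw [embed_eq, embed_eq, ← Matrix.mul_assoc, ← Matrix.mul_assoc, hU.mul_blockIncl]
  simp only [Matrix.mul_assoc]

lemma measurable_embed {k l : Fin d} :
    Measurable (embed : Matrix (Fin (q k)) (Fin (q l)) ℂ → BMat q) := by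
  have : (embed : Matrix (Fin (q k)) (Fin (q l)) ℂ → BMat q)
      = fun M => blockIncl q k * M * (blockIncl q l)ᴴ := funext embed_eq
  rw [this]
  have hc : Continuous fun M : Matrix (Fin (q k)) (Fin (q l)) ℂ =>
    blockIncl q k * M * (blockIncl q l)ᴴ := by fun_prop
  exact hc.measurable

end Embedding

/-! ### Traces of powers in terms of eigenvalues and singular values -/

section Traces

open scoped Matrix

lemma trace_pow_eq_sum_eigenvalues {E : Type*} [NormedAddCommGroup E] [InnerProductSpace ℂ E]
    [FiniteDimensional ℂ E] {S : E →ₗ[ℂ] E} (hS : S.IsSymmetric) {n : ℕ}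
    (hn : Module.finrank ℂ E = n) (m : ℕ) :
    LinearMap.trace ℂ E (S ^ m) = ∑ i, ((hS.eigenvalues hn i : ℂ)) ^ m := by
  rw [LinearMap.trace_eq_sum_inner _ (hS.eigenvectorBasis hn)]
  refine Finset.sum_congr rfl fun i _ => ?_
  have h : (S ^ m) (hS.eigenvectorBasis hn i)
      = ((hS.eigenvalues hn i : ℂ)) ^ m • hS.eigenvectorBasis hn i := by
    induction m with
    | zero => simp
    | succ m ih =>
      rw [pow_succ', Module.End.mul_apply, ih, map_smul, hS.apply_eigenvectorBasis, smul_smul,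
        pow_succ]
      rfl
  rw [h, inner_smul_right, inner_self_eq_norm_sq_to_K, OrthonormalBasis.norm_eq_one]
  simp

/-- The `n` eigenvalues of `Mᴴ * M` are squares of singular values, and those beyond the first `min
m n` vanish because of the rank. The exponent is positive so that these zeros do not count. -/
lemma trace_conjTranspose_mul_self_pow {m n : ℕ} (M : Matrix (Fin m) (Fin n) ℂ) (j : ℕ) :
    ((Mᴴ * M) ^ (j + 1)).trace = ∑ i, ((singVal M i : ℂ)) ^ (2 * (j + 1)) := by
  set T := Matrix.toEuclideanLin M with hT
  have hn : Module.finrank ℂ (EuclideanSpace ℂ (Fin n)) = n := by simp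
  have hm : Module.finrank ℂ (EuclideanSpace ℂ (Fin m)) = m := by simp
  have hE : ∀ {m n : ℕ} (M : Matrix (Fin m) (Fin n) ℂ), Matrix.toEuclideanLin M
      = Matrix.toLin (PiLp.basisFun 2 ℂ (Fin n)) (PiLp.basisFun 2 ℂ (Fin m)) M := fun M =>
    DFunLike.congr_fun (Matrix.toLpLin_eq_toLin 2 2) M
  have e1 : ((Mᴴ * M) ^ (j + 1)).trace
      = LinearMap.trace ℂ _ ((LinearMap.adjoint T ∘ₗ T) ^ (j + 1)) := by
    rw [hT, ← Matrix.toEuclideanLin_conjTranspose_eq_adjoint, hE, hE, ← Matrix.toLin_mul, ← Matrix.toLin_pow,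
      LinearMap.trace_eq_matrix_trace ℂ (PiLp.basisFun 2 ℂ (Fin n)), LinearMap.toMatrix_toLin]
  rw [e1, trace_pow_eq_sum_eigenvalues T.isSymmetric_adjoint_comp_self hn]
  have e2 : ∀ i : Fin n, ((T.isSymmetric_adjoint_comp_self.eigenvalues hn i : ℂ)) ^ (j + 1)
      = ((T.singularValues i : ℂ)) ^ (2 * (j + 1)) := by
    intro i
    rw [← LinearMap.sq_singularValues_fin T hn i, pow_mul]
    push_cast; rfl
  simp only [e2]
  rw [Fin.sum_univ_eq_sum_range (fun i => ((T.singularValues i : ℂ)) ^ (2 * (j + 1))) n]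
  simp only [singVal]
  rw [Fin.sum_univ_eq_sum_range (fun i => ((T.singularValues i : ℂ)) ^ (2 * (j + 1))) (min m n)]
  symm
  refine Finset.sum_subset (Finset.range_mono (min_le_right _ _)) fun i hi hi' => ?_
  have : T.singularValues i = 0 := by
    rw [LinearMap.singularValues_eq_zero_iff_le_finrank_range]
    have h1 := LinearMap.finrank_range_le T
    have h2 := Submodule.finrank_le (LinearMap.range T)
    rw [hn] at h1; rw [hm] at h2
    simp at hi hi'
    omega
  simp [this]

lemma singVal_nonneg {m n : ℕ} (M : Matrix (Fin m) (Fin n) ℂ) (i : Fin (min m n)) :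
    0 ≤ singVal M i := LinearMap.singularValues_nonneg _ _

open scoped Matrix.Norms.L2Operator in
-- A singular value is `‖T v‖` for a unit eigenvector `v` of `adjoint T ∘ₗ T`.
lemma singVal_le_opNorm {m n : ℕ} (M : Matrix (Fin m) (Fin n) ℂ) (i : Fin (min m n)) :
    singVal M i ≤ opNorm M := by
  set T := Matrix.toEuclideanLin M with hT
  have hn : Module.finrank ℂ (EuclideanSpace ℂ (Fin n)) = n := by simp
  have hi : (i : ℕ) < n := i.2.trans_le (min_le_right _ _)
  set v := T.isSymmetric_adjoint_comp_self.eigenvectorBasis hn ⟨i, hi⟩ with hv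
  have hv1 : ‖v‖ = 1 := OrthonormalBasis.norm_eq_one _ _
  have h1 := T.isSymmetric_adjoint_comp_self.apply_eigenvectorBasis hn ⟨i, hi⟩
  rw [← LinearMap.sq_singularValues_of_lt T hn hi, ← hv] at h1
  have h2 : inner ℂ v ((LinearMap.adjoint T ∘ₗ T) v) = ((‖T v‖ ^ 2 : ℝ) : ℂ) := by
    rw [LinearMap.comp_apply, LinearMap.adjoint_inner_right, inner_self_eq_norm_sq_to_K]
    simp
  rw [h1, inner_smul_right, inner_self_eq_norm_sq_to_K, hv1] at h2
  have h3 : T.singularValues i ^ 2 = ‖T v‖ ^ 2 := by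
    have : ((T.singularValues i ^ 2 : ℝ) : ℂ) = ((‖T v‖ ^ 2 : ℝ) : ℂ) := by
      rw [← h2]; simp
    exact_mod_cast this
  have h4 : ‖T v‖ ≤ ‖M‖ := by
    have := Matrix.l2_opNorm_mulVec M v
    rw [hv1, mul_one] at this
    exact this
  have h5 : T.singularValues i = ‖T v‖ :=
    (sq_eq_sq₀ (LinearMap.singularValues_nonneg _ _) (norm_nonneg _)).1 h3
  exact h5.trans_le h4

lemma trace_pow_of_isHermitian {m : ℕ} {M : Matrix (Fin m) (Fin m) ℂ} (hM : M.IsHermitian)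
    (j : ℕ) : (M ^ j).trace = ∑ i, ((hM.eigenvalues i : ℂ)) ^ j := by
  have h := hM.spectral_theorem
  conv_lhs => rw [h, ← map_pow, Unitary.conjStarAlgAut_apply, Matrix.trace_mul_comm,
    ← Matrix.mul_assoc, Unitary.coe_star_mul_self, Matrix.one_mul, Matrix.diagonal_pow,
    Matrix.trace_diagonal]
  rfl

open scoped Matrix.Norms.L2Operator in
lemma abs_eigenvalues_le_opNorm {m : ℕ} {M : Matrix (Fin m) (Fin m) ℂ} (hM : M.IsHermitian)
    (i : Fin m) : |hM.eigenvalues i| ≤ opNorm M := by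
  have h := Matrix.l2_opNorm_mulVec M (hM.eigenvectorBasis i)
  rw [OrthonormalBasis.norm_eq_one, mul_one] at h
  refine le_trans (le_of_eq ?_) h
  rw [hM.mulVec_eigenvectorBasis]
  change _ = ‖hM.eigenvalues i • hM.eigenvectorBasis i‖
  rw [norm_smul, OrthonormalBasis.norm_eq_one, mul_one, Real.norm_eq_abs]

end Traces

/-! ### Haar distributed unitary matrices -/

section Haar

open scoped Matrix.Norms.L2Operator

noncomputable instance unitaryBorelSpace (m : ℕ) : BorelSpace (Matrix.unitaryGroup (Fin m) ℂ) := by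
  have : BorelSpace (Matrix (Fin m) (Fin m) ℂ) := inferInstance
  exact Subtype.borelSpace _

instance unitaryCompactSpace (m : ℕ) : CompactSpace (Matrix.unitaryGroup (Fin m) ℂ) := by
  refine isCompact_iff_compactSpace.1 ?_
  refine Metric.isCompact_of_isClosed_isBounded ?_ ?_
  · exact isClosed_unitary
  · refine (Metric.isBounded_closedBall (x := (0 : Matrix (Fin m) (Fin m) ℂ)) (r := 1)).subset ?_
    intro U hU
    rw [mem_closedBall_zero_iff]
    have h := CStarRing.norm_star_mul_self (x := U)
    have h1 : ‖(1 : Matrix (Fin m) (Fin m) ℂ)‖ ≤ 1 := by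
      rw [← Matrix.diagonal_one, Matrix.l2_opNorm_diagonal]
      exact (pi_norm_le_iff_of_nonneg zero_le_one).2 fun _ => by simp
    rw [Unitary.star_mul_self_of_mem hU] at h
    nlinarith [norm_nonneg U]

lemma uniformUnitary_map_mul {Ω : Type*} [MeasurableSpace Ω] {P : Measure Ω} {m : ℕ}
    {R : Ω → Matrix (Fin m) (Fin m) ℂ} (hR : Measurable R) (h : UniformUnitary P R)
    (U V : Matrix.unitaryGroup (Fin m) ℂ) :
    P.map (fun ω => (U : Matrix (Fin m) (Fin m) ℂ) * R ω * (V : Matrix (Fin m) (Fin m) ℂ))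
      = P.map R := by
  obtain ⟨μ, hμ, hμp, e⟩ := h
  have hc : Measurable fun W : Matrix.unitaryGroup (Fin m) ℂ => (W : Matrix (Fin m) (Fin m) ℂ) :=
    measurable_subtype_coe
  have hm : Measurable fun M : Matrix (Fin m) (Fin m) ℂ =>
      (U : Matrix (Fin m) (Fin m) ℂ) * M * (V : Matrix (Fin m) (Fin m) ℂ) := by fun_prop
  have hl : Measurable fun W : Matrix.unitaryGroup (Fin m) ℂ => U * W :=
    (continuous_const_mul U).measurable
  have hr : Measurable fun W : Matrix.unitaryGroup (Fin m) ℂ => W * V :=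
    (continuous_mul_const V).measurable
  -- A right translate of `μ` is again a left invariant probability measure, and the Haar
  -- probability measure is unique.
  have hright : μ.map (fun W => W * V) = μ := by
    have : IsProbabilityMeasure (μ.map fun W => W * V) :=
      Measure.isProbabilityMeasure_map hr.aemeasurable
    exact Measure.isHaarMeasure_eq_of_isProbabilityMeasure _ _
  have hboth : μ.map (fun W => U * W * V) = μ := by
    have : (fun W => U * W * V) = (fun W => W * V) ∘ fun W => U * W := rfl
    rw [this, ← Measure.map_map hr hl, map_mul_left_eq_self, hright]
  have h1 : P.map (fun ω => (U : Matrix (Fin m) (Fin m) ℂ) * R ω * (V : Matrix (Fin m) (Fin m) ℂ))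
      = (P.map R).map fun M => (U : Matrix (Fin m) (Fin m) ℂ) * M * (V : Matrix (Fin m) (Fin m) ℂ) :=
    (Measure.map_map hm hR).symm
  rw [h1, e, Measure.map_map hm hc]
  have hlr : Measurable fun W : Matrix.unitaryGroup (Fin m) ℂ => U * W * V := hr.comp hl
  conv_rhs => rw [← hboth, Measure.map_map hc hlr]
  rfl

lemma UniformUnitary.ae_mem {Ω : Type*} [MeasurableSpace Ω] {P : Measure Ω} {m : ℕ}
    {R : Ω → Matrix (Fin m) (Fin m) ℂ} (hR : Measurable R) (h : UniformUnitary P R) :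
    ∀ᵐ ω ∂P, R ω ∈ Matrix.unitaryGroup (Fin m) ℂ := by
  obtain ⟨μ, hμ, hμp, e⟩ := h
  have hs : MeasurableSet {M : Matrix (Fin m) (Fin m) ℂ | M ∈ Matrix.unitaryGroup (Fin m) ℂ} :=
    isClosed_unitary.measurableSet
  have h1 : ∀ᵐ M ∂(P.map R), M ∈ Matrix.unitaryGroup (Fin m) ℂ := by
    rw [e, ae_map_iff measurable_subtype_coe.aemeasurable hs]
    exact .of_forall fun W => W.2
  exact (ae_map_iff hR.aemeasurable hs).1 h1

end Haar

/-! ### Spanning words for the algebra generated by a letter and the projectors -/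

section AdjoinSpan

variable {A : Type*} [Ring A] [StarRing A] [Algebra ℂ A] [StarModule ℂ A]

/-- The elements that stabilize the span by left multiplication form an algebra; it contains the
generators and their adjoints, and the span contains `1`. -/
lemma mem_span_of_mem_adjoin {s W : Set A} (h1 : 1 ∈ Submodule.span ℂ W)
    (hs : ∀ g ∈ s, ∀ w ∈ W, g * w ∈ Submodule.span ℂ W ∧ star g * w ∈ Submodule.span ℂ W)
    {x : A} (hx : x ∈ StarAlgebra.adjoin ℂ s) : x ∈ Submodule.span ℂ W := by
  have hx' : x ∈ Algebra.adjoin ℂ (s ∪ star s) := by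
    rw [← StarAlgebra.adjoin_toSubalgebra]; exact hx
  clear hx
  have key : ∀ w ∈ Submodule.span ℂ W, x * w ∈ Submodule.span ℂ W := by
    induction hx' using Algebra.adjoin_induction with
    | mem g hg =>
      intro w hw
      refine (Submodule.span_le (p := (Submodule.span ℂ W).comap (LinearMap.mulLeft ℂ g))).2
        (fun w hw => ?_) hw
      rcases hg with hg | hg
      · exact (hs g hg w hw).1
      · simpa using (hs (star g) hg w hw).2
    | algebraMap c =>
      intro w hw
      rw [← Algebra.smul_def]
      exact Submodule.smul_mem _ _ hw
    | add x y _ _ hx hy =>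
      intro w hw
      rw [add_mul]
      exact add_mem (hx w hw) (hy w hw)
    | mul x y _ _ hx hy =>
      intro w hw
      rw [mul_assoc]
      exact hx _ (hy w hw)
  simpa using key 1 h1

/-- The alternating products `a * b * a * ⋯` with `n` factors. -/
def altWord : A → A → ℕ → A
  | _, _, 0 => 1
  | a, b, n + 1 => a * altWord b a n

lemma altWord_two_mul (a b : A) (m : ℕ) : altWord a b (2 * m) = (a * b) ^ m := by
  induction m with
  | zero => simp [altWord]
  | succ m ih => rw [mul_add, mul_one, altWord, altWord, ih, pow_succ', mul_assoc]

lemma altWord_two_mul_add_one (a b : A) (m : ℕ) : altWord a b (2 * m + 1) = (a * b) ^ m * a := by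
  induction m with
  | zero => simp [altWord]
  | succ m ih =>
    rw [mul_add, mul_one, add_right_comm, altWord, altWord, ih, pow_succ', mul_assoc, mul_assoc]

variable {d : ℕ}

/-- Pairwise orthogonal self-adjoint projectors of sum `1`. -/
structure IsProjFamily (p : Fin d → A) : Prop where
  star_eq : ∀ k, star (p k) = p k
  idem : ∀ k, p k * p k = p k
  orth : ∀ k l, k ≠ l → p k * p l = 0
  sum_eq : ∑ k, p k = 1

namespace IsProjFamily

variable {p : Fin d → A} (h : IsProjFamily p)

include h

lemma one_mem_span {W : Set A} (hW : ∀ k, p k ∈ W) : 1 ∈ Submodule.span ℂ W := by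
  rw [← h.sum_eq]
  exact sum_mem fun k _ => Submodule.subset_span (hW k)

lemma mul_mem_or {k l : Fin d} {x : A} (hx : p k * x * p l = x) (j : Fin d) :
    p j * x = x ∨ p j * x = 0 := by
  by_cases hj : j = k
  · left
    rw [hj, ← hx, ← mul_assoc, ← mul_assoc, h.idem]
  · right
    rw [← hx, ← mul_assoc, ← mul_assoc, h.orth j k hj, zero_mul, zero_mul]

lemma mul_eq {k l : Fin d} {x : A} (hx : p k * x * p l = x) : p k * x = x := by
  rw [← hx, ← mul_assoc, ← mul_assoc, h.idem]

lemma mul_eq' {k l : Fin d} {x : A} (hx : p k * x * p l = x) : x * p l = x := by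
  rw [← hx, mul_assoc, h.idem]

lemma mul_mem_or' {k l : Fin d} {x : A} (hx : p k * x * p l = x) (j : Fin d) :
    x * p j = x ∨ x * p j = 0 := by
  by_cases hj : j = l
  · left
    rw [hj, h.mul_eq' hx]
  · right
    rw [← hx, mul_assoc, h.orth l j (Ne.symm hj), mul_zero]

lemma mul_eq_zero_of_ne {k l k' l' : Fin d} {x y : A} (hx : p k * x * p l = x)
    (hy : p k' * y * p l' = y) (hne : l ≠ k') : x * y = 0 := by
  rw [← h.mul_eq' hx, ← h.mul_eq hy, mul_assoc, ← mul_assoc (p l), h.orth _ _ hne, zero_mul, mul_zero]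

lemma star_corner {k l : Fin d} {x : A} (hx : p k * x * p l = x) :
    p l * star x * p k = star x := by
  conv_rhs => rw [← hx]
  rw [star_mul, star_mul, h.star_eq, h.star_eq, mul_assoc]

lemma mul_corner {k l j : Fin d} {x y : A} (hx : p k * x * p l = x) (hy : p l * y * p j = y) :
    p k * (x * y) * p j = x * y := by
  rw [← mul_assoc, h.mul_eq hx, mul_assoc, h.mul_eq' hy]

lemma altWord_corner {k l : Fin d} {a b : A} (ha : p k * a * p l = a) (hb : p l * b * p k = b)
    (n : ℕ) : ∃ j, p k * altWord a b (n + 1) * p j = altWord a b (n + 1) := by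
  induction n generalizing a b k l with
  | zero => exact ⟨l, by simpa [altWord] using ha⟩
  | succ n ih =>
    obtain ⟨j, hj⟩ := ih hb ha
    exact ⟨j, h.mul_corner ha hj⟩

lemma pow_corner {k : Fin d} {a : A} (ha : p k * a * p k = a) (n : ℕ) :
    p k * a ^ (n + 1) * p k = a ^ (n + 1) := by
  induction n with
  | zero => simpa using ha
  | succ n ih => rw [pow_succ]; exact h.mul_corner ih ha

/-- As `k ≠ l`, the products `a * a` and `star a * star a` vanish, so only alternating words
survive. -/
lemma mem_span_altWord {k l : Fin d} (hkl : k ≠ l) {a : A} (ha : p k * a * p l = a) {x : A}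
    (hx : x ∈ StarAlgebra.adjoin ℂ (Set.range p ∪ {a})) :
    x ∈ Submodule.span ℂ (Set.range p ∪ (Set.range (fun n => altWord a (star a) (n + 1)) ∪
      Set.range fun n => altWord (star a) a (n + 1))) := by
  set W := Set.range p ∪ (Set.range (fun n => altWord a (star a) (n + 1)) ∪
      Set.range fun n => altWord (star a) a (n + 1)) with hW
  have hp : ∀ j, p j ∈ W := fun j => Or.inl ⟨j, rfl⟩
  have hA : ∀ n, altWord a (star a) (n + 1) ∈ W := fun n => Or.inr (Or.inl ⟨n, rfl⟩)
  have hB : ∀ n, altWord (star a) a (n + 1) ∈ W := fun n => Or.inr (Or.inr ⟨n, rfl⟩)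
  have hb := h.star_corner ha
  have mem_or : ∀ {x y : A}, x ∈ W → (y = x ∨ y = 0) → y ∈ Submodule.span ℂ W := by
    rintro x y hx (rfl | rfl)
    · exact Submodule.subset_span hx
    · exact zero_mem _
  refine mem_span_of_mem_adjoin (h.one_mem_span hp) ?_ hx
  have hproj : ∀ j, ∀ w ∈ W, p j * w ∈ Submodule.span ℂ W := by
    rintro j w hw
    refine mem_or hw ?_
    rcases hw with ⟨i, rfl⟩ | ⟨n, rfl⟩ | ⟨n, rfl⟩
    · exact h.mul_mem_or (by rw [h.idem, h.idem]) j
    · obtain ⟨i, hi⟩ := h.altWord_corner ha hb n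
      exact h.mul_mem_or hi j
    · obtain ⟨i, hi⟩ := h.altWord_corner hb ha n
      exact h.mul_mem_or hi j
  rintro g (⟨j, rfl⟩ | rfl) w hw
  · rw [h.star_eq]
    exact ⟨hproj j w hw, hproj j w hw⟩
  · rcases hw with ⟨i, rfl⟩ | ⟨n, rfl⟩ | ⟨n, rfl⟩
    · refine ⟨mem_or (x := g) ?_ (h.mul_mem_or' ha i), mem_or (x := star g) ?_ (h.mul_mem_or' hb i)⟩
      · simpa [altWord] using hA 0
      · simpa [altWord] using hB 0
    · obtain ⟨i, hi⟩ := h.altWord_corner ha hb n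
      refine ⟨?_, Submodule.subset_span (hB (n + 1))⟩
      rw [h.mul_eq_zero_of_ne ha hi hkl.symm]
      exact zero_mem _
    · obtain ⟨i, hi⟩ := h.altWord_corner hb ha n
      refine ⟨Submodule.subset_span (hA (n + 1)), ?_⟩
      rw [h.mul_eq_zero_of_ne hb hi hkl]
      exact zero_mem _

/-- The two alternatives are the hermitian letters and the unitary letters of a diagonal block. In
both, mixed words in `a` and `star a` reduce to powers or to `p k`. -/
lemma mem_span_pow {k : Fin d} {a : A} (ha : p k * a * p k = a)
    (hstar : star a = a ∨ a * star a = p k ∧ star a * a = p k) {x : A}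
    (hx : x ∈ StarAlgebra.adjoin ℂ (Set.range p ∪ {a})) :
    x ∈ Submodule.span ℂ (Set.range p ∪ (Set.range (fun n => a ^ (n + 1)) ∪
      Set.range fun n => star a ^ (n + 1))) := by
  set W := Set.range p ∪ (Set.range (fun n => a ^ (n + 1)) ∪
      Set.range fun n => star a ^ (n + 1)) with hW
  have hp : ∀ j, p j ∈ W := fun j => Or.inl ⟨j, rfl⟩
  have hA : ∀ n, a ^ (n + 1) ∈ W := fun n => Or.inr (Or.inl ⟨n, rfl⟩)
  have hB : ∀ n, star a ^ (n + 1) ∈ W := fun n => Or.inr (Or.inr ⟨n, rfl⟩)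
  have hb := h.star_corner ha
  have mem_or : ∀ {x y : A}, x ∈ W → (y = x ∨ y = 0) → y ∈ Submodule.span ℂ W := by
    rintro x y hx (rfl | rfl)
    · exact Submodule.subset_span hx
    · exact zero_mem _
  -- A letter put in front of a power of its adjoint lengthens the power in the hermitian case. In
  -- the unitary case it cancels one factor, which leaves `p k` when the power is the first one.
  have hmix : ∀ {a b : A}, p k * b * p k = b → (b = a ∨ a * b = p k) → (∀ n, a ^ (n + 1) ∈ W) →
      (∀ n, b ^ (n + 1) ∈ W) → ∀ n, a * b ^ (n + 1) ∈ Submodule.span ℂ W := by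
    rintro a b hb hab hA hB n
    refine Submodule.subset_span ?_
    rcases hab with rfl | hab
    · rw [← pow_succ']; exact hA _
    · rw [pow_succ', ← mul_assoc, hab]
      cases n with
      | zero => simpa using hp k
      | succ n => rw [h.mul_eq (h.pow_corner hb n)]; exact hB n
  refine mem_span_of_mem_adjoin (h.one_mem_span hp) ?_ hx
  have hproj : ∀ j, ∀ w ∈ W, p j * w ∈ Submodule.span ℂ W := by
    rintro j w hw
    refine mem_or hw ?_
    rcases hw with ⟨i, rfl⟩ | ⟨n, rfl⟩ | ⟨n, rfl⟩
    · exact h.mul_mem_or (by rw [h.idem, h.idem]) j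
    · exact h.mul_mem_or (h.pow_corner ha n) j
    · exact h.mul_mem_or (h.pow_corner hb n) j
  rintro g (⟨j, rfl⟩ | rfl) w hw
  · rw [h.star_eq]
    exact ⟨hproj j w hw, hproj j w hw⟩
  · rcases hw with ⟨i, rfl⟩ | ⟨n, rfl⟩ | ⟨n, rfl⟩
    · refine ⟨mem_or (x := g) ?_ (h.mul_mem_or' ha i), mem_or (x := star g) ?_ (h.mul_mem_or' hb i)⟩
      · simpa using hA 0
      · simpa using hB 0
    · refine ⟨Submodule.subset_span ?_, hmix ha (hstar.imp Eq.symm And.right) hB hA n⟩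
      rw [← pow_succ']
      exact hA (n + 1)
    · refine ⟨hmix hb (hstar.imp id And.left) hA hB n, Submodule.subset_span ?_⟩
      rw [← pow_succ']
      exact hB (n + 1)

end IsProjFamily

end AdjoinSpan

/-! ### Letters modified on a null set, as elements of the algebra of sequences -/

section Generators

open scoped Matrix.Norms.L2Operator

section Letters

variable {d : ℕ} {q : Fin d → ℕ}

lemma isProjFamily_blockProj (hq : ∀ k, 0 < q k) : IsProjFamily (blockProj q) :=
  ⟨(matrixSpace q hq).p_star, (matrixSpace q hq).p_idem, (matrixSpace q hq).p_orth,
    (matrixSpace q hq).p_sum⟩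

lemma IsBlockUnitary.star (hq : ∀ k, 0 < q k) {U : BMat q} (hU : IsBlockUnitary U) :
    IsBlockUnitary (star U) := by
  refine ⟨Unitary.star_mem hU.1, fun k => ?_⟩
  have := (hU.2 k).star_star
  rwa [(isProjFamily_blockProj hq).star_eq] at this

/-- The block matrices of norm at most `K` that satisfy the almost sure identities of the random
matrix of index `(s, k, l)`. -/
def letterSet (K : ℝ) (t : ℕ × Fin d × Fin d) (q : Fin d → ℕ) : Set (BMat q) :=
  {M | ‖M‖ ≤ K ∧ blockProj q t.2.1 * M * blockProj q t.2.2 = M ∧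
    (t.2.1 = t.2.2 → Even t.1 → star M = M) ∧
    (t.2.1 = t.2.2 → Odd t.1 → M * star M = blockProj q t.2.1 ∧ star M * M = blockProj q t.2.1)}

lemma measurableSet_letterSet (K : ℝ) (t : ℕ × Fin d × Fin d) : MeasurableSet (letterSet K t q) := by
  have h1 : IsClosed {M : BMat q | ‖M‖ ≤ K} := isClosed_le continuous_norm continuous_const
  have h2 : IsClosed {M : BMat q | blockProj q t.2.1 * M * blockProj q t.2.2 = M} :=
    isClosed_eq (by fun_prop) continuous_id
  have h3 : IsClosed {M : BMat q | star M = M} := isClosed_eq continuous_star continuous_id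
  have h4 : IsClosed {M : BMat q | M * star M = blockProj q t.2.1} :=
    isClosed_eq (continuous_id.mul continuous_star) continuous_const
  have h5 : IsClosed {M : BMat q | star M * M = blockProj q t.2.1} :=
    isClosed_eq (continuous_star.mul continuous_id) continuous_const
  refine h1.measurableSet.inter (h2.measurableSet.inter (MeasurableSet.inter ?_ ?_))
  · by_cases h : t.2.1 = t.2.2 ∧ Even t.1
    · refine (congrArg MeasurableSet (Set.ext fun M => ?_)).mpr h3.measurableSet
      exact ⟨fun hM => hM h.1 h.2, fun hM _ _ => hM⟩
    · refine (congrArg MeasurableSet (Set.ext fun M => ?_)).mpr MeasurableSet.univ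
      exact ⟨fun _ => trivial, fun _ h1 h2 => absurd ⟨h1, h2⟩ h⟩
  · by_cases h : t.2.1 = t.2.2 ∧ Odd t.1
    · refine (congrArg MeasurableSet (Set.ext fun M => ?_)).mpr (h4.measurableSet.inter h5.measurableSet)
      exact ⟨fun hM => hM h.1 h.2, fun hM _ _ => hM⟩
    · refine (congrArg MeasurableSet (Set.ext fun M => ?_)).mpr MeasurableSet.univ
      exact ⟨fun _ => trivial, fun _ h1 h2 => absurd ⟨h1, h2⟩ h⟩

lemma IsBlockUnitary.conj_blockProj {U : BMat q} (hU : IsBlockUnitary U) (k : Fin d) :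
    U * blockProj q k * Star.star U = blockProj q k := by
  rw [← (hU.2 k).eq, mul_assoc, Unitary.mul_star_self_of_mem hU.1, mul_one]

lemma conj_mul_conj {A : Type*} [Ring A] [StarRing A] {U : A} (hU : U ∈ unitary A) (x y : A) :
    U * x * star U * (U * y * star U) = U * (x * y) * star U := by
  calc U * x * star U * (U * y * star U) = U * x * (star U * U) * y * star U := by noncomm_ring
    _ = _ := by rw [Unitary.star_mul_self_of_mem hU]; noncomm_ring

lemma star_conj {A : Type*} [Ring A] [StarRing A] (U x : A) :
    star (U * x * star U) = U * star x * star U := by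
  simp only [star_mul, star_star, mul_assoc]

lemma conj_mem_letterSet {K : ℝ} {t : ℕ × Fin d × Fin d} {M U : BMat q} (hU : IsBlockUnitary U)
    (hM : M ∈ letterSet K t q) : U * M * star U ∈ letterSet K t q := by
  obtain ⟨h1, h2, h3, h4⟩ := hM
  refine ⟨(norm_conj_unitary hU.1 M).trans_le h1, ?_, fun e1 e2 => ?_, fun e1 e2 => ?_⟩
  · conv_rhs => rw [← h2, ← conj_mul_conj hU.1, ← conj_mul_conj hU.1, hU.conj_blockProj,
      hU.conj_blockProj]
  · rw [star_conj, h3 e1 e2]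
  · rw [star_conj, conj_mul_conj hU.1, conj_mul_conj hU.1, (h4 e1 e2).1, (h4 e1 e2).2,
      hU.conj_blockProj]
    exact ⟨rfl, rfl⟩

lemma conj_mem_letterSet_iff (hq : ∀ k, 0 < q k) {K : ℝ} {t : ℕ × Fin d × Fin d} {M U : BMat q}
    (hU : IsBlockUnitary U) : U * M * star U ∈ letterSet K t q ↔ M ∈ letterSet K t q := by
  refine ⟨fun h => ?_, conj_mem_letterSet hU⟩
  have := conj_mem_letterSet (hU.star hq) h
  rw [star_star] at this
  have e : star U * (U * M * star U) * U = star U * U * M * (star U * U) := by noncomm_ring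
  rwa [e, Unitary.star_mul_self_of_mem hU.1, one_mul, mul_one] at this

/-- An element of `letterSet` that is invariant under block diagonal conjugations. -/
def defaultLetter (t : ℕ × Fin d × Fin d) (q : Fin d → ℕ) : BMat q :=
  if t.2.1 = t.2.2 ∧ Odd t.1 then blockProj q t.2.1 else 0

lemma defaultLetter_mem (hq : ∀ k, 0 < q k) {K : ℝ} (hK : 1 ≤ K) (t : ℕ × Fin d × Fin d) :
    defaultLetter t q ∈ letterSet K t q := by
  have h := isProjFamily_blockProj hq
  by_cases ht : t.2.1 = t.2.2 ∧ Odd t.1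
  · rw [defaultLetter, if_pos ht]
    refine ⟨(norm_blockProj_le _).trans hK, ?_, fun _ e => absurd ht.2 (Nat.not_odd_iff_even.2 e),
      fun _ _ => ?_⟩
    · rw [← ht.1, h.idem, h.idem]
    · rw [h.star_eq, h.idem]
      exact ⟨rfl, rfl⟩
  · rw [defaultLetter, if_neg ht]
    refine ⟨by simpa using zero_le_one.trans hK, by simp, by simp, fun e1 e2 => absurd ⟨e1, e2⟩ ht⟩

lemma conj_defaultLetter {U : BMat q} (hU : IsBlockUnitary U) (t : ℕ × Fin d × Fin d) :
    U * defaultLetter t q * star U = defaultLetter t q := by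
  rw [defaultLetter]
  split_ifs
  · exact hU.conj_blockProj _
  · simp

open Classical in
/-- The modification of a block matrix that forces it to satisfy the almost sure identities of the
random matrix of index `t`. -/
noncomputable def clipLetter (K : ℝ) (t : ℕ × Fin d × Fin d) (M : BMat q) : BMat q :=
  if M ∈ letterSet K t q then M else defaultLetter t q

lemma clipLetter_mem (hq : ∀ k, 0 < q k) {K : ℝ} (hK : 1 ≤ K) (t : ℕ × Fin d × Fin d)
    (M : BMat q) : clipLetter K t M ∈ letterSet K t q := by
  rw [clipLetter]
  split_ifs with h
  · exact h
  · exact defaultLetter_mem hq hK t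

lemma clipLetter_of_mem {K : ℝ} {t : ℕ × Fin d × Fin d} {M : BMat q} (h : M ∈ letterSet K t q) :
    clipLetter K t M = M := if_pos h

lemma measurable_clipLetter (K : ℝ) (t : ℕ × Fin d × Fin d) :
    Measurable (clipLetter K t : BMat q → BMat q) :=
  Measurable.ite (measurableSet_letterSet K t) measurable_id measurable_const

/-- Both `letterSet` and the default value are stable under block diagonal conjugation. Clipping can
therefore make the almost sure identities hold everywhere, hence as equalities between sequences,
without losing equivariance. -/
lemma clipLetter_conj (hq : ∀ k, 0 < q k) (K : ℝ) (t : ℕ × Fin d × Fin d) {U : BMat q}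
    (hU : IsBlockUnitary U) (M : BMat q) :
    clipLetter K t (U * M * star U) = U * clipLetter K t M * star U := by
  by_cases h : M ∈ letterSet K t q
  · rw [clipLetter_of_mem h, clipLetter_of_mem (conj_mem_letterSet hU h)]
  · rw [clipLetter, clipLetter, if_neg h, if_neg (mt (conj_mem_letterSet_iff hq hU).1 h),
      conj_defaultLetter hU]

end Letters

variable {d : ℕ} {q : ℕ → Fin d → ℕ}

/-- A deterministic sequence. -/
def constSeq (q : ℕ → Fin d → ℕ) (T : Type) (D : ∀ n, BMat (q n)) : SeqAlg.{u} q T :=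
  fun n _ => D n.down

lemma constSeq_mem_bddAlg {T : Type} {D : ∀ n, BMat (q n)} {K : ℝ} (hD : ∀ n, ‖D n‖ ≤ K) :
    constSeq.{u} q T D ∈ bddAlg q T :=
  ⟨fun _ => measurable_const, K, fun n _ => hD n.down⟩

lemma constSeq_mem_equivAlg {T : Type} [DecidableEq T] (D : ∀ n, BMat (q n)) :
    constSeq.{u} q T D ∈ equivAlg q (none : Option T) := by
  intro n t U _ r
  rw [if_neg (by simp)]
  rfl

lemma seqProj_mem_equivAlg {T : Type} [DecidableEq T] (α : Option T) (k : Fin d) :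
    seqProj.{u} q T k ∈ equivAlg q α := by
  intro n t U hU r
  change blockProj _ _ = if α = some t then U * blockProj _ _ * star U else blockProj _ _
  rw [hU.conj_blockProj, ite_self]

lemma isProjFamily_seqProj (hq : ∀ n k, 0 < q n k) (T : Type) :
    IsProjFamily (seqProj.{u} q T) where
  star_eq k := funext fun n => funext fun _ => (isProjFamily_blockProj (hq n.down)).star_eq k
  idem k := funext fun n => funext fun _ => (isProjFamily_blockProj (hq n.down)).idem k
  orth k l hkl := funext fun n => funext fun _ => (isProjFamily_blockProj (hq n.down)).orth k l hkl
  sum_eq := funext fun n => funext fun r => by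
    rw [Finset.sum_apply, Finset.sum_apply]
    exact (isProjFamily_blockProj (hq n.down)).sum_eq

/-- The sequence of the random matrices of index `t`. -/
noncomputable def letterSeq (q : ℕ → Fin d → ℕ) (K : ℝ) (t : ℕ × Fin d × Fin d) :
    SeqAlg.{u} q (ℕ × Fin d × Fin d) :=
  fun _ r => clipLetter K t (r t)

lemma letterSeq_mem_bddAlg (hq : ∀ n k, 0 < q n k) {K : ℝ} (hK : 1 ≤ K) (t : ℕ × Fin d × Fin d) :
    letterSeq.{u} q K t ∈ bddAlg q _ :=
  ⟨fun _ => (measurable_clipLetter K t).comp (measurable_pi_apply t), K,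
    fun n r => (clipLetter_mem (hq n.down) hK t (r t)).1⟩

lemma letterSeq_mem_equivAlg (hq : ∀ n k, 0 < q n k) (K : ℝ) (t : ℕ × Fin d × Fin d) :
    letterSeq.{u} q K t ∈ equivAlg q (some t) := by
  intro n t' U hU r
  change clipLetter K t (conjCoord t' U r t)
    = if some t = some t' then U * clipLetter K t (r t) * star U else clipLetter K t (r t)
  by_cases h : t = t'
  · subst h
    rw [if_pos rfl, ← clipLetter_conj (hq n.down) K t hU, conjCoord, Function.update_self]
  · rw [if_neg (by simpa using h), conjCoord, Function.update_of_ne h]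

lemma letterSeq_corner (hq : ∀ n k, 0 < q n k) {K : ℝ} (hK : 1 ≤ K) (t : ℕ × Fin d × Fin d) :
    seqProj q _ t.2.1 * letterSeq.{u} q K t * seqProj q _ t.2.2 = letterSeq q K t :=
  funext fun n => funext fun r => (clipLetter_mem (hq n.down) hK t (r t)).2.1

lemma star_letterSeq (hq : ∀ n k, 0 < q n k) {K : ℝ} (hK : 1 ≤ K) {t : ℕ × Fin d × Fin d}
    (ht : t.2.1 = t.2.2) (hs : Even t.1) : star (letterSeq.{u} q K t) = letterSeq q K t :=
  funext fun n => funext fun r => (clipLetter_mem (hq n.down) hK t (r t)).2.2.1 ht hs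

lemma letterSeq_mul_star (hq : ∀ n k, 0 < q n k) {K : ℝ} (hK : 1 ≤ K) {t : ℕ × Fin d × Fin d}
    (ht : t.2.1 = t.2.2) (hs : Odd t.1) :
    letterSeq.{u} q K t * star (letterSeq q K t) = seqProj q _ t.2.1 ∧
      star (letterSeq.{u} q K t) * letterSeq q K t = seqProj q _ t.2.1 :=
  ⟨funext fun n => funext fun r => ((clipLetter_mem (hq n.down) hK t (r t)).2.2.2 ht hs).1,
    funext fun n => funext fun r => ((clipLetter_mem (hq n.down) hK t (r t)).2.2.2 ht hs).2⟩

end Generators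

/-! ### Asymptotic coordinates of elements of a corner -/

section Coordinates

open scoped Matrix.Norms.L2Operator

variable {d : ℕ} {q : ℕ → Fin d → ℕ} {T : Type} {μ : ∀ n, Measure (T → BMat (q n))}
  [∀ n, IsProbabilityMeasure (μ n)]

lemma hasCoord_of_tendsto (hq : ∀ n k, 0 < q n k) {x : SeqAlg.{u} q T} (hx : x ∈ bddAlg q T)
    {c : Fin d → ℂ}
    (h : ∀ k, Tendsto (fun n => ∫ r, ‖blockTr (q n) k (x ⟨n⟩ r) - c k‖ ∂μ n) atTop (𝓝 0)) :
    HasCoord μ x c := by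
  refine ⟨sub_mem hx (seqDiag_mem seqProj_mem_bddAlg c), fun k => (h k).congr fun n => ?_⟩
  congr 1; ext1 r
  rw [Pi.sub_apply, Pi.sub_apply, map_sub, seqDiag_apply, blockTr_sum_blockProj (hq n)]

lemma hasCoord_seqProj (k : Fin d) : HasCoord μ (seqProj.{u} q T k) (Pi.single k 1) := by
  rw [← one_smul ℂ (seqProj q T k), ← seqDiag_single]
  exact hasCoord_seqDiag _

lemma exists_hasCoord_of_mem_span {W : Set (SeqAlg.{u} q T)} (hW : ∀ x ∈ W, ∃ c, HasCoord μ x c)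
    {x : SeqAlg.{u} q T} (hx : x ∈ Submodule.span ℂ W) : ∃ c, HasCoord μ x c := by
  induction hx using Submodule.span_induction with
  | mem x hx => exact hW x hx
  | zero => exact ⟨0, isCentered_zero.hasCoord⟩
  | add y z _ _ hy hz =>
    obtain ⟨c, h⟩ := hy
    obtain ⟨c', h'⟩ := hz
    exact ⟨_, h.add h'⟩
  | smul z y _ hy =>
    obtain ⟨c, h⟩ := hy
    exact ⟨_, h.smul z⟩

/-- An element of an off-diagonal corner is centered. -/
lemma isCentered_of_corner {x : SeqAlg.{u} q T} (hx : x ∈ bddAlg q T) {k l : Fin d} (hkl : k ≠ l)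
    (h : seqProj q T k * x * seqProj q T l = x) : IsCentered μ x := by
  refine ⟨hx, fun j => ?_⟩
  have : ∀ n r, blockTr (q n) j (x ⟨n⟩ r) = 0 := by
    intro n r
    have e : blockProj (q n) k * x ⟨n⟩ r * blockProj (q n) l = x ⟨n⟩ r :=
      congrFun (congrFun h ⟨n⟩) r
    rw [← e, blockTr_mul_blockProj]
    split_ifs with h1
    · rw [blockTr_blockProj_mul, if_neg (h1 ▸ hkl)]
    · rfl
  simp [this]

/-- The coordinates of an element of a diagonal corner. -/
lemma hasCoord_of_corner (hq : ∀ n k, 0 < q n k) {x : SeqAlg.{u} q T} (hx : x ∈ bddAlg q T)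
    {k : Fin d} (h : seqProj q T k * x * seqProj q T k = x) {z : ℂ}
    (hz : Tendsto (fun n => ∫ r, ‖blockTr (q n) k (x ⟨n⟩ r) - z‖ ∂μ n) atTop (𝓝 0)) :
    HasCoord μ x (Pi.single k z) := by
  refine hasCoord_of_tendsto hq hx fun j => ?_
  by_cases hj : j = k
  · subst hj
    simpa using hz
  · have : ∀ n r, blockTr (q n) j (x ⟨n⟩ r) = 0 := by
      intro n r
      have e : blockProj (q n) k * x ⟨n⟩ r * blockProj (q n) k = x ⟨n⟩ r :=
        congrFun (congrFun h ⟨n⟩) r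
      rw [← e, blockTr_mul_blockProj, if_neg (Ne.symm hj)]
    simp [this, hj]

end Coordinates

/-! ### Powers of Haar unitary matrices -/

section HaarMoments

open scoped Matrix.Norms.L2Operator

section RootsOfUnity

variable {d : ℕ} {q : Fin d → ℕ}

/-- The diagonal matrix whose blocks consist of the roots of unity. -/
noncomputable def rootsDiag (q : Fin d → ℕ) : BMat q :=
  Matrix.diagonal fun x => Complex.exp (2 * Real.pi * Complex.I / (q x.1 : ℂ)) ^ (x.2 : ℕ)

lemma norm_rootsDiag_entry (x : BIdx q) :
    ‖Complex.exp (2 * Real.pi * Complex.I / (q x.1 : ℂ)) ^ (x.2 : ℕ)‖ = 1 := by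
  have : (2 * Real.pi * Complex.I / (q x.1 : ℂ)) = ((2 * Real.pi / q x.1 : ℝ) : ℂ) * Complex.I := by
    push_cast; ring
  rw [norm_pow, this, Complex.norm_exp_ofReal_mul_I, one_pow]

lemma isBlockUnitary_rootsDiag : IsBlockUnitary (rootsDiag q) := by
  have h : ∀ x : BIdx q, star (Complex.exp (2 * Real.pi * Complex.I / (q x.1 : ℂ)) ^ (x.2 : ℕ))
      * Complex.exp (2 * Real.pi * Complex.I / (q x.1 : ℂ)) ^ (x.2 : ℕ) = 1 := by
    intro x
    rw [Complex.star_def, ← Complex.normSq_eq_conj_mul_self, Complex.normSq_eq_norm_sq,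
      norm_rootsDiag_entry]
    simp
  refine ⟨Unitary.mem_iff.2 ⟨?_, ?_⟩, fun k => ?_⟩
  · rw [rootsDiag, Matrix.star_eq_conjTranspose, Matrix.diagonal_conjTranspose,
      Matrix.diagonal_mul_diagonal, ← Matrix.diagonal_one]
    congr 1; ext x
    exact h x
  · rw [rootsDiag, Matrix.star_eq_conjTranspose, Matrix.diagonal_conjTranspose,
      Matrix.diagonal_mul_diagonal, ← Matrix.diagonal_one]
    congr 1; ext x
    exact (mul_comm _ _).trans (h x)
  · rw [blockProj_eq, rootsDiag]
    exact Matrix.commute_diagonal _ _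

lemma norm_rootsDiag_le : ‖rootsDiag q‖ ≤ 1 := by
  rw [rootsDiag, Matrix.l2_opNorm_diagonal]
  exact (pi_norm_le_iff_of_nonneg zero_le_one).2 fun x => (norm_rootsDiag_entry x).le

lemma blockTr_rootsDiag {k : Fin d} (hk : 1 < q k) : blockTr q k (rootsDiag q) = 0 := by
  have h := (Complex.isPrimitiveRoot_exp (q k) (by omega)).geom_sum_eq_zero hk
  simp only [blockTr, rootsDiag, LinearMap.coe_mk, AddHom.coe_mk, Matrix.diagonal_apply_eq]
  rw [Fin.sum_univ_eq_sum_range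
    (fun i => Complex.exp (2 * Real.pi * Complex.I / (q k : ℂ)) ^ i), h, mul_zero]

lemma blockTr_conj {U : BMat q} (hU : IsBlockUnitary U) (k : Fin d) (X : BMat q) :
    blockTr q k (U * X * star U) = blockTr q k X := by
  have e : blockProj q k * (U * X * star U) = U * (blockProj q k * X) * star U := by
    rw [← mul_assoc, ← mul_assoc, (hU.2 k).eq, mul_assoc U]
  rw [blockTr_eq_trace, blockTr_eq_trace, e, Matrix.trace_mul_comm, ← mul_assoc,
    Unitary.star_mul_self_of_mem hU.1, one_mul]

/-- Left translation keeps a good unitary letter good, so clipping does not interfere with the left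
invariance of Haar letters. -/
lemma mul_mem_letterSet {K : ℝ} {t : ℕ × Fin d × Fin d} (ht : t.2.1 = t.2.2) (hs : Odd t.1)
    {M U : BMat q} (hU : IsBlockUnitary U) (hM : M ∈ letterSet K t q) :
    U * M ∈ letterSet K t q := by
  obtain ⟨h1, h2, h3, h4⟩ := hM
  refine ⟨?_, ?_, fun _ e => absurd hs (Nat.not_odd_iff_even.2 e), fun _ _ => ⟨?_, ?_⟩⟩
  · rwa [CStarRing.norm_mem_unitary_mul M hU.1]
  · rw [← mul_assoc, (hU.2 _).eq, mul_assoc U, mul_assoc U, h2]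
  · rw [star_mul, mul_assoc, ← mul_assoc M, (h4 ht hs).1, ← mul_assoc, hU.conj_blockProj]
  · rw [star_mul, mul_assoc, ← mul_assoc (star U), Unitary.star_mul_self_of_mem hU.1, one_mul,
      (h4 ht hs).2]

end RootsOfUnity

variable {d : ℕ} {q : ℕ → Fin d → ℕ} {T : Type} {μ : ∀ n, Measure (T → BMat (q n))}
  [∀ n, IsProbabilityMeasure (μ n)]

/-- Block diagonal conjugation changes neither the block traces nor the projectors. A letter minus
its own random expectation is thus still a letter of the same index, and it is centered before any
convergence of traces is known. -/
lemma seqExp_mem_equivAlg [DecidableEq T] {t : T} {x : SeqAlg.{u} q T}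
    (hx : x ∈ equivAlg q (some t)) : seqExp x ∈ equivAlg q (some t) := by
  have inv : ∀ (n : ℕ) {U : BMat (q n)}, IsBlockUnitary U → ∀ X,
      U * expD (q n) X * star U = expD (q n) X := by
    intro n U hU X
    rw [expD_apply, Finset.mul_sum, Finset.sum_mul]
    refine Finset.sum_congr rfl fun k _ => ?_
    rw [mul_smul_comm, smul_mul_assoc, hU.conj_blockProj]
  intro n t' U hU r
  change expD (q n.down) (x n (conjCoord t' U r)) = if some t = some t' then
    U * expD (q n.down) (x n r) * star U else expD (q n.down) (x n r)
  rw [hx n t' U hU r]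
  split_ifs
  · rw [inv _ hU, expD_apply, expD_apply]
    simp only [blockTr_conj hU]
  · rfl

lemma IsCentered.star {x : SeqAlg.{u} q T} (hx : IsCentered μ x) : IsCentered μ (star x) := by
  refine isCentered_of_blockTr_le hx (star_mem hx.1) fun n k r => ?_
  rw [Pi.star_apply, Pi.star_apply, blockTr_star]
  simp

lemma isCentered_sub_seqExp (hq : ∀ n k, 0 < q n k) {x : SeqAlg.{u} q T} (hx : x ∈ bddAlg q T) :
    IsCentered μ (x - seqExp x) := by
  refine ⟨sub_mem hx (seqExp_mem_bddAlg hx), fun k => ?_⟩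
  have : ∀ n r, blockTr (q n) k ((x - seqExp x) ⟨n⟩ r) = 0 := by
    intro n r
    change blockTr (q n) k (x ⟨n⟩ r - expD (q n) (x ⟨n⟩ r)) = 0
    rw [map_sub, blockTr_expD (hq n), sub_self]
  simp only [this, norm_zero, integral_zero]
  exact tendsto_const_nhds

/-- The sequence of the diagonal matrices of roots of unity. -/
noncomputable def rootsSeq (q : ℕ → Fin d → ℕ) (T : Type) : SeqAlg.{u} q T :=
  constSeq q T fun n => rootsDiag (q n)

lemma rootsSeq_mem_bddAlg : rootsSeq.{u} q T ∈ bddAlg q T :=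
  constSeq_mem_bddAlg fun _ => norm_rootsDiag_le

lemma isCentered_rootsSeq (hq_top : ∀ k, Tendsto (fun n => q n k) atTop atTop) :
    IsCentered μ (rootsSeq.{u} q T) := by
  refine ⟨rootsSeq_mem_bddAlg, fun k => tendsto_const_nhds.congr' ?_⟩
  filter_upwards [(hq_top k).eventually_gt_atTop 1] with n hn
  simp [rootsSeq, constSeq, blockTr_rootsDiag hn]

lemma isCentered_rootsSeq_mul_seqExp (hq_top : ∀ k, Tendsto (fun n => q n k) atTop atTop)
    {x : SeqAlg.{u} q T} (hx : x ∈ bddAlg q T) :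
    IsCentered μ (rootsSeq q T * seqExp x) := by
  refine ⟨mul_mem rootsSeq_mem_bddAlg (seqExp_mem_bddAlg hx),
    fun k => tendsto_const_nhds.congr' ?_⟩
  filter_upwards [(hq_top k).eventually_gt_atTop 1] with n hn
  have : ∀ r, blockTr (q n) k ((rootsSeq q T * seqExp x) ⟨n⟩ r) = 0 := by
    intro r
    change blockTr (q n) k (rootsDiag (q n) * expD (q n) (x ⟨n⟩ r)) = 0
    rw [expD_apply, Finset.mul_sum, map_sum]
    refine Finset.sum_eq_zero fun j _ => ?_
    rw [mul_smul_comm, map_smul, blockTr_mul_blockProj, blockTr_rootsDiag hn, ite_self, smul_zero]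
  simp only [this, norm_zero, integral_zero]

/-- The word `z x z x ⋯` with `j` pairs of letters. -/
def pairWord (t : T) (z x : SeqAlg.{u} q T) : ℕ → List (Option T × SeqAlg.{u} q T)
  | 0 => []
  | j + 1 => (none, z) :: (some t, x) :: pairWord t z x j

lemma prod_pairWord (t : T) (z x : SeqAlg.{u} q T) (j : ℕ) :
    ((pairWord t z x j).map Prod.snd).prod = (z * x) ^ j := by
  induction j with
  | zero => simp [pairWord]
  | succ j ih => simp [pairWord, ih, pow_succ', mul_assoc]

lemma isChain_pairWord (t : T) (z x : SeqAlg.{u} q T) (j : ℕ) :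
    (pairWord t z x j).IsChain fun s t => s.1 ≠ t.1 := by
  induction j with
  | zero => simp [pairWord]
  | succ j ih =>
    cases j with
    | zero => simp [pairWord]
    | succ j =>
      rw [pairWord, List.isChain_cons_cons]
      refine ⟨by simp, ?_⟩
      rw [pairWord] at ih ⊢
      rw [List.isChain_cons_cons]
      exact ⟨by simp, ih⟩

lemma mem_pairWord {t : T} {z x : SeqAlg.{u} q T} {j : ℕ} {p : Option T × SeqAlg.{u} q T}
    (hp : p ∈ pairWord t z x j) : p = (none, z) ∨ p = (some t, x) := by
  induction j with
  | zero => simp [pairWord] at hp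
  | succ j ih =>
    rw [pairWord, List.mem_cons, List.mem_cons] at hp
    exact hp.elim Or.inl (Or.elim · Or.inr ih)

/-- The positive powers of Haar distributed unitary matrices are centered. -/
lemma isCentered_letterSeq_pow
    {μ : ∀ n, Measure (ℕ × Fin d × Fin d → BMat (q n))} [∀ n, IsProbabilityMeasure (μ n)]
    (hq : ∀ n k, 0 < q n k) (hq_top : ∀ k, Tendsto (fun n => q n k) atTop atTop)
    (hμ : ∀ n t (U : BMat (q n)), IsBlockUnitary U →
      MeasurePreserving (conjCoord t U) (μ n) (μ n))
    {K : ℝ} (hK : 1 ≤ K) {t : ℕ × Fin d × Fin d} (ht : t.2.1 = t.2.2) (hs : Odd t.1)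
    (hleft : ∀ n (U : BMat (q n)), IsBlockUnitary U →
      MeasurePreserving (fun r => Function.update r t (U * r t)) (μ n) (μ n))
    (hgood : ∀ n, ∀ᵐ r ∂μ n, r t ∈ letterSet K t (q n)) (j : ℕ) :
    IsCentered μ (letterSeq.{u} q K t ^ (j + 1)) := by
  set a := letterSeq.{u} q K t with ha
  set z := rootsSeq.{u} q (ℕ × Fin d × Fin d) with hz
  have hab : a ∈ bddAlg q _ := letterSeq_mem_bddAlg hq hK t
  have hae : a ∈ equivAlg q (some t) := letterSeq_mem_equivAlg hq K t
  have hze : z ∈ equivAlg q none := constSeq_mem_equivAlg _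
  have hzc : IsCentered μ z := isCentered_rootsSeq hq_top
  -- By left invariance `a` and `z * a` have the same law, so the traces of their powers have the
  -- same mean absolute values.
  have transfer : ∀ j, IsCentered μ ((z * a) ^ (j + 1)) → IsCentered μ (a ^ (j + 1)) := by
    intro j hj
    refine ⟨pow_mem hab _, fun k => (hj.2 k).congr fun n => ?_⟩
    have hmp := hleft n _ (isBlockUnitary_rootsDiag (q := q n))
    have e := integral_map (μ := μ n) hmp.measurable.aemeasurable
      (f := fun r => ‖blockTr (q n) k ((a ^ (j + 1)) ⟨n⟩ r)‖)
      (((measurable_blockTr k).comp ((pow_mem hab (j + 1)).1 ⟨n⟩)).norm.aestronglyMeasurable)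
    rw [hmp.map_eq] at e
    rw [e]
    refine integral_congr_ae ?_
    filter_upwards [hgood n] with r hr
    have h1 : a ⟨n⟩ (Function.update r t (rootsDiag (q n) * r t))
        = rootsDiag (q n) * a ⟨n⟩ r := by
      change clipLetter K t (Function.update r t (rootsDiag (q n) * r t) t)
        = rootsDiag (q n) * clipLetter K t (r t)
      rw [Function.update_self, clipLetter_of_mem hr,
        clipLetter_of_mem (mul_mem_letterSet ht hs isBlockUnitary_rootsDiag hr)]
    change ‖blockTr (q n) k ((rootsDiag (q n) * a ⟨n⟩ r) ^ (j + 1))‖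
      = ‖blockTr (q n) k (a ⟨n⟩ (Function.update r t (rootsDiag (q n) * r t)) ^ (j + 1))‖
    rw [h1]
  -- The trace of `a` is not yet known to converge, so write `z * a = z * (a - seqExp a) + z *
  -- seqExp a`. The first term is alternating and centered; the second has zero block traces once `q
  -- n k > 1`, since `z` has.
  have hac : IsCentered μ a := by
    have h1 : IsCentered μ ([(none, z), (some t, a - seqExp a)].map Prod.snd).prod := by
      refine isCentered_prod hq hq_top hμ _ (by simp) (by simp) ?_
      intro p hp
      rw [List.mem_cons, List.mem_singleton] at hp
      rcases hp with rfl | rfl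
      · exact ⟨hze, hzc⟩
      · exact ⟨sub_mem hae (seqExp_mem_equivAlg hae), isCentered_sub_seqExp hq hab⟩
    have h2 := h1.add (isCentered_rootsSeq_mul_seqExp hq_top hab)
    have h3 := transfer 0
    simp only [zero_add, pow_one] at h3
    refine h3 ?_
    have e : z * a = ([(none, z), (some t, a - seqExp a)].map
      (Prod.snd : Option (ℕ × Fin d × Fin d) × SeqAlg.{u} q _ → _)).prod + z * seqExp a := by
      simp [mul_sub]
    rw [e]
    exact h2
  refine transfer j ?_
  rw [← prod_pairWord t]
  refine isCentered_prod hq hq_top hμ _ (by simp [pairWord]) (isChain_pairWord _ _ _ _) fun p hp => ?_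
  rcases mem_pairWord hp with rfl | rfl
  · exact ⟨hze, hzc⟩
  · exact ⟨hae, hac⟩

end HaarMoments

/-! ### Moments from weak convergence in probability -/

section Laws

open scoped Matrix

/-- Bounded convergence in probability: `|c n * Y - c' * y| ≤ |Y - y| + |c n - c'| * |y|`, and on
the event of small probability where this is large, the integrand is at most `M + ‖z‖`. -/
lemma tendsto_integral_norm_sub {Ω : Type*} [MeasurableSpace Ω] {P : Measure Ω}
    [IsProbabilityMeasure P] {X : ℕ → Ω → ℂ} (hX : ∀ n, Measurable (X n)) {M : ℝ}
    (hM : ∀ n ω, ‖X n ω‖ ≤ M) {Y : ℕ → Ω → ℝ} {y : ℝ}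
    (hY : TendstoInMeasure P Y atTop fun _ => y) {c : ℕ → ℝ} {c' : ℝ} (hc1 : ∀ n, |c n| ≤ 1)
    (hc : Tendsto c atTop (𝓝 c')) (hXY : ∀ n, ∀ᵐ ω ∂P, X n ω = ((c n * Y n ω : ℝ) : ℂ)) :
    Tendsto (fun n => ∫ ω, ‖X n ω - ((c' * y : ℝ) : ℂ)‖ ∂P) atTop (𝓝 0) := by
  set z : ℂ := ((c' * y : ℝ) : ℂ) with hz
  have hbound : ∀ n ω, ‖X n ω - z‖ ≤ M + ‖z‖ := fun n ω =>
    (norm_sub_le _ _).trans (by gcongr; exact hM n ω)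
  have hM0 : 0 ≤ M + ‖z‖ := (norm_nonneg _).trans (hbound 0 (Classical.choice P.nonempty_of_neZero))
  rw [tendstoInMeasure_iff_measureReal_norm] at hY
  rw [Metric.tendsto_atTop]
  intro ε hε
  -- Two errors of `ε / 4` keep the integrand below `ε / 2` off the exceptional event, which itself
  -- costs at most another `ε / 4`.
  have h1 : Tendsto (fun n => (M + ‖z‖) * P.real {ω | ε / 4 ≤ ‖Y n ω - y‖}) atTop (𝓝 0) := by
    simpa using (hY (ε / 4) (by positivity)).const_mul (M + ‖z‖)
  have h2 : Tendsto (fun n => |c n - c'| * |y|) atTop (𝓝 0) := by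
    have := ((hc.sub_const c').abs).mul_const |y|
    simpa using this
  obtain ⟨N, hN⟩ := eventually_atTop.1 ((h1.eventually_lt_const (show (0 : ℝ) < ε / 4 by positivity)).and
    (h2.eventually_lt_const (show (0 : ℝ) < ε / 4 by positivity)))
  refine ⟨N, fun n hn => ?_⟩
  obtain ⟨a1, a2⟩ := hN n hn
  have hmX : Measurable fun ω => ‖X n ω - z‖ := ((hX n).sub_const z).norm
  have hS : MeasurableSet {ω | ε / 2 ≤ ‖X n ω - z‖} := measurableSet_le measurable_const hmX
  have hsub : P.real {ω | ε / 2 ≤ ‖X n ω - z‖} ≤ P.real {ω | ε / 4 ≤ ‖Y n ω - y‖} := by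
    refine ENNReal.toReal_mono (measure_ne_top _ _) (measure_mono_ae ?_)
    filter_upwards [hXY n] with ω hω h
    change ε / 2 ≤ ‖X n ω - z‖ at h
    change ε / 4 ≤ ‖Y n ω - y‖
    rw [hω, hz, ← Complex.ofReal_sub, Complex.norm_real, Real.norm_eq_abs] at h
    have e : c n * Y n ω - c' * y = c n * (Y n ω - y) + (c n - c') * y := by ring
    rw [e] at h
    have h3 := abs_add_le (c n * (Y n ω - y)) ((c n - c') * y)
    rw [abs_mul, abs_mul] at h3
    have h4 : |c n| * |Y n ω - y| ≤ 1 * |Y n ω - y| :=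
      mul_le_mul_of_nonneg_right (hc1 n) (abs_nonneg _)
    rw [Real.norm_eq_abs]
    linarith
  have hint : ∫ ω, ‖X n ω - z‖ ∂P
      ≤ ∫ ω, (ε / 2 + {ω | ε / 2 ≤ ‖X n ω - z‖}.indicator (fun _ => M + ‖z‖) ω) ∂P := by
    refine integral_mono (Integrable.of_bound hmX.aestronglyMeasurable (M + ‖z‖)
      (.of_forall fun ω => by rw [norm_norm]; exact hbound n ω))
      ((integrable_const _).add ((integrable_const _).indicator hS)) fun ω => ?_
    by_cases h : ω ∈ {ω | ε / 2 ≤ ‖X n ω - z‖}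
    · simp only [Set.indicator_of_mem h]
      linarith [hbound n ω]
    · simp only [Set.indicator_of_notMem h, add_zero]
      exact (not_le.1 h).le
  rw [integral_add (integrable_const _) ((integrable_const _).indicator hS),
    integral_indicator_const _ hS, integral_const, probReal_univ, one_smul, smul_eq_mul] at hint
  rw [Real.dist_eq, sub_zero, abs_of_nonneg (integral_nonneg fun _ => norm_nonneg _)]
  have := mul_le_mul_of_nonneg_left hsub hM0
  linarith

/-- The power function, cut off outside of `[-K, K]`. -/
noncomputable def cutPow {K : ℝ} (hK : 0 ≤ K) (j : ℕ) : ℝ →ᵇ ℝ :=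
  BoundedContinuousFunction.ofNormedAddCommGroup (fun x => (max (-K) (min K x)) ^ j)
    (by fun_prop) (K ^ j) fun x => by
      rw [norm_pow, Real.norm_eq_abs]
      refine pow_le_pow_left₀ (abs_nonneg _) (abs_le.2 ⟨le_max_left _ _, ?_⟩) _
      exact max_le (by linarith) (min_le_left _ _)

lemma cutPow_apply {K : ℝ} (hK : 0 ≤ K) (j : ℕ) {x : ℝ} (hx : |x| ≤ K) :
    cutPow hK j x = x ^ j := by
  obtain ⟨h1, h2⟩ := abs_le.1 hx
  change (max (-K) (min K x)) ^ j = x ^ j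
  rw [min_eq_right h2, max_eq_right h1]

lemma integral_singularLaw {m n : ℕ} (M : Matrix (Fin m) (Fin n) ℂ) (f : ℝ →ᵇ ℝ) :
    ∫ t, f t ∂(singularLaw M) = ((min m n : ℕ) : ℝ)⁻¹ * ∑ i, f (singVal M i) := by
  rw [singularLaw, integral_smul_measure,
    integral_finsetSum_measure fun i _ => f.integrable _]
  simp

lemma integral_spectralLaw {m : ℕ} {M : Matrix (Fin m) (Fin m) ℂ} (hM : M.IsHermitian)
    (f : ℝ →ᵇ ℝ) : ∫ t, f t ∂(spectralLaw M) = (m : ℝ)⁻¹ * ∑ i, f (hM.eigenvalues i) := by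
  have e : ((spec M).map fun z => Measure.dirac z.re).sum
      = ∑ i, Measure.dirac (hM.eigenvalues i) := by
    rw [spec, hM.roots_charpoly_eq_eigenvalues, Multiset.map_map]
    rfl
  rw [spectralLaw, e, integral_smul_measure,
    integral_finsetSum_measure fun i _ => f.integrable _]
  simp

lemma trace_mul_conjTranspose_pow {m n : ℕ} (M : Matrix (Fin m) (Fin n) ℂ) (j : ℕ) :
    ((M * Mᴴ) ^ (j + 1)).trace = ((Mᴴ * M) ^ (j + 1)).trace := by
  have e : (M * Mᴴ) ^ (j + 1) = M * (Mᴴ * M) ^ j * Mᴴ := by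
    induction j with
    | zero => simp
    | succ j ih => rw [pow_succ, ih, pow_succ _ j]; simp only [Matrix.mul_assoc]
  rw [e, Matrix.mul_assoc, Matrix.trace_mul_comm, Matrix.mul_assoc, ← pow_succ]

/-- All singular values lie in `[0, K]`, where the cut-off power is the power. The singular law is
normalized by `min m n` and not by a block size, which explains the ratio `min (q k) (q l) / q k`
further on. -/
lemma trace_conjTranspose_mul_self_pow_eq_integral {K : ℝ} (hK : 0 ≤ K) {m n : ℕ}
    {M : Matrix (Fin m) (Fin n) ℂ} (hM : opNorm M ≤ K) (j : ℕ) :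
    ((Mᴴ * M) ^ (j + 1)).trace
      = (((min m n : ℕ) * ∫ t, cutPow hK (2 * (j + 1)) t ∂(singularLaw M) : ℝ) : ℂ) := by
  rw [trace_conjTranspose_mul_self_pow, integral_singularLaw]
  have h : ∀ i, cutPow hK (2 * (j + 1)) (singVal M i) = singVal M i ^ (2 * (j + 1)) := fun i =>
    cutPow_apply hK _ (by
      rw [abs_of_nonneg (singVal_nonneg M i)]
      exact (singVal_le_opNorm M i).trans hM)
  simp only [h]
  rcases Nat.eq_zero_or_pos (min m n) with h0 | h0
  · have : IsEmpty (Fin (min m n)) := ⟨fun i => by have := i.2; omega⟩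
    simp [Finset.univ_eq_empty]
  · have : ((min m n : ℕ) : ℝ) ≠ 0 := by exact_mod_cast h0.ne'
    rw [mul_inv_cancel_left₀ this]
    push_cast; rfl

lemma trace_pow_eq_integral {K : ℝ} (hK : 0 ≤ K) {m : ℕ}
    {M : Matrix (Fin m) (Fin m) ℂ} (hM : M.IsHermitian) (hMK : opNorm M ≤ K) (j : ℕ) :
    (m : ℂ)⁻¹ * (M ^ j).trace = ((∫ t, cutPow hK j t ∂(spectralLaw M) : ℝ) : ℂ) := by
  rw [trace_pow_of_isHermitian hM, integral_spectralLaw hM]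
  have h : ∀ i, cutPow hK j (hM.eigenvalues i) = hM.eigenvalues i ^ j := fun i =>
    cutPow_apply hK _ ((abs_eigenvalues_le_opNorm hM i).trans hMK)
  simp only [h]
  push_cast; rfl

/-- If `ρ k ≠ 0`, divide the limits. If `ρ k = 0 < ρ l`, the block `k` is eventually the smaller one
and the quotient is `1`. Two vanishing ratios would leave the quotient undetermined. -/
lemma exists_tendsto_min_div {d : ℕ} {q : ℕ → Fin d → ℕ} (hq : ∀ n k, 0 < q n k) {ρ : Fin d → ℝ}
    (hρ : ∀ k, Tendsto (fun n => (q n k : ℝ) / ((∑ l, q n l : ℕ) : ℝ)) atTop (𝓝 (ρ k)))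
    {k l : Fin d} (h : ρ k ≠ 0 ∨ 0 < ρ l) :
    ∃ c, Tendsto (fun n => ((min (q n k) (q n l) : ℕ) : ℝ) / q n k) atTop (𝓝 c) := by
  have hN : ∀ n, (0 : ℝ) < ((∑ l, q n l : ℕ) : ℝ) := fun n => by
    exact_mod_cast (hq n k).trans_le (Finset.single_le_sum (f := q n) (fun _ _ => Nat.zero_le _)
      (Finset.mem_univ k))
  by_cases hk0 : ρ k = 0
  · have hl : 0 < ρ l := h.resolve_left (not_not.2 hk0)
    refine ⟨1, tendsto_const_nhds.congr' ?_⟩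
    have hlt : ρ k < ρ l := hk0 ▸ hl
    filter_upwards [(hρ k).eventually_lt (hρ l) hlt] with n hn
    rw [div_lt_div_iff_of_pos_right (hN n)] at hn
    rw [min_eq_left (by exact_mod_cast hn.le), div_self (by exact_mod_cast (hq n k).ne')]
  · refine ⟨min (ρ k) (ρ l) / ρ k, (((hρ k).min (hρ l)).div (hρ k) hk0).congr fun n => ?_⟩
    simp only [Pi.div_apply]
    rw [min_div_div_right (hN n).le, div_div_div_cancel_right₀ (hN n).ne']
    push_cast; rfl

end Laws

/-! ### Asymptotic traces on the algebra of a single letter and on that of the constants -/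

section LetterCoordinates

open scoped Matrix Matrix.Norms.L2Operator

variable {d : ℕ} {q : ℕ → Fin d → ℕ} {T : Type} {μ : ∀ n, Measure (T → BMat (q n))}
  [∀ n, IsProbabilityMeasure (μ n)]
  {Ω : Type v} [MeasurableSpace Ω] {P : Measure Ω} [IsProbabilityMeasure P]
  {r : ∀ n, Ω → T → BMat (q n)}

/-- The coordinate of an element of a diagonal corner, from a convergence in probability of the
normalized traces. -/
lemma hasCoord_of_tendstoInMeasure (hq : ∀ n k, 0 < q n k) (hr : ∀ n, Measurable (r n))
    (hμ : ∀ n, P.map (r n) = μ n) {x : SeqAlg.{u} q T} (hx : x ∈ bddAlg q T) {k : Fin d}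
    (hcorner : seqProj q T k * x * seqProj q T k = x) {Y : ℕ → Ω → ℝ} {y : ℝ}
    (hY : TendstoInMeasure P Y atTop fun _ => y) {c : ℕ → ℝ} {c' : ℝ} (hc1 : ∀ n, |c n| ≤ 1)
    (hc : Tendsto c atTop (𝓝 c'))
    (hXY : ∀ n, ∀ᵐ ω ∂P, blockTr (q n) k (x ⟨n⟩ (r n ω)) = ((c n * Y n ω : ℝ) : ℂ)) :
    HasCoord μ x (Pi.single k ((c' * y : ℝ) : ℂ)) := by
  obtain ⟨M, hM⟩ := hx.2
  have hm : ∀ n, Measurable fun s : T → BMat (q n) => blockTr (q n) k (x ⟨n⟩ s) := fun n =>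
    (measurable_blockTr k).comp (hx.1 ⟨n⟩)
  refine hasCoord_of_corner hq hx hcorner ?_
  refine (tendsto_integral_norm_sub (fun n => (hm n).comp (hr n))
    (fun n ω => (norm_blockTr_le k _).trans (hM ⟨n⟩ (r n ω))) hY hc1 hc hXY).congr fun n => ?_
  rw [← hμ n, integral_map (hr n).aemeasurable ((hm n).sub_const _).norm.aestronglyMeasurable]
  rfl

/-- Alternating words of odd length lie in an off-diagonal corner and have no trace. Those of even
length have a moment of the singular law as normalized trace, up to the quotient of `min (q n k) (q
n l)` by the size of the block. -/
lemma exists_hasCoord_adjoin_rect (hq : ∀ n k, 0 < q n k) (hr : ∀ n, Measurable (r n))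
    (hμ : ∀ n, P.map (r n) = μ n) {k l : Fin d} (hkl : k ≠ l) {a : SeqAlg.{u} q T}
    (ha : a ∈ bddAlg q T) (hcorner : seqProj q T k * a * seqProj q T l = a)
    {M : ∀ n, Ω → Matrix (Fin (q n k)) (Fin (q n l)) ℂ}
    (hM : ∀ n, ∀ᵐ ω ∂P, a ⟨n⟩ (r n ω) = embed (M n ω)) {K : ℝ} (hK : 0 ≤ K)
    (hMK : ∀ n, ∀ᵐ ω ∂P, opNorm (M n ω) ≤ K) {ν : Measure ℝ}
    (hν : WeakConvInProb P (fun n ω => singularLaw (M n ω)) ν)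
    (hk : ∃ c, Tendsto (fun n => ((min (q n k) (q n l) : ℕ) : ℝ) / q n k) atTop (𝓝 c))
    (hl : ∃ c, Tendsto (fun n => ((min (q n l) (q n k) : ℕ) : ℝ) / q n l) atTop (𝓝 c))
    {x : SeqAlg.{u} q T} (hx : x ∈ StarAlgebra.adjoin ℂ (Set.range (seqProj q T) ∪ {a})) :
    ∃ c, HasCoord μ x c := by
  have h := isProjFamily_seqProj.{u} hq T
  have hb := star_mem ha
  have hbcorner := h.star_corner hcorner
  have hmul : ∀ {x y : SeqAlg.{u} q T}, x ∈ bddAlg q T → y ∈ bddAlg q T → ∀ j,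
      (x * y) ^ j ∈ bddAlg q T := fun hx hy j => pow_mem (mul_mem hx hy) j
  have hle : ∀ (n : ℕ) (i j : Fin d), |((min (q n i) (q n j) : ℕ) : ℝ) / q n i| ≤ 1 := by
    intro n i j
    rw [abs_of_nonneg (by positivity)]
    exact div_le_one_of_le₀ (by exact_mod_cast min_le_left _ _) (by positivity)
  have hab : ∀ j, ∃ c, HasCoord μ ((a * star a) ^ (j + 1)) c := by
    intro j
    obtain ⟨c, hc⟩ := hk
    refine ⟨_, hasCoord_of_tendstoInMeasure hq hr hμ (hmul ha hb _)
      (h.pow_corner (h.mul_corner hcorner hbcorner) j) (hν (cutPow hK (2 * (j + 1))))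
      (fun n => hle n k l) hc fun n => ?_⟩
    filter_upwards [hM n, hMK n] with ω h1 h2
    change blockTr (q n) k ((a ⟨n⟩ (r n ω) * star (a ⟨n⟩ (r n ω))) ^ (j + 1)) = _
    rw [h1, star_embed, embed_mul_embed, embed_pow_succ, blockTr_embed,
      trace_mul_conjTranspose_pow, trace_conjTranspose_mul_self_pow_eq_integral hK h2]
    push_cast; ring
  have hba : ∀ j, ∃ c, HasCoord μ ((star a * a) ^ (j + 1)) c := by
    intro j
    obtain ⟨c, hc⟩ := hl
    refine ⟨_, hasCoord_of_tendstoInMeasure hq hr hμ (hmul hb ha _)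
      (h.pow_corner (h.mul_corner hbcorner hcorner) j) (hν (cutPow hK (2 * (j + 1))))
      (fun n => hle n l k) hc fun n => ?_⟩
    filter_upwards [hM n, hMK n] with ω h1 h2
    change blockTr (q n) l ((star (a ⟨n⟩ (r n ω)) * a ⟨n⟩ (r n ω)) ^ (j + 1)) = _
    rw [h1, star_embed, embed_mul_embed, embed_pow_succ, blockTr_embed,
      trace_conjTranspose_mul_self_pow_eq_integral hK h2, min_comm]
    push_cast; ring
  have hodd : ∀ {i j : Fin d} {x y : SeqAlg.{u} q T}, x ∈ bddAlg q T → y ∈ bddAlg q T → i ≠ j →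
      seqProj q T i * x * seqProj q T j = x → seqProj q T j * y * seqProj q T i = y →
      ∀ m, ∃ c, HasCoord μ ((x * y) ^ m * x) c := by
    intro i j x y hx hy hij hxc hyc m
    refine ⟨0, (isCentered_of_corner (mul_mem (hmul hx hy m) hx) hij ?_).hasCoord⟩
    cases m with
    | zero => simpa using hxc
    | succ m => exact h.mul_corner (h.pow_corner (h.mul_corner hxc hyc) m) hxc
  refine exists_hasCoord_of_mem_span ?_ (h.mem_span_altWord hkl hcorner hx)
  rintro _ (⟨i, rfl⟩ | ⟨n, rfl⟩ | ⟨n, rfl⟩)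
  · exact ⟨_, hasCoord_seqProj i⟩
  · obtain ⟨m, hm⟩ := Nat.even_or_odd' (n + 1)
    dsimp only
    rcases hm with hm | hm
    · rw [hm, altWord_two_mul]
      obtain ⟨j, rfl⟩ : ∃ j, m = j + 1 := ⟨m - 1, by omega⟩
      exact hab j
    · rw [hm, altWord_two_mul_add_one]
      exact hodd ha hb hkl hcorner hbcorner m
  · obtain ⟨m, hm⟩ := Nat.even_or_odd' (n + 1)
    dsimp only
    rcases hm with hm | hm
    · rw [hm, altWord_two_mul]
      obtain ⟨j, rfl⟩ : ∃ j, m = j + 1 := ⟨m - 1, by omega⟩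
      exact hba j
    · rw [hm, altWord_two_mul_add_one]
      exact hodd hb ha hkl.symm hbcorner hcorner m

/-- The algebra is spanned by powers, whose traces are moments of the spectral law. -/
lemma exists_hasCoord_adjoin_hermitian (hq : ∀ n k, 0 < q n k) (hr : ∀ n, Measurable (r n))
    (hμ : ∀ n, P.map (r n) = μ n) {k : Fin d} {a : SeqAlg.{u} q T}
    (ha : a ∈ bddAlg q T) (hcorner : seqProj q T k * a * seqProj q T k = a) (hstar : star a = a)
    {M : ∀ n, Ω → Matrix (Fin (q n k)) (Fin (q n k)) ℂ}
    (hM : ∀ n, ∀ᵐ ω ∂P, a ⟨n⟩ (r n ω) = embed (M n ω))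
    (hMh : ∀ n, ∀ᵐ ω ∂P, (M n ω).IsHermitian) {K : ℝ} (hK : 0 ≤ K)
    (hMK : ∀ n, ∀ᵐ ω ∂P, opNorm (M n ω) ≤ K) {ν : Measure ℝ}
    (hν : WeakConvInProb P (fun n ω => spectralLaw (M n ω)) ν)
    {x : SeqAlg.{u} q T} (hx : x ∈ StarAlgebra.adjoin ℂ (Set.range (seqProj q T) ∪ {a})) :
    ∃ c, HasCoord μ x c := by
  have h := isProjFamily_seqProj.{u} hq T
  have hpow : ∀ j, ∃ c, HasCoord μ (a ^ (j + 1)) c := by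
    intro j
    refine ⟨_, hasCoord_of_tendstoInMeasure hq hr hμ (pow_mem ha _) (h.pow_corner hcorner j)
      (hν (cutPow hK (j + 1))) (c := fun _ => 1) (by simp) tendsto_const_nhds fun n => ?_⟩
    filter_upwards [hM n, hMK n, hMh n] with ω h1 h2 h3
    change blockTr (q n) k (a ⟨n⟩ (r n ω) ^ (j + 1)) = _
    rw [h1, embed_pow_succ, blockTr_embed, trace_pow_eq_integral hK h3 h2, one_mul]
  refine exists_hasCoord_of_mem_span ?_ (h.mem_span_pow hcorner (Or.inl hstar) hx)
  rintro _ (⟨i, rfl⟩ | ⟨n, rfl⟩ | ⟨n, rfl⟩)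
  · exact ⟨_, hasCoord_seqProj i⟩
  · exact hpow n
  · dsimp only
    rw [hstar]
    exact hpow n

/-- The clipped letter is exactly unitary in its corner, so the algebra is spanned by the projectors
and by the positive powers of the letter and of its adjoint, which are centered. -/
lemma exists_hasCoord_adjoin_haar
    {μ : ∀ n, Measure (ℕ × Fin d × Fin d → BMat (q n))} [∀ n, IsProbabilityMeasure (μ n)]
    (hq : ∀ n k, 0 < q n k) (hq_top : ∀ k, Tendsto (fun n => q n k) atTop atTop)
    (hμ : ∀ n t (U : BMat (q n)), IsBlockUnitary U →
      MeasurePreserving (conjCoord t U) (μ n) (μ n))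
    {K : ℝ} (hK : 1 ≤ K) {t : ℕ × Fin d × Fin d} (ht : t.2.1 = t.2.2) (hs : Odd t.1)
    (hleft : ∀ n (U : BMat (q n)), IsBlockUnitary U →
      MeasurePreserving (fun r => Function.update r t (U * r t)) (μ n) (μ n))
    (hgood : ∀ n, ∀ᵐ r ∂μ n, r t ∈ letterSet K t (q n))
    {x : SeqAlg.{u} q (ℕ × Fin d × Fin d)}
    (hx : x ∈ StarAlgebra.adjoin ℂ (Set.range (seqProj q _) ∪ {letterSeq q K t})) :
    ∃ c, HasCoord μ x c := by
  have h := isProjFamily_seqProj.{u} hq (ℕ × Fin d × Fin d)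
  have hcorner := letterSeq_corner.{u} hq hK t
  rw [← ht] at hcorner
  have hpow := isCentered_letterSeq_pow.{u} hq hq_top hμ hK ht hs hleft hgood
  refine exists_hasCoord_of_mem_span ?_
    (h.mem_span_pow hcorner (Or.inr (letterSeq_mul_star hq hK ht hs)) hx)
  rintro _ (⟨i, rfl⟩ | ⟨n, rfl⟩ | ⟨n, rfl⟩)
  · exact ⟨_, hasCoord_seqProj i⟩
  · exact ⟨0, (hpow n).hasCoord⟩
  · dsimp only
    rw [← star_pow]
    exact ⟨0, (hpow n).star.hasCoord⟩

/-- Stability under products and adjoints makes the span of the constants an algebra, since products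
of blocks with incompatible indices vanish. Only the traces of the constants themselves then matter.
-/
lemma exists_hasCoord_adjoin_const (hq : ∀ n k, 0 < q n k) {I : Type w} {κ lam : I → Fin d}
    {C : ∀ (i : I) (n : ℕ), Matrix (Fin (q n (κ i))) (Fin (q n (lam i))) ℂ}
    (hC_proj : ∀ k, ∃ i, ∀ n, embed (C i n) = blockProj (q n) k)
    (hC_mul : ∀ i j, lam i = κ j → ∃ m, ∀ n, embed (C m n) = embed (C i n) * embed (C j n))
    (hC_star : ∀ i, ∃ m, ∀ n, embed (C m n) = star (embed (C i n)))
    (hC_trace : ∀ i, κ i = lam i → ∃ t : ℂ, Tendsto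
      (fun n => blockTr (q n) (κ i) (embed (C i n))) atTop (𝓝 t))
    {K : ℝ} (hC_bdd : ∀ i n, opNorm (C i n) ≤ K)
    {x : SeqAlg.{u} q T} (hx : x ∈ StarAlgebra.adjoin ℂ (Set.range (seqProj q T) ∪
      Set.range fun i => constSeq q T fun n => embed (C i n))) :
    ∃ c, HasCoord μ x c := by
  have h := isProjFamily_seqProj.{u} hq T
  have hcorner : ∀ i, seqProj.{u} q T (κ i) * (constSeq q T fun n => embed (C i n))
      * seqProj q T (lam i) = constSeq q T fun n => embed (C i n) := fun i =>
    funext fun n => funext fun _ => blockProj_mul_embed_mul (C i n.down)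
  set W := Set.range fun i => constSeq.{u} q T fun n => embed (C i n) with hW
  have hprojW : ∀ k, seqProj q T k ∈ W := by
    intro k
    obtain ⟨i, hi⟩ := hC_proj k
    exact ⟨i, funext fun n => funext fun _ => hi n.down⟩
  have hmulW : ∀ x ∈ W, ∀ y ∈ W, x * y ∈ Submodule.span ℂ W := by
    rintro _ ⟨i, rfl⟩ _ ⟨j, rfl⟩
    by_cases hij : lam i = κ j
    · obtain ⟨m, hm⟩ := hC_mul i j hij
      exact Submodule.subset_span ⟨m, funext fun n => funext fun _ => hm n.down⟩
    · rw [h.mul_eq_zero_of_ne (hcorner i) (hcorner j) hij]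
      exact zero_mem _
  have hstarW : ∀ x ∈ W, star x ∈ W := by
    rintro _ ⟨i, rfl⟩
    obtain ⟨m, hm⟩ := hC_star i
    exact ⟨m, funext fun n => funext fun _ => hm n.down⟩
  have hgen : Set.range (seqProj q T) ∪ W = W :=
    Set.union_eq_right.2 (by rintro _ ⟨k, rfl⟩; exact hprojW k)
  rw [hgen] at hx
  refine exists_hasCoord_of_mem_span ?_ (mem_span_of_mem_adjoin (h.one_mem_span hprojW)
    (fun g hg w hw => ⟨hmulW g hg w hw, hmulW _ (hstarW g hg) w hw⟩) hx)
  rintro _ ⟨i, rfl⟩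
  have hb : (constSeq.{u} q T fun n => embed (C i n)) ∈ bddAlg q T :=
    constSeq_mem_bddAlg fun n => (norm_embed_le _).trans (hC_bdd i n)
  by_cases hi : κ i = lam i
  · obtain ⟨z, hz⟩ := hC_trace i hi
    have hc := hcorner i
    rw [← congrArg (seqProj q T) hi] at hc
    refine ⟨_, hasCoord_of_corner hq hb hc (z := z) ?_⟩
    have := tendsto_iff_norm_sub_tendsto_zero.1 hz
    refine this.congr fun n => ?_
    simp [constSeq]
  · exact ⟨0, (isCentered_of_corner hb hi (hcorner i)).hasCoord⟩

end LetterCoordinates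

/-! ### Invariance of the joint law under transformations of one letter -/

section JointLaw

open scoped Matrix Matrix.Norms.L2Operator

/-- A transformation of one coordinate of an independent family that preserves the law of this
coordinate preserves the joint law. -/
lemma measurePreserving_update {Ω T X : Type*} [DecidableEq T] [MeasurableSpace Ω]
    [MeasurableSpace X] {P : Measure Ω} [IsProbabilityMeasure P] {Y : T → Ω → X}
    (hY : ∀ t, Measurable (Y t)) (hind : ProbabilityTheory.iIndepFun Y P) (t : T) {f : X → X}
    (hf : Measurable f) (hinv : P.map (fun ω => f (Y t ω)) = P.map (Y t)) :
    MeasurePreserving (fun r : T → X => Function.update r t (f (r t)))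
      (P.map fun ω t => Y t ω) (P.map fun ω t => Y t ω) := by
  set g : T → X → X := fun t' => if t' = t then f else id with hg
  have hgm : ∀ t', Measurable (g t') := by
    intro t'
    by_cases h : t' = t
    · simpa [hg, h] using hf
    · simpa [hg, h] using measurable_id
  have e : (fun r : T → X => Function.update r t (f (r t))) = fun r t' => g t' (r t') := by
    ext r t'
    by_cases h : t' = t
    · subst h; simp [hg]
    · simp [hg, h]
  have hm : Measurable fun r : T → X => fun t' => g t' (r t') :=
    measurable_pi_lambda _ fun t' => (hgm t').comp (measurable_pi_apply t')
  have hlaw : ∀ t', P.map (g t' ∘ Y t') = P.map (Y t') := by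
    intro t'
    by_cases h : t' = t
    · subst h
      simpa [hg, Function.comp_def] using hinv
    · simp [hg, h]
  rw [e]
  refine ⟨hm, ?_⟩
  -- By independence the joint law is the product of the marginal laws both before and after the
  -- transformation, and the marginal laws agree.
  have h1 := (hind.comp g hgm).map_fun_eq_infinitePi_map fun t' => (hgm t').comp (hY t')
  rw [Measure.map_map hm (measurable_pi_lambda _ hY)]
  refine Eq.trans h1 ?_
  simp only [hlaw]
  exact (hind.map_fun_eq_infinitePi_map hY).symm

variable {Ω : Type*} [MeasurableSpace Ω] {P : Measure Ω} [IsProbabilityMeasure P] {d : ℕ}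
  {q : Fin d → ℕ}

lemma map_embed_eq {k l : Fin d} {R R' : Ω → Matrix (Fin (q k)) (Fin (q l)) ℂ}
    (hR : Measurable R) (hR' : Measurable R') (h : P.map R' = P.map R) :
    P.map (fun ω => (embed (R' ω) : BMat q)) = P.map fun ω => (embed (R ω) : BMat q) := by
  have h1 := Measure.map_map (μ := P) (measurable_embed (q := q)) hR
  have h2 := Measure.map_map (μ := P) (measurable_embed (q := q)) hR'
  rw [h] at h2
  exact h2.symm.trans h1

lemma measurable_mul_mul {m n : ℕ} (U : Matrix (Fin m) (Fin m) ℂ) (V : Matrix (Fin n) (Fin n) ℂ) :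
    Measurable fun M : Matrix (Fin m) (Fin n) ℂ => U * M * V :=
  Continuous.measurable (by fun_prop)

lemma BiUnitarilyInvariant.map_conj {k l : Fin d} {R : Ω → Matrix (Fin (q k)) (Fin (q l)) ℂ}
    (hR : Measurable R) (h : BiUnitarilyInvariant P R) {U : BMat q} (hU : IsBlockUnitary U) :
    P.map (fun ω => U * embed (R ω) * star U) = P.map fun ω => (embed (R ω) : BMat q) := by
  simp only [hU.conj_embed]
  have h1 := h ⟨_, hU.diagBlock_mem k⟩ ⟨_, Unitary.star_mem (hU.diagBlock_mem l)⟩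
  exact map_embed_eq hR ((measurable_mul_mul _ _).comp hR) h1

lemma UnitarilyInvariant.map_conj {k : Fin d} {R : Ω → Matrix (Fin (q k)) (Fin (q k)) ℂ}
    (hR : Measurable R) (h : UnitarilyInvariant P R) {U : BMat q} (hU : IsBlockUnitary U) :
    P.map (fun ω => U * embed (R ω) * star U) = P.map fun ω => (embed (R ω) : BMat q) := by
  simp only [hU.conj_embed]
  have h1 := h ⟨_, hU.diagBlock_mem k⟩
  exact map_embed_eq hR ((measurable_mul_mul _ _).comp hR) h1

lemma UniformUnitary.map_conj {k : Fin d} {R : Ω → Matrix (Fin (q k)) (Fin (q k)) ℂ}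
    (hR : Measurable R) (h : UniformUnitary P R) {U : BMat q} (hU : IsBlockUnitary U) :
    P.map (fun ω => U * embed (R ω) * star U) = P.map fun ω => (embed (R ω) : BMat q) := by
  simp only [hU.conj_embed]
  have h1 := uniformUnitary_map_mul hR h ⟨_, hU.diagBlock_mem k⟩
    ⟨_, Unitary.star_mem (hU.diagBlock_mem k)⟩
  exact map_embed_eq hR ((measurable_mul_mul _ _).comp hR) h1

lemma UniformUnitary.map_mul {k : Fin d} {R : Ω → Matrix (Fin (q k)) (Fin (q k)) ℂ}
    (hR : Measurable R) (h : UniformUnitary P R) {U : BMat q} (hU : IsBlockUnitary U) :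
    P.map (fun ω => U * embed (R ω)) = P.map fun ω => (embed (R ω) : BMat q) := by
  simp only [hU.mul_embed]
  have h1 := uniformUnitary_map_mul hR h ⟨_, hU.diagBlock_mem k⟩ 1
  simp only [OneMemClass.coe_one, mul_one] at h1
  refine map_embed_eq hR ?_ h1
  simpa [Function.comp_def] using (measurable_mul_mul (diagBlock U k) 1).comp hR

end JointLaw

end RectFree

/-! ### Assembly of the limit space for the given matrices -/

theorem theorem18p1p05p1
    {Ω : Type v} [MeasurableSpace Ω] (P : Measure Ω) [IsProbabilityMeasure P]
    (d : ℕ) [NeZero d]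
    -- the sizes; the index `0` of `Fin d` plays the role of the block whose ratio vanishes
    (q : ℕ → Fin d → ℕ) (hq : ∀ n k, 0 < q n k)
    (hq_inj : ∀ n, Function.Injective (q n))
    (hq_top : ∀ k, Tendsto (fun n => q n k) atTop atTop)
    (ρ : Fin d → ℝ)
    (hρ : ∀ k, Tendsto (fun n => (q n k : ℝ) / ((∑ l, q n l : ℕ) : ℝ)) atTop (𝓝 (ρ k)))
    (hρ_zero : ρ 0 = 0) (hρ_pos : ∀ k, k ≠ 0 → 0 < ρ k)
    -- the random matrices
    (R : ℕ → ∀ k l : Fin d, ∀ n, Ω → Matrix (Fin (q n k)) (Fin (q n l)) ℂ)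
    (hR_meas : ∀ s k l n, Measurable (R s k l n))
    (hR_indep : ∀ n, ProbabilityTheory.iIndepFun
      (fun t : ℕ × Fin d × Fin d => R t.1 t.2.1 t.2.2 n) P)
    (hR_biinv : ∀ s k l, k ≠ l → ∀ n, RectFree.BiUnitarilyInvariant P (R s k l n))
    (hR_sing : ∀ s k l, k ≠ l → ∃ μ : Measure ℝ, IsProbabilityMeasure μ ∧
      RectFree.WeakConvInProb P (fun n ω => RectFree.singularLaw (R s k l n ω)) μ)
    (hR_odd : ∀ s, Odd s → ∀ k n, RectFree.UniformUnitary P (R s k k n))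
    (hR_herm : ∀ s, Even s → ∀ k n, ∀ᵐ ω ∂P, (R s k k n ω).IsHermitian)
    (hR_inv : ∀ s, Even s → ∀ k n, RectFree.UnitarilyInvariant P (R s k k n))
    (hR_spec : ∀ s, Even s → ∀ k, ∃ μ : Measure ℝ, IsProbabilityMeasure μ ∧
      RectFree.WeakConvInProb P (fun n ω => RectFree.spectralLaw (R s k k n ω)) μ)
    -- deterministic singular values and spectra
    (hR_sing_det : ∀ s k l, k ≠ l → ∀ n, ∃ h : Fin (min (q n k) (q n l)) → ℝ,
      ∀ᵐ ω ∂P, RectFree.singVal (R s k l n ω) = h)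
    (hR_spec_det : ∀ s, Even s → ∀ k n, ∃ σ : Multiset ℂ,
      ∀ᵐ ω ∂P, RectFree.spec (R s k k n ω) = σ)
    -- the deterministic diagonal matrices
    {I : Type u} (κ lam : I → Fin d)
    (C : ∀ (i : I) (n : ℕ), Matrix (Fin (q n (κ i))) (Fin (q n (lam i))) ℂ)
    (hC_diag : ∀ i n (a : Fin (q n (κ i))) (b : Fin (q n (lam i))),
      (a : ℕ) ≠ (b : ℕ) → C i n a b = 0)
    (hC_proj : ∀ k, ∃ i, ∀ n, RectFree.embed (C i n) = RectFree.blockProj (q n) k)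
    (hC_mul : ∀ i j, lam i = κ j → ∃ m, ∀ n,
      RectFree.embed (C m n) = RectFree.embed (C i n) * RectFree.embed (C j n))
    (hC_star : ∀ i, ∃ m, ∀ n, RectFree.embed (C m n) = star (RectFree.embed (C i n)))
    (hC_trace : ∀ i, κ i = lam i → ∃ t : ℂ, Tendsto
      (fun n => RectFree.blockTr (q n) (κ i) (RectFree.embed (C i n))) atTop (𝓝 t))
    -- the uniform bound on operator norms
    (K : ℝ) (hR_bdd : ∀ s k l n, ∀ᵐ ω ∂P, RectFree.opNorm (R s k l n ω) ≤ K)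
    (hC_bdd : ∀ i n, RectFree.opNorm (C i n) ≤ K) :
    ∃ (A : Type u) (_ : Ring A) (_ : StarRing A) (_ : Algebra ℂ A) (_ : StarModule ℂ A)
      (S : RectFree.RectSpace ρ A) (a : ℕ × Fin d × Fin d → A) (c : I → A),
      RectFree.DConvInProb P q hq
        (fun n j ω => Sum.elim
          (fun t : ℕ × Fin d × Fin d => RectFree.embed (R t.1 t.2.1 t.2.2 n ω))
          (fun i : I => RectFree.embed (C i n)) j)
        S (Sum.elim a c) ∧
      RectFree.FreeSubsets S.diag S.condExp
        (fun o : Option (ℕ × Fin d × Fin d) => o.elim (Set.range c) (fun t => {a t})) := by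
  set T := ℕ × Fin d × Fin d with hT
  -- The bound is raised to `1` so that the projectors, default values of the odd diagonal letters,
  -- satisfy it.
  set K' := max K 1 with hK'
  have hK1 : 1 ≤ K' := le_max_right _ _
  have hK0 : 0 ≤ K' := zero_le_one.trans hK1
  set r : ∀ n, Ω → T → RectFree.BMat (q n) :=
    fun n ω t => RectFree.embed (R t.1 t.2.1 t.2.2 n ω) with hr
  have hrt : ∀ n t, Measurable fun ω => r n ω t := fun n t =>
    RectFree.measurable_embed.comp (hR_meas _ _ _ _)
  have hrm : ∀ n, Measurable (r n) := fun n => measurable_pi_lambda _ (hrt n)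
  set μ : ∀ n, Measure (T → RectFree.BMat (q n)) := fun n => P.map (r n) with hμ
  have hprob : ∀ n, IsProbabilityMeasure (μ n) := fun n =>
    Measure.isProbabilityMeasure_map (hrm n).aemeasurable
  have hind : ∀ n, ProbabilityTheory.iIndepFun (fun t ω => r n ω t) P := fun n =>
    (hR_indep n).comp (fun _ => RectFree.embed) fun _ => RectFree.measurable_embed
  have hinv : ∀ n t (U : RectFree.BMat (q n)), RectFree.IsBlockUnitary U →
      MeasurePreserving (RectFree.conjCoord t U) (μ n) (μ n) := by
    intro n t U hU
    refine RectFree.measurePreserving_update (hrt n) (hind n) t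
      (f := fun M => U * M * star U) (by fun_prop) ?_
    obtain ⟨s, k, l⟩ := t
    by_cases hkl : k = l
    · subst hkl
      rcases Nat.even_or_odd s with hs | hs
      · exact (hR_inv s hs k n).map_conj (hR_meas _ _ _ _) hU
      · exact (hR_odd s hs k n).map_conj (hR_meas _ _ _ _) hU
    · exact (hR_biinv s k l hkl n).map_conj (hR_meas _ _ _ _) hU
  have hRK : ∀ s k l n, ∀ᵐ ω ∂P, RectFree.opNorm (R s k l n ω) ≤ K' := fun s k l n =>
    (hR_bdd s k l n).mono fun ω hω => hω.trans (le_max_left _ _)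
  have hgood : ∀ n t, ∀ᵐ ω ∂P, r n ω t ∈ RectFree.letterSet K' t (q n) := by
    rintro n ⟨s, k, l⟩
    by_cases hkl : k = l
    · subst hkl
      rcases Nat.even_or_odd s with hs | hs
      · filter_upwards [hRK s k k n, hR_herm s hs k n] with ω h1 h2
        refine ⟨(RectFree.norm_embed_le _).trans h1, RectFree.blockProj_mul_embed_mul _,
          fun _ _ => ?_, fun _ e => absurd hs (Nat.not_even_iff_odd.2 e)⟩
        change star (RectFree.embed (R s k k n ω)) = RectFree.embed (R s k k n ω)
        rw [RectFree.star_embed, h2.eq]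
      · filter_upwards [hRK s k k n, (hR_odd s hs k n).ae_mem (hR_meas _ _ _ _)] with ω h1 h2
        refine ⟨(RectFree.norm_embed_le _).trans h1, RectFree.blockProj_mul_embed_mul _,
          fun _ e => absurd hs (Nat.not_odd_iff_even.2 e), fun _ _ => ?_⟩
        change RectFree.embed (R s k k n ω) * star (RectFree.embed (R s k k n ω))
            = RectFree.blockProj (q n) k ∧ star (RectFree.embed (R s k k n ω))
            * RectFree.embed (R s k k n ω) = RectFree.blockProj (q n) k
        rw [RectFree.star_embed, RectFree.embed_mul_embed, RectFree.embed_mul_embed,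
          ← Matrix.star_eq_conjTranspose, Unitary.mul_star_self_of_mem h2,
          Unitary.star_mul_self_of_mem h2]
        exact ⟨rfl, rfl⟩
    · filter_upwards [hRK s k l n] with ω h1
      exact ⟨(RectFree.norm_embed_le _).trans h1, RectFree.blockProj_mul_embed_mul _,
        fun e => absurd e hkl, fun e => absurd e hkl⟩
  set cseq : I → RectFree.SeqAlg.{u} q T := fun i =>
    RectFree.constSeq q T fun n => RectFree.embed (C i n) with hcseq
  -- The index `none` carries the deterministic matrices, which no conjugation of a coordinate
  -- moves.
  set B : Option T → StarSubalgebra ℂ (RectFree.SeqAlg.{u} q T) := fun o =>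
    StarAlgebra.adjoin ℂ (Set.range (RectFree.seqProj q T) ∪
      o.elim (Set.range cseq) fun t => {RectFree.letterSeq q K' t}) with hB
  have hcB : ∀ i, cseq i ∈ B none := fun i =>
    StarAlgebra.subset_adjoin ℂ _ (Or.inr ⟨i, rfl⟩)
  have haB : ∀ t, RectFree.letterSeq q K' t ∈ B (some t) := fun t =>
    StarAlgebra.subset_adjoin ℂ _ (Or.inr rfl)
  have hletter : ∀ n t, ∀ᵐ ω ∂P, RectFree.letterSeq.{u} q K' t ⟨n⟩ (r n ω) = r n ω t := fun n t =>
    (hgood n t).mono fun ω hω => RectFree.clipLetter_of_mem hω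
  -- Of two distinct blocks at most one has vanishing ratio.
  have hratio : ∀ k l : Fin d, k ≠ l →
      ∃ c, Tendsto (fun n => ((min (q n k) (q n l) : ℕ) : ℝ) / q n k) atTop (𝓝 c) := by
    intro k l hkl
    refine RectFree.exists_tendsto_min_div hq hρ ?_
    by_cases hk : k = 0
    · exact Or.inr (hρ_pos l fun hl => hkl (hk.trans hl.symm))
    · exact Or.inl (hρ_pos k hk).ne'
  have hfree : RectFree.AsympFree q ρ μ B :=
    { prob := hprob
      pos := hq
      top := hq_top
      ratio := hρ
      inv := hinv
      proj := fun α k => StarAlgebra.subset_adjoin ℂ _ (Or.inl ⟨k, rfl⟩)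
      coord := by
        rintro (_ | ⟨s, k, l⟩) x hx
        · exact RectFree.exists_hasCoord_adjoin_const hq hC_proj hC_mul hC_star hC_trace hC_bdd hx
        · by_cases hkl : k = l
          · subst hkl
            rcases Nat.even_or_odd s with hs | hs
            · obtain ⟨ν, _, hν⟩ := hR_spec s hs k
              exact RectFree.exists_hasCoord_adjoin_hermitian hq hrm (fun _ => rfl)
                (RectFree.letterSeq_mem_bddAlg hq hK1 _)
                (RectFree.letterSeq_corner hq hK1 (s, k, k))
                (RectFree.star_letterSeq hq hK1 rfl hs) (fun n => hletter n (s, k, k))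
                (hR_herm s hs k) hK0 (hRK s k k) hν hx
            · refine RectFree.exists_hasCoord_adjoin_haar hq hq_top hinv hK1
                (t := (s, k, k)) rfl hs (fun n U hU => ?_) (fun n => ?_) hx
              · exact RectFree.measurePreserving_update (hrt n) (hind n) (s, k, k)
                  (f := fun M => U * M) (by fun_prop)
                  ((hR_odd s hs k n).map_mul (hR_meas _ _ _ _) hU)
              · exact (ae_map_iff (hrm n).aemeasurable (measurable_pi_apply _
                  (RectFree.measurableSet_letterSet K' (s, k, k)))).2 (hgood n _)
          · obtain ⟨ν, _, hν⟩ := hR_sing s k l hkl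
            exact RectFree.exists_hasCoord_adjoin_rect hq hrm (fun _ => rfl) hkl
              (RectFree.letterSeq_mem_bddAlg hq hK1 _)
              (RectFree.letterSeq_corner hq hK1 (s, k, l)) (fun n => hletter n (s, k, l)) hK0
              (hRK s k l) hν (hratio k l hkl) (hratio l k (Ne.symm hkl)) hx
      equiv := by
        rintro (_ | t) <;> refine StarAlgebra.adjoin_le (Set.union_subset ?_ ?_)
        · rintro _ ⟨k, rfl⟩
          exact RectFree.seqProj_mem_equivAlg _ _
        · rintro _ ⟨i, rfl⟩
          exact RectFree.constSeq_mem_equivAlg _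
        · rintro _ ⟨k, rfl⟩
          exact RectFree.seqProj_mem_equivAlg _ _
        · rintro _ rfl
          exact RectFree.letterSeq_mem_equivAlg hq K' t }
  set a : T → RectFree.genAlg B := fun t =>
    ⟨RectFree.letterSeq q K' t, RectFree.le_genAlg B _ (haB t)⟩ with ha
  set c : I → RectFree.genAlg B := fun i => ⟨cseq i, RectFree.le_genAlg B _ (hcB i)⟩ with hc
  -- The subalgebras that witness freeness are the generating algebras `B o`, seen inside the
  -- algebra that they generate.
  refine ⟨RectFree.genAlg B, inferInstance, inferInstance, inferInstance, inferInstance,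
    hfree.limitSpace, a, c, ?_, fun o => (B o).comap (RectFree.genAlg B).subtype, ?_,
    hfree.freeSubalgebras⟩
  · refine hfree.dConvInProb P hrm (fun _ => rfl) (Sum.elim a c) ?_ _ fun n => ?_
    · rintro (t | i)
      · exact ⟨t.2.1, t.2.2, Subtype.ext (RectFree.letterSeq_corner hq hK1 t)⟩
      · exact ⟨κ i, lam i, hfree.coe_apply_injective fun n _ =>
          RectFree.blockProj_mul_embed_mul (C i n.down)⟩
    -- There are countably many random letters, so almost surely none of them is modified by the
    -- clipping.
    · filter_upwards [ae_all_iff.2 (hletter n)] with ω hω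
      rintro (t | i)
      · exact (hω t).symm
      · rfl
  · rintro (_ | t)
    · rintro _ ⟨i, rfl⟩
      exact hcB i
    · rintro _ rfl
      exact haB t
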